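/- **Setting.** Let $G_0$ be a group with identity $e_0$, let $A,B\le G_0$ be finite subgroups, $\varphi:A\to B$ an isomorphism, and let $G=\langle G_0,t\mid at=t\varphi(a),\ a\in A\rangle$ be the HNN extension, with identity $e$. Let $X$ and $Y$ be sets of representatives of the left cosets of $A$, respectively of $B$, in $G_0$, with $e_0\in X\cap Y$. Every $g\in G$ has a unique normal form $g=g_1t_1g_2t_2\cdots g_nt_ng_{n+1}$ with $t_i\in\{t,t^{-1}\}$, $g_i\in X$ if $t_i=t$, $g_i\in Y$ if $t_i=t^{-1}$ (for $i\le n$), $g_{n+1}\in G_0$, and without subwords $te_0t^{-1}$, $t^{-1}e_0t$; put $|g|_t:=n$. Let $\mu_0$ be a finitely supported probability measure on $G_0$ whose support generates $G_0$ as a semigroup, let $\alpha,p\in(0,1)$, and exclude the case that both $A=B=G_0$ and $p=\frac12$. Let $(X_n)_{n\ge 0}$ be the random walk $X_0=e$, $X_n=\zeta_1\cdots\zeta_n$ with i.i.d. increments of law $\mu=\alpha\mu_0+(1-\alpha)\bigl(p\,\delta_t+(1-p)\,\delta_{t^{-1}}\bigr)$; $\mathbb P_x$ refers to the walk started in $x$.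 Write $\mathbb N=\{1,2,\dots\}$. For $k\ge 0$ let $\mathbf e_k=\min\{m\ge 0: |X_n|_t\ge k\ \text{for all } n\ge m\}$, and for $k\ge1$ let $\mathbf i_k=\mathbf e_k-\mathbf e_{k-1}$ and $\mathbf W_k=g_kt_kh$, where $X_{\mathbf e_k}=g_1t_1\cdots g_kt_kh$ in normal form. Put $$\mathcal D=\{gth: g\in X,h\in B\}\cup\{gt^{-1}h: g\in Y,h\in A\},\qquad \mathcal D_0=\{th:h\in B\}\cup\{t^{-1}h:h\in A\},$$ $$\mathbb D=\bigl\{(gt'h,n)\in\mathcal D\times\mathbb N:\ \exists\, g_1t_1h_1\in\mathcal D,\ \mathbb P[X_{\mathbf e_1}=g_1t_1h_1,\ X_{\mathbf e_2}=g_1t_1gt'h,\ \mathbf i_2=n]>0\bigr\},$$ and $\xi(t'h)=\mathbb P_{t'h}[X_n\notin G_0\ \text{for all } n\ge1]$ for $t'h\in\mathcal D_0$. For $(w_1t_1h_1,m),(w_2t_2h_2,n)\in\mathcal D\times\mathbb N$ let $$q\bigl((w_1t_1h_1,m),(w_2t_2h_2,n)\bigr)=\frac{\xi(t_2h_2)}{\xi(t_1h_1)}\,\mathbb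 P_{t_1h_1}\bigl[X_n=t_1w_2t_2h_2,\ |X_{n-1}|_t=1,\ \forall n'<n: |X_{n'}|_t\ge1\bigr]$$ if $t_1w_2t_2\ne e$, and $q=0$ otherwise; also $q=0$ if $\xi(t_1h_1)=0$ (which happens only if $A=B=G_0$). This does not depend on $w_1$ and $m$. **Proposition.** Almost surely, $\mathbf e_k<\infty$ for all $k\ge 0$, and $(\mathbf W_k,\mathbf i_k)\in\mathcal D\times\mathbb N$ for all $k\ge1$. 1. For every $k\ge2$, $(\mathbf W_k,\mathbf i_k)\in\mathbb D$ almost surely, and $\mathbb P[(\mathbf W_k,\mathbf i_k)=s]>0$ if and only if $s\in\mathbb D$. 2. $(\mathbf W_k,\mathbf i_k)_{k\in\mathbb N}$ is a time-homogeneous Markov chain with transition probabilities $q$: for all $k\ge1$, all $s_1,\dots,s_k$ with $\mathbb P[(\mathbf W_j,\mathbf i_j)=s_j,\ 1\le j\le k]>0$ and all $s'\in\mathbb D$, $$\mathbb P\bigl[(\mathbf W_{k+1},\mathbf i_{k+1})=s'\mid (\mathbf W_j,\mathbf i_j)=s_j,\ 1\le j\le k\bigr]=q(s_k,s'),$$ and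 likewise $\mathbb P[(\mathbf W_{k+1},\mathbf i_{k+1})=s'\mid(\mathbf W_k,\mathbf i_k)=s]=q(s,s')$ whenever $\mathbb P[(\mathbf W_k,\mathbf i_k)=s]>0$. 3. The matrix $(q(s,s'))_{s,s'\in\mathbb D}$ is stochastic, irreducible, aperiodic and positive recurrent (from every state the chain returns with probability one and in finite mean time). 4. For $t_1h_1,t_2h_2\in\mathcal D_0$ let $q_{\mathbf h}(t_1h_1,t_2h_2)=\sum_{g}\sum_{n\in\mathbb N}q\bigl((e_0t_1h_1,m),(gt_2h_2,n)\bigr)$, where $g$ runs over $X$ if $t_2=t$ and over $Y$ if $t_2=t^{-1}$ (the term $g=e_0$ is zero if $t_2=t_1^{-1}$). There is exactly one probability vector $\nu_{\mathbf h}$ on $\mathcal D_0$ with $\nu_{\mathbf h}q_{\mathbf h}=\nu_{\mathbf h}$; it vanishes at all $t_0h_0$ with $\xi(t_0h_0)=0$, and $$\pi(w_1t_1h_1,n)=\sum_{t_0h_0\in\mathcal D_0}\nu_{\mathbf h}(t_0h_0)\,q\bigl((e_0t_0h_0,m),(w_1t_1h_1,n)\bigr),\qquad (w_1t_1h_1,n)\in\mathbb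 D,$$ is an invariant probability measure of $(q(s,s'))_{s,s'\in\mathbb D}$. -/

import Mathlib

open MeasureTheory

/-! ### Markov chains with countable state space, given by a transition matrix -/

namespace MarkovMatrix

/-- All rows sum to `1`. -/
def IsStochastic {S : Type*} (Q : S → S → ENNReal) : Prop :=
  ∀ s, ∑' s', Q s s' = 1

open scoped Classical in
/-- The `n`-step transition probabilities. -/
noncomputable def nStep {S : Type*} (Q : S → S → ENNReal) : ℕ → S → S → ENNReal
  | 0, s, s' => if s = s' then 1 else 0
  | n + 1, s, s' => ∑' u, Q s u * nStep Q n u s'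

/-- Every state can be reached from every state (in at least one step). -/
def IsIrreducible {S : Type*} (Q : S → S → ENNReal) : Prop :=
  ∀ s s', ∃ n, 1 ≤ n ∧ 0 < nStep Q n s s'

/-- The greatest common divisor of the possible return times is `1`, for every state. -/
def IsAperiodic {S : Type*} (Q : S → S → ENNReal) : Prop :=
  ∀ s, ∀ d : ℕ, (∀ n, 1 ≤ n → 0 < nStep Q n s s → d ∣ n) → d = 1

/-- `firstHit Q s n u` is the probability that the chain started in `u` visits `s`
at time `n + 1`, and at none of the times `1, …, n`. -/
noncomputable def firstHit {S : Type*} (Q : S → S → ENNReal) (s : S) : ℕ → S → ENNReal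
  | 0, u => Q u s
  | n + 1, u => ∑' v : {v : S // v ≠ s}, Q u v * firstHit Q s n v

/-- From every state the chain returns with probability one, in finite mean time. -/
def IsPositiveRecurrent {S : Type*} (Q : S → S → ENNReal) : Prop :=
  ∀ s, ∑' n, firstHit Q s n s = 1 ∧ ∑' n : ℕ, ((n : ENNReal) + 1) * firstHit Q s n s < ⊤

/-- `ν` is a probability vector with `ν Q = ν`. -/
def IsInvariantLaw {S : Type*} (Q : S → S → ENNReal) (ν : S → ENNReal) : Prop :=
  ∑' s, ν s = 1 ∧ ∀ s', ∑' s, ν s * Q s s' = ν s'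

end MarkovMatrix

/-! ### The HNN extension, normal forms and the random walk -/

namespace HNNWalk

/-- The HNN extension `⟨G₀, t | a t = t φ(a) for a ∈ A⟩`. The convention of
`HNNExtension G A B φ` is `t a = φ(a) t`, so that the roles of `A` and `B` are exchanged. -/
abbrev HNN {G₀ : Type*} [Group G₀] {A B : Subgroup G₀} (φ : A ≃* B) : Type _ :=
  HNNExtension G₀ B A φ.symm

instance instMeasurableSpaceHNN {G₀ : Type*} [Group G₀] {A B : Subgroup G₀} (φ : A ≃* B) :
    MeasurableSpace (HNNExtension G₀ A B φ) := ⊤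

/-- The defining relation `a t = t φ(a)`. -/
theorem of_mul_t_eq {G₀ : Type*} [Group G₀] {A B : Subgroup G₀} (φ : A ≃* B) (a : A) :
    (HNNExtension.of (a : G₀) * HNNExtension.t : HNN φ)
      = HNNExtension.t * HNNExtension.of (φ a : G₀) := by
  rw [HNNExtension.t_mul_of (φ := φ.symm) (φ a)]
  simp

/-- Letter blocks `g t^ε h` with `g, h ∈ G₀` and `ε = ±1`. -/
@[ext] structure Block (G₀ : Type*) where
  /-- the letter `g` -/
  rep : G₀
  /-- the sign `ε` -/
  sign : ℤˣ
  /-- the letter `h` -/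
  tail : G₀

instance instInhabitedBlock {G₀ : Type*} [Group G₀] : Inhabited (Block G₀) := ⟨⟨1, 1, 1⟩⟩

section

variable {G₀ : Type*} [Group G₀] {A B : Subgroup G₀}

/-- The group element `t^ε`. -/
def tPow (φ : A ≃* B) (ε : ℤˣ) : HNN φ := HNNExtension.t ^ (ε : ℤ)

/-- The representatives allowed in front of `t^ε`: those in `X` for `t`, in `Y` for `t⁻¹`. -/
def reps (X Y : Set G₀) (ε : ℤˣ) : Set G₀ := if ε = 1 then X else Y

/-- The subgroup from which the letter right after `t^ε` is taken when the walk has just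
made the step `t^ε`: `B` for `t`, and `A` for `t⁻¹`. -/
def tailGroup (A B : Subgroup G₀) (ε : ℤˣ) : Subgroup G₀ := if ε = 1 then B else A

/-- The group element `g₁ t₁ g₂ t₂ ⋯ gₙ tₙ`. -/
def word (φ : A ≃* B) (l : List (G₀ × ℤˣ)) : HNN φ :=
  (l.map fun x => HNNExtension.of x.1 * tPow φ x.2).prod

/-- The word `g₁ t₁ g₂ t₂ ⋯ gₙ tₙ` (followed by an arbitrary element of `G₀`) is in normal
form: every `gᵢ` is an allowed representative, and there is no `t 1 t⁻¹` and no `t⁻¹ 1 t`. -/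
def IsNormal (X Y : Set G₀) (l : List (G₀ × ℤˣ)) : Prop :=
  (∀ x ∈ l, x.1 ∈ reps X Y x.2) ∧ l.IsChain fun x y => y.1 = 1 → x.2 = y.2

/-- The `t`-length of `g`: the number of letters `t^{±1}` in the normal form of `g`. -/
noncomputable def tLength (φ : A ≃* B) (X Y : Set G₀) (g : HNN φ) : ℕ :=
  sInf {n | ∃ l h, IsNormal X Y l ∧ word φ l * HNNExtension.of h = g ∧ l.length = n}

/-- The group element `t^ε h`. -/
def tailVal (φ : A ≃* B) (ε : ℤˣ) (h : G₀) : HNN φ := tPow φ ε * HNNExtension.of h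

/-- The group element `g t^ε h`. -/
def Block.val (φ : A ≃* B) (b : Block G₀) : HNN φ :=
  HNNExtension.of b.rep * tailVal φ b.sign b.tail

/-- The set of all `g t h` with `g ∈ X`, `h ∈ B`, and all `g t⁻¹ h` with `g ∈ Y`, `h ∈ A`. -/
def blocks (A B : Subgroup G₀) (X Y : Set G₀) : Set (Block G₀) :=
  {b | b.rep ∈ reps X Y b.sign ∧ b.tail ∈ tailGroup A B b.sign}

/-- The block `gₖ tₖ h` of an element with normal form `g₁ t₁ ⋯ gₖ tₖ h`, where `k ≥ 1`
(an arbitrary block if there is none). -/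
noncomputable def lastBlock (φ : A ≃* B) (X Y : Set G₀) (g : HNN φ) : Block G₀ :=
  Classical.epsilon fun b => ∃ l, IsNormal X Y (l ++ [(b.rep, b.sign)]) ∧
    word φ l * b.val φ = g

/-- The law `α μ₀ + (1 - α) (p δ_t + (1 - p) δ_{t⁻¹})` of a step. -/
noncomputable def stepLaw (φ : A ≃* B) (μ₀ : PMF G₀) (α p : ℝ) : Measure (HNN φ) :=
  ENNReal.ofReal α • (μ₀.map (HNNExtension.of : G₀ →* HNN φ)).toMeasure
    + ENNReal.ofReal (1 - α) •
      (ENNReal.ofReal p • Measure.dirac (HNNExtension.t : HNN φ)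
        + ENNReal.ofReal (1 - p) • Measure.dirac (HNNExtension.t : HNN φ)⁻¹)

variable {Ω : Type*}

/-- The walk with increments `ζ 0, ζ 1, …` that starts in `x`. -/
def walk {φ : A ≃* B} (ζ : ℕ → Ω → HNN φ) (x : HNN φ) : ℕ → Ω → HNN φ
  | 0, _ => x
  | n + 1, ω => walk ζ x n ω * ζ n ω

/-- The exit time `eₖ = min {m | |Xₙ|_t ≥ k for all n ≥ m}` of the walk started in `1`. -/
noncomputable def exitTime {φ : A ≃* B} (X Y : Set G₀) (ζ : ℕ → Ω → HNN φ) (k : ℕ) (ω : Ω) : ℕ :=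
  sInf {m | ∀ n, m ≤ n → k ≤ tLength φ X Y (walk ζ 1 n ω)}

/-- The pair `(Wₖ, iₖ)` of the last stabilized block at time `eₖ` and of
`iₖ = eₖ - eₖ₋₁`; it is meant for `k ≥ 1`. -/
noncomputable def exitChain {φ : A ≃* B} (X Y : Set G₀) (ζ : ℕ → Ω → HNN φ) (k : ℕ) (ω : Ω) :
    Block G₀ × ℕ :=
  (lastBlock φ X Y (walk ζ 1 (exitTime X Y ζ k ω) ω),
    exitTime X Y ζ k ω - exitTime X Y ζ (k - 1) ω)

variable [MeasurableSpace Ω]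

/-- The state space: all `(b, n)` with `b` in `blocks A B X Y` and `n ≥ 1` such that, for some
`g₁ t₁ h₁` in `blocks A B X Y`, the event `X_{e₁} = g₁ t₁ h₁`, `X_{e₂} = g₁ t₁ b`, `i₂ = n`
has positive probability. -/
def stateSpace {φ : A ≃* B} (X Y : Set G₀) (P : Measure Ω) (ζ : ℕ → Ω → HNN φ) :
    Set (Block G₀ × ℕ) :=
  {s | s.1 ∈ blocks A B X Y ∧ 1 ≤ s.2 ∧ ∃ b₁ ∈ blocks A B X Y,
    0 < P {ω | walk ζ 1 (exitTime X Y ζ 1 ω) ω = b₁.val φ ∧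
      walk ζ 1 (exitTime X Y ζ 2 ω) ω
        = HNNExtension.of b₁.rep * tPow φ b₁.sign * s.1.val φ ∧
      exitTime X Y ζ 2 ω - exitTime X Y ζ 1 ω = s.2}}

/-- The escape probability `ξ(t^ε h)`: the walk started in `t^ε h` never visits `G₀`. -/
noncomputable def xi {φ : A ≃* B} (P : Measure Ω) (ζ : ℕ → Ω → HNN φ) (ε : ℤˣ) (h : G₀) :
    ENNReal :=
  P {ω | ∀ n, 1 ≤ n → walk ζ (tailVal φ ε h) n ω ∉ Set.range (HNNExtension.of : G₀ →* HNN φ)}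

open scoped Classical in
/-- `q((w₁ t₁ h₁, m), (w₂ t₂ h₂, n))`; it depends on `t₁ h₁`, `w₂ t₂ h₂` and `n` only. -/
noncomputable def transProb {φ : A ≃* B} (X Y : Set G₀) (P : Measure Ω) (ζ : ℕ → Ω → HNN φ)
    (s s' : Block G₀ × ℕ) : ENNReal :=
  if tPow φ s.1.sign * HNNExtension.of s'.1.rep * tPow φ s'.1.sign ≠ 1 then
    xi P ζ s'.1.sign s'.1.tail / xi P ζ s.1.sign s.1.tail *
      P {ω | walk ζ (tailVal φ s.1.sign s.1.tail) s'.2 ω = tPow φ s.1.sign * s'.1.val φ ∧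
        tLength φ X Y (walk ζ (tailVal φ s.1.sign s.1.tail) (s'.2 - 1) ω) = 1 ∧
        ∀ n, n < s'.2 → 1 ≤ tLength φ X Y (walk ζ (tailVal φ s.1.sign s.1.tail) n ω)}
  else 0

/-- The transition matrix of the exit chain on its state space. -/
noncomputable def chainMatrix {φ : A ≃* B} (X Y : Set G₀) (P : Measure Ω) (ζ : ℕ → Ω → HNN φ)
    (s s' : stateSpace X Y P ζ) : ENNReal :=
  transProb X Y P ζ s s'

/-- The finite set of all `t h` with `h ∈ B` and all `t⁻¹ h` with `h ∈ A`. -/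
abbrev Tails (A B : Subgroup G₀) : Type _ := {c : ℤˣ × G₀ // c.2 ∈ tailGroup A B c.1}

/-- The state `(1 t^ε h, 1)`; the second entry plays no role as long as transitions out of this
state are considered. -/
def tailState (c : Tails A B) : Block G₀ × ℕ := (⟨1, c.1.1, c.1.2⟩, 1)

/-- The transition matrix `q_h(t₁ h₁, t₂ h₂)`: the sum of `q((1 t₁ h₁, m), (g t₂ h₂, n))` over
all `n ≥ 1` and all representatives `g` allowed in front of `t₂`. The summand with `g = 1` and
`t₂ = t₁⁻¹` vanishes, by the definition of `q`. -/
noncomputable def tailMatrix {φ : A ≃* B} (X Y : Set G₀) (P : Measure Ω) (ζ : ℕ → Ω → HNN φ)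
    (c c' : Tails A B) : ENNReal :=
  ∑' (g : reps X Y c'.1.1) (n : ℕ),
    transProb X Y P ζ (tailState c) (⟨g, c'.1.1, c'.1.2⟩, n + 1)

/-- `π(w₁ t₁ h₁, n) = ∑ ν(t₀ h₀) q((1 t₀ h₀, m), (w₁ t₁ h₁, n))`, the sum over all `t₀ h₀`. -/
noncomputable def piLaw {φ : A ≃* B} (X Y : Set G₀) (P : Measure Ω) (ζ : ℕ → Ω → HNN φ)
    (ν : Tails A B → ENNReal) (s : stateSpace X Y P ζ) : ENNReal :=
  ∑' c : Tails A B, ν c * transProb X Y P ζ (tailState c) s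

end

end HNNWalk

open HNNWalk MarkovMatrix

/-!
Multiplying `g₁ t₁ ⋯ gₙ tₙ h` by a step of the walk changes at most the last letter `t^{±1}` of the
normal form, so that the walk moves along the edges of the Bass–Serre tree: as long as its
`t`-length does not fall below `k`, its first `k` letters stay fixed (`Transversals.prefix_path`).
This makes the cone behind a vertex a translated copy of the cone behind `t^ε`, and the block `Wₖ`
together with the increment `iₖ` is determined by the path in the cone of the previous block.

*Transience.* If `A` and `B` are proper subgroups, then the cosets of `G₀` whose normal forms begin
with `1 t` and with `1 t⁻¹` form a paradoxical decomposition of `G / G₀`. The truncated Green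
function is almost invariant under the walk, hence by the parallelogram identity its translates
by group elements are close to it in `ℓ²`; the paradoxical decomposition then bounds its `ℓ²`-norm
uniformly (`tsum_visitProb_ne_top`). Hence every coset is visited finitely often, and the
`t`-length tends to infinity. As `A` and `B` are finite and isomorphic, the only other case is
`A = B = G₀`, where the exponent sum of `t` is a biased random walk on `ℤ` and the strong law of
large numbers applies. The two cases meet in `Transversals.ae_exists_stays`.

*Markov property.* The event `e_k = N, X_N = x` says that something happens before time `N`, and
that the walk with the remaining steps never leaves the cone of `x`, an event with probability `ξ`
of the last letters of `x`. Splitting off the first `N` steps, and then the steps up to the next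
exit time, gives the transition probabilities `q` (`Transversals.exitChain_markov`).

*The chain.* The probabilities `q(s, s')` depend on `s` only through `tₖ hₖ`, which takes finitely
many values. From every such value with `ξ > 0` every other one can be reached in one step
(`Transversals.exists_transProb_pos`); if `A = B = G₀`, this holds because `ξ` is positive for one
sign of the exponent only. So every state can be reached from every state in two and in three
steps, with a probability that, for two steps, is bounded below uniformly in the starting point.
This yields irreducibility, aperiodicity and geometric tails of the return times. The matrix `q_h`
vanishes on the columns with `ξ = 0` and is positive and stochastic on the rest, so that it has
exactly one invariant law, and one step of the chain turns this law into an invariant law of `q`.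
-/

/-! ### Normal forms in the HNN extension -/

namespace HNNWalk

variable {G₀ : Type*} [Group G₀] {A B : Subgroup G₀}

/-- `X` and `Y` are sets of representatives of the left cosets of `A` and of `B`, and both
contain the identity. -/
structure Transversals (A B : Subgroup G₀) (X Y : Set G₀) : Prop where
  complX : Subgroup.IsComplement X (A : Set G₀)
  complY : Subgroup.IsComplement Y (B : Set G₀)
  oneX : (1 : G₀) ∈ X
  oneY : (1 : G₀) ∈ Y

theorem tailGroup_one : tailGroup A B 1 = B := rfl

theorem tailGroup_neg_one : tailGroup A B (-1) = A := rfl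

theorem tPow_one (φ : A ≃* B) : tPow φ 1 = HNNExtension.t := by simp [tPow]

theorem tPow_neg_one (φ : A ≃* B) : tPow φ (-1) = HNNExtension.t⁻¹ := by simp [tPow]

theorem tPow_neg (φ : A ≃* B) (ε : ℤˣ) : tPow φ (-ε) = (tPow φ ε)⁻¹ := by simp [tPow]

theorem tPow_neg_mul (φ : A ≃* B) (ε : ℤˣ) : tPow φ (-ε) * tPow φ ε = 1 := by simp [tPow_neg]

theorem units_eq_neg_of_ne {ε δ : ℤˣ} (h : ε ≠ δ) : ε = -δ := by
  rcases Int.units_eq_one_or ε with rfl | rfl <;> rcases Int.units_eq_one_or δ with rfl | rfl <;>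
    simp_all

variable {X Y : Set G₀}

theorem Transversals.one_mem (hT : Transversals A B X Y) (ε : ℤˣ) : (1 : G₀) ∈ reps X Y ε := by
  rcases Int.units_eq_one_or ε with rfl | rfl
  · exact hT.oneX
  · exact hT.oneY

theorem Transversals.compl (hT : Transversals A B X Y) (ε : ℤˣ) :
    Subgroup.IsComplement (reps X Y ε) (tailGroup A B (-ε) : Set G₀) := by
  rcases Int.units_eq_one_or ε with rfl | rfl
  · exact hT.complX
  · rw [neg_neg]; exact hT.complY

theorem Transversals.exists_rep (hT : Transversals A B X Y) (ε : ℤˣ) (g : G₀) :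
    ∃ r ∈ reps X Y ε, ∃ a ∈ tailGroup A B (-ε), g = r * a := by
  obtain ⟨s, hs, -⟩ := Subgroup.isComplement_iff_existsUnique_inv_mul_mem.mp (hT.compl ε) g
  exact ⟨s, s.2, _, hs, by simp⟩

theorem Transversals.eq_one_of_mem (hT : Transversals A B X Y) {ε : ℤˣ} {r : G₀}
    (hr : r ∈ reps X Y ε) (h : r ∈ tailGroup A B (-ε)) : r = 1 := by
  obtain ⟨s, -, hu⟩ := Subgroup.isComplement_iff_existsUnique_inv_mul_mem.mp (hT.compl ε) r
  have h1 := hu ⟨r, hr⟩ (by simp [(tailGroup A B (-ε)).one_mem])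
  have h2 := hu ⟨1, hT.one_mem ε⟩ (by simpa using h)
  exact congrArg Subtype.val (h1.trans h2.symm)

/-- Passing to inverses turns representatives of left cosets into representatives of right
cosets, which is what `HNNExtension.NormalWord` is about. -/
theorem isComplement_inv {S : Set G₀} {H : Subgroup G₀} (h : Subgroup.IsComplement S (H : Set G₀)) :
    Subgroup.IsComplement (H : Set G₀) S⁻¹ := by
  rw [Subgroup.isComplement_iff_existsUnique_mul_inv_mem]
  intro g
  obtain ⟨s, hs, hu⟩ := Subgroup.isComplement_iff_existsUnique_inv_mul_mem.mp h g⁻¹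
  refine ⟨⟨(s : G₀)⁻¹, by simp⟩, ?_, ?_⟩
  · have := H.inv_mem hs
    simpa using this
  · rintro ⟨t, ht⟩ hgt
    have := hu ⟨t⁻¹, ht⟩ (by simpa using H.inv_mem hgt)
    rw [Subtype.ext_iff] at this ⊢
    simpa using congrArg (·⁻¹) this

/-- The transversals for the right cosets that consist of the inverses of the given
representatives. -/
def Transversals.pair (hT : Transversals A B X Y) :
    HNNExtension.NormalWord.TransversalPair G₀ B A where
  set u := (reps X Y (-u))⁻¹
  compl u := by
    have := isComplement_inv (hT.compl (-u))
    rw [neg_neg] at this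
    exact this

/-- The normal word in the sense of Mathlib that represents the inverse of
`g₁ t₁ ⋯ gₙ tₙ h`. -/
def Transversals.invWord (hT : Transversals A B X Y) (l : List (G₀ × ℤˣ)) (h : G₀)
    (hl : IsNormal X Y l) : HNNExtension.NormalWord hT.pair where
  head := h⁻¹
  toList := (l.map fun x => (-x.2, x.1⁻¹)).reverse
  chain := by
    rw [List.isChain_reverse, List.isChain_map]
    refine List.IsChain.imp_of_mem_imp ?_ hl.2
    intro a b _ hb hab hmem
    have : b.1 ∈ tailGroup A B (-b.2) := by simpa using (tailGroup A B (-b.2)).inv_mem hmem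
    have := hab (hT.eq_one_of_mem (hl.1 b hb) this)
    simp [this]
  mem_set u g h := by
    simp only [List.mem_reverse, List.mem_map, Prod.mk.injEq] at h
    obtain ⟨x, hx, rfl, rfl⟩ := h
    have := hl.1 x hx
    simpa [Transversals.pair] using this

theorem inv_word (φ : A ≃* B) (l : List (G₀ × ℤˣ)) :
    (word φ l)⁻¹ = ((l.map fun x => (-x.2, x.1⁻¹)).reverse.map
      fun x => (HNNExtension.t : HNN φ) ^ (x.1 : ℤ) * HNNExtension.of x.2).prod := by
  induction l with
  | nil => simp [word]
  | cons a l ih =>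
    have : word φ (a :: l) = HNNExtension.of a.1 * tPow φ a.2 * word φ l := by simp [word]
    rw [this, mul_inv_rev, ih]
    simp [tPow]

theorem Transversals.prod_invWord (hT : Transversals A B X Y) (φ : A ≃* B) (l : List (G₀ × ℤˣ))
    (h : G₀) (hl : IsNormal X Y l) :
    (hT.invWord l h hl).prod φ.symm = (word φ l * HNNExtension.of h)⁻¹ := by
  rw [mul_inv_rev, inv_word, HNNExtension.NormalWord.ReducedWord.prod]
  simp [Transversals.invWord]

/-- Uniqueness of the normal form. -/
theorem Transversals.word_injective (hT : Transversals A B X Y) (φ : A ≃* B)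
    {l l' : List (G₀ × ℤˣ)} {h h' : G₀} (hl : IsNormal X Y l) (hl' : IsNormal X Y l')
    (heq : word φ l * HNNExtension.of h = word φ l' * HNNExtension.of h') : l = l' ∧ h = h' := by
  have := HNNExtension.NormalWord.prod_injective φ.symm hT.pair
    (a₁ := hT.invWord l h hl) (a₂ := hT.invWord l' h' hl')
    (by simp only [hT.prod_invWord, heq])
  have h1 := congrArg (fun w => w.toList) this
  have h2 := congrArg (fun w => w.head) this
  simp only [Transversals.invWord, List.reverse_inj, inv_inj] at h1 h2
  refine ⟨List.map_injective_iff.mpr ?_ h1, h2⟩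
  rintro ⟨a, b⟩ ⟨c, d⟩ hab
  simpa [and_comm] using hab

/-- Existence of the normal form. -/
theorem Transversals.exists_word (hT : Transversals A B X Y) (φ : A ≃* B) (g : HNN φ) :
    ∃ l h, IsNormal X Y l ∧ word φ l * HNNExtension.of h = g := by
  obtain ⟨w, hw⟩ := (HNNExtension.NormalWord.equiv φ.symm hT.pair).symm.surjective g⁻¹
  have hw : w.prod φ.symm = g⁻¹ := hw
  set l := (w.toList.map fun x => (x.2⁻¹, -x.1)).reverse with hldef
  have hl : IsNormal X Y l := by
    constructor
    · intro x hx
      simp only [hldef, List.mem_reverse, List.mem_map] at hx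
      obtain ⟨y, hy, rfl⟩ := hx
      have := w.mem_set y.1 y.2 hy
      simpa [Transversals.pair] using this
    · rw [hldef, List.isChain_reverse, List.isChain_map]
      refine w.chain.imp ?_
      intro a b hab h1
      have : a.2 = 1 := by simpa using h1
      simp [hab (this ▸ Subgroup.one_mem _)]
  have hinv : hT.invWord l w.head⁻¹ hl = w := by
    apply HNNExtension.NormalWord.ext
    · simp [Transversals.invWord]
    · simp [Transversals.invWord, hldef, Function.comp_def]
  refine ⟨l, w.head⁻¹, hl, ?_⟩
  rw [← inv_inj, ← hw, ← hT.prod_invWord φ l _ hl, hinv]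

open scoped Classical in
/-- The sequence `(g₁, t₁), …, (gₙ, tₙ)` of the normal form `g₁ t₁ ⋯ gₙ tₙ h` of `g`. -/
noncomputable def nfWord (φ : A ≃* B) (X Y : Set G₀) (g : HNN φ) : List (G₀ × ℤˣ) :=
  Classical.epsilon fun l => ∃ h, IsNormal X Y l ∧ word φ l * HNNExtension.of h = g

/-- The last letter `h` of the normal form `g₁ t₁ ⋯ gₙ tₙ h` of `g`. -/
noncomputable def nfTail (φ : A ≃* B) (X Y : Set G₀) (g : HNN φ) : G₀ :=
  Classical.epsilon fun h => word φ (nfWord φ X Y g) * HNNExtension.of h = g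

section

variable (hT : Transversals A B X Y) (φ : A ≃* B)
include hT

theorem Transversals.nfWord_spec (g : HNN φ) :
    IsNormal X Y (nfWord φ X Y g) ∧
      word φ (nfWord φ X Y g) * HNNExtension.of (nfTail φ X Y g) = g := by
  have h := Classical.epsilon_spec
    (p := fun l => ∃ h, IsNormal X Y l ∧ word φ l * HNNExtension.of h = g)
    (hT.exists_word φ g)
  obtain ⟨h, h1, h2⟩ := h
  exact ⟨h1, Classical.epsilon_spec
    (p := fun h => word φ (nfWord φ X Y g) * HNNExtension.of h = g) ⟨h, h2⟩⟩

theorem Transversals.nf_eq {l : List (G₀ × ℤˣ)} {h : G₀} {g : HNN φ} (hl : IsNormal X Y l)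
    (hg : word φ l * HNNExtension.of h = g) : nfWord φ X Y g = l ∧ nfTail φ X Y g = h := by
  obtain ⟨h1, h2⟩ := hT.nfWord_spec φ g
  exact hT.word_injective φ h1 hl (h2.trans hg.symm)

theorem Transversals.tLength_eq (g : HNN φ) : tLength φ X Y g = (nfWord φ X Y g).length := by
  have : {n | ∃ l h, IsNormal X Y l ∧ word φ l * HNNExtension.of h = g ∧ l.length = n}
      = {(nfWord φ X Y g).length} := by
    ext n
    simp only [Set.mem_ofPred_eq, Set.mem_singleton_iff]
    constructor
    · rintro ⟨l, h, hl, hg, rfl⟩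
      rw [(hT.nf_eq φ hl hg).1]
    · rintro rfl
      exact ⟨_, _, (hT.nfWord_spec φ g).1, (hT.nfWord_spec φ g).2, rfl⟩
  rw [tLength, this, csInf_singleton]

theorem Transversals.tLength_word {l : List (G₀ × ℤˣ)} (hl : IsNormal X Y l) (h : G₀) :
    tLength φ X Y (word φ l * HNNExtension.of h) = l.length := by
  rw [hT.tLength_eq, (hT.nf_eq φ hl rfl).1]

end

theorem word_append (φ : A ≃* B) (l l' : List (G₀ × ℤˣ)) :
    word φ (l ++ l') = word φ l * word φ l' := by simp [word]

theorem word_singleton (φ : A ≃* B) (g : G₀) (ε : ℤˣ) :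
    word φ [(g, ε)] = HNNExtension.of g * tPow φ ε := by simp [word]

theorem word_concat_mul (φ : A ≃* B) (l : List (G₀ × ℤˣ)) (b : Block G₀) :
    word φ (l ++ [(b.rep, b.sign)]) * HNNExtension.of b.tail = word φ l * b.val φ := by
  simp [word_append, word_singleton, Block.val, tailVal, mul_assoc]

theorem Transversals.lastBlock_eq (hT : Transversals A B X Y) (φ : A ≃* B)
    {l : List (G₀ × ℤˣ)} {b : Block G₀} (hl : IsNormal X Y (l ++ [(b.rep, b.sign)])) :
    lastBlock φ X Y (word φ l * b.val φ) = b := by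
  have key : ∀ b' : Block G₀, (∃ l', IsNormal X Y (l' ++ [(b'.rep, b'.sign)]) ∧
      word φ l' * b'.val φ = word φ l * b.val φ) → b' = b := by
    rintro b' ⟨l', hl', h'⟩
    rw [← word_concat_mul, ← word_concat_mul φ l] at h'
    obtain ⟨h1, h2⟩ := hT.word_injective φ hl' hl h'
    have h3 := List.append_inj_right' h1 rfl
    simp only [List.cons.injEq, Prod.mk.injEq, and_true] at h3
    exact Block.ext h3.1 h3.2 h2
  have hex : ∃ b' : Block G₀, ∃ l', IsNormal X Y (l' ++ [(b'.rep, b'.sign)]) ∧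
      word φ l' * b'.val φ = word φ l * b.val φ := ⟨b, l, hl, rfl⟩
  exact key _ (Classical.epsilon_spec hex)

/-! ### Right multiplication by generators -/

theorem of_mul_tPow (φ : A ≃* B) (ε : ℤˣ) {a : G₀} (ha : a ∈ tailGroup A B (-ε)) :
    ∃ a' ∈ tailGroup A B ε,
      (HNNExtension.of a : HNN φ) * tPow φ ε = tPow φ ε * HNNExtension.of a' := by
  rcases Int.units_eq_one_or ε with rfl | rfl
  · exact ⟨φ ⟨a, ha⟩, (φ ⟨a, ha⟩).2, by rw [tPow_one]; exact of_mul_t_eq φ ⟨a, ha⟩⟩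
  · have ha : a ∈ B := by rw [neg_neg] at ha; exact ha
    refine ⟨φ.symm ⟨a, ha⟩, (φ.symm ⟨a, ha⟩).2, ?_⟩
    rw [tPow_neg_one, HNNExtension.inv_t_mul_of (φ := φ.symm)]
    have := of_mul_t_eq φ (φ.symm ⟨a, ha⟩)
    simp only [MulEquiv.apply_symm_apply] at this
    rw [mul_inv_eq_iff_eq_mul, mul_assoc]
    simp

theorem tPow_mul_of (φ : A ≃* B) (ε : ℤˣ) {a : G₀} (ha : a ∈ tailGroup A B ε) :
    ∃ a' ∈ tailGroup A B (-ε),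
      tPow φ ε * (HNNExtension.of a : HNN φ) = HNNExtension.of a' * tPow φ ε := by
  obtain ⟨a', ha', h⟩ := of_mul_tPow φ (-ε) (a := a) (by rwa [neg_neg])
  refine ⟨a', ha', ?_⟩
  have := congrArg (fun x => tPow φ ε * x * tPow φ ε) h
  simpa [tPow_neg, mul_assoc] using this

theorem IsNormal.nil : IsNormal X Y ([] : List (G₀ × ℤˣ)) := ⟨by simp, List.isChain_nil⟩

theorem IsNormal.left {l l' : List (G₀ × ℤˣ)} (h : IsNormal X Y (l ++ l')) : IsNormal X Y l :=
  ⟨fun x hx => h.1 x (by simp [hx]), (List.isChain_append.mp h.2).1⟩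

theorem IsNormal.right {l l' : List (G₀ × ℤˣ)} (h : IsNormal X Y (l ++ l')) : IsNormal X Y l' :=
  ⟨fun x hx => h.1 x (by simp [hx]), (List.isChain_append.mp h.2).2.1⟩

theorem isNormal_concat_iff {l : List (G₀ × ℤˣ)} {g r : G₀} {δ ε : ℤˣ} :
    IsNormal X Y (l ++ [(g, δ)] ++ [(r, ε)]) ↔
      IsNormal X Y (l ++ [(g, δ)]) ∧ r ∈ reps X Y ε ∧ (r = 1 → δ = ε) := by
  constructor
  · intro h
    refine ⟨h.left, h.1 (r, ε) (by simp), ?_⟩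
    have := (List.isChain_append.mp h.2).2.2 (g, δ) (by simp) (r, ε) (by simp)
    exact this
  · rintro ⟨h, hr, h1⟩
    refine ⟨?_, List.isChain_append.mpr ⟨h.2, List.isChain_singleton _, ?_⟩⟩
    · intro x hx
      rcases List.mem_append.mp hx with hx | hx
      · exact h.1 x hx
      · rw [List.mem_singleton.mp hx]; exact hr
    · simpa using h1

theorem isNormal_singleton_iff {r : G₀} {ε : ℤˣ} :
    IsNormal X Y [(r, ε)] ↔ r ∈ reps X Y ε := by
  simp [IsNormal]

theorem isNormal_cons_one_iff {l : List (G₀ × ℤˣ)} (hT : Transversals A B X Y) {ε : ℤˣ} :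
    IsNormal X Y ((1, ε) :: l) ↔ IsNormal X Y l ∧ l.head? ≠ some (1, -ε) := by
  constructor
  · intro h
    refine ⟨IsNormal.right (l := [(1, ε)]) h, ?_⟩
    intro hl
    have := (List.isChain_cons.mp h.2).1 (1, -ε) (by simp [hl])
    have : ε = -ε := this rfl
    rcases Int.units_eq_one_or ε with rfl | rfl <;> simp at this
  · rintro ⟨h, hne⟩
    refine ⟨?_, List.isChain_cons.mpr ⟨?_, h.2⟩⟩
    · intro x hx
      rcases List.mem_cons.mp hx with rfl | hx
      · exact hT.one_mem ε
      · exact h.1 x hx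
    · rintro ⟨g, δ⟩ hy rfl
      by_contra hδ
      exact hne (by rw [Option.mem_def.mp hy, units_eq_neg_of_ne (ε := δ) (δ := ε) (Ne.symm hδ)])

section

variable (hT : Transversals A B X Y) (φ : A ≃* B)
include hT

theorem Transversals.nf_mul_of (g : HNN φ) (x : G₀) :
    nfWord φ X Y (g * HNNExtension.of x) = nfWord φ X Y g ∧
      nfTail φ X Y (g * HNNExtension.of x) = nfTail φ X Y g * x := by
  obtain ⟨h1, h2⟩ := hT.nfWord_spec φ g
  refine hT.nf_eq φ h1 ?_
  conv_rhs => rw [← h2]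
  simp [mul_assoc]

/-- Multiplication by `t^ε` from the right either appends a letter to the normal form, and the
new last letter lies in the corresponding subgroup, or it removes the last letter. -/
theorem Transversals.nf_mul_tPow (g : HNN φ) (ε : ℤˣ) :
    (∃ r, nfWord φ X Y (g * tPow φ ε) = nfWord φ X Y g ++ [(r, ε)] ∧
      nfTail φ X Y (g * tPow φ ε) ∈ tailGroup A B ε) ∨
    ∃ x, nfWord φ X Y g = nfWord φ X Y (g * tPow φ ε) ++ [x] := by
  obtain ⟨h1, h2⟩ := hT.nfWord_spec φ g
  obtain ⟨r, hr, a, ha, hra⟩ := hT.exists_rep ε (nfTail φ X Y g)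
  obtain ⟨a', ha', haa'⟩ := of_mul_tPow φ ε ha
  have hprod : word φ (nfWord φ X Y g) * HNNExtension.of r * tPow φ ε * HNNExtension.of a'
      = g * tPow φ ε := by
    conv_rhs => rw [← h2, hra]
    rw [map_mul]
    simp only [mul_assoc]
    rw [haa']
  rcases List.eq_nil_or_concat (nfWord φ X Y g) with hnil | ⟨l, ⟨s, δ⟩, hl⟩
  · left
    have hn : IsNormal X Y (nfWord φ X Y g ++ [(r, ε)]) := by
      rw [hnil]; exact isNormal_singleton_iff.mpr hr
    obtain ⟨h3, h4⟩ := hT.nf_eq φ (h := a') (g := g * tPow φ ε) hn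
      (by rw [word_append, word_singleton, ← hprod]; simp only [mul_assoc])
    exact ⟨r, h3, h4 ▸ ha'⟩
  · rw [List.concat_eq_append] at hl
    by_cases hc : r = 1 → δ = ε
    · left
      have hn : IsNormal X Y (nfWord φ X Y g ++ [(r, ε)]) := by
        rw [hl]; rw [hl] at h1; exact isNormal_concat_iff.mpr ⟨h1, hr, hc⟩
      obtain ⟨h3, h4⟩ := hT.nf_eq φ (h := a') (g := g * tPow φ ε) hn
        (by rw [word_append, word_singleton, ← hprod]; simp only [mul_assoc])
      exact ⟨r, h3, h4 ▸ ha'⟩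
    · right
      push Not at hc
      obtain ⟨rfl, hδ⟩ := hc
      have hδ := units_eq_neg_of_ne hδ
      subst hδ
      refine ⟨(s, -ε), ?_⟩
      rw [hl] at h1
      have := hT.nf_eq φ (h := s * a') (g := g * tPow φ ε) h1.left (by
        rw [← hprod, hl, word_append, word_singleton]
        simp only [map_one, mul_one, map_mul, mul_assoc]
        rw [← mul_assoc (tPow φ (-ε)) (tPow φ ε), tPow_neg_mul, one_mul])
      rw [hl, this.1]

end

end HNNWalk

/-! ### Paths of the walk -/

namespace HNNWalk

variable {G₀ : Type*} [Group G₀] {A B : Subgroup G₀}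

/-- The coordinate process on the space of sequences of steps. -/
def coord (φ : A ≃* B) : ℕ → (ℕ → HNN φ) → HNN φ := fun i z => z i

/-- The sequence `z` without its first `N` entries. -/
def shiftSeq {α : Type*} (N : ℕ) (z : ℕ → α) : ℕ → α := fun i => z (N + i)

/-- The position after `n` steps of the path with steps `z` that starts in `x`. -/
abbrev path {φ : A ≃* B} (z : ℕ → HNN φ) (x : HNN φ) (n : ℕ) : HNN φ := walk (coord φ) x n z

/-- The elements of `G₀` and `t`, `t⁻¹`. -/
def stepSet (φ : A ≃* B) : Set (HNN φ) := {s | (∃ x, s = HNNExtension.of x) ∨ ∃ ε, s = tPow φ ε}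

section

variable {φ : A ≃* B}

theorem walk_eq_path {Ω : Type*} (ζ : ℕ → Ω → HNN φ) (x : HNN φ) (n : ℕ) (ω : Ω) :
    walk ζ x n ω = path (fun i => ζ i ω) x n := by
  induction n with
  | zero => rfl
  | succ n ih => simp only [walk, path, ih, coord] at *

theorem path_zero (z : ℕ → HNN φ) (x : HNN φ) : path z x 0 = x := rfl

theorem path_succ (z : ℕ → HNN φ) (x : HNN φ) (n : ℕ) : path z x (n + 1) = path z x n * z n := rfl

theorem path_mul_left (z : ℕ → HNN φ) (g x : HNN φ) (n : ℕ) :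
    path z (g * x) n = g * path z x n := by
  induction n with
  | zero => rfl
  | succ n ih => rw [path_succ, path_succ, ih, mul_assoc]

theorem path_eq_mul (z : ℕ → HNN φ) (x : HNN φ) (n : ℕ) : path z x n = x * path z 1 n := by
  rw [← path_mul_left, mul_one]

theorem path_add (z : ℕ → HNN φ) (x : HNN φ) (N n : ℕ) :
    path z x (N + n) = path (shiftSeq N z) (path z x N) n := by
  induction n with
  | zero => rfl
  | succ n ih => rw [← add_assoc, path_succ, path_succ, ih]; rfl

theorem path_congr {z z' : ℕ → HNN φ} {n : ℕ} (h : ∀ i < n, z i = z' i) (x : HNN φ) :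
    path z x n = path z' x n := by
  induction n with
  | zero => rfl
  | succ n ih => rw [path_succ, path_succ, ih fun i hi => h i (by omega), h n (by omega)]

variable {X Y : Set G₀} (hT : Transversals A B X Y)
include hT

theorem Transversals.prefix_step {g s : HNN φ} (hs : s ∈ stepSet φ) {l : List (G₀ × ℤˣ)}
    (hl : l <+: nfWord φ X Y g) (hlen : l.length ≤ tLength φ X Y (g * s)) :
    l <+: nfWord φ X Y (g * s) := by
  rw [hT.tLength_eq] at hlen
  rcases hs with ⟨x, rfl⟩ | ⟨ε, rfl⟩
  · rwa [(hT.nf_mul_of φ g x).1]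
  · rcases hT.nf_mul_tPow φ g ε with ⟨r, h, -⟩ | ⟨x, h⟩
    · rw [h]; exact hl.trans (List.prefix_append _ _)
    · exact List.prefix_of_prefix_length_le hl (h ▸ List.prefix_append _ _) hlen

theorem Transversals.tLength_step {g s : HNN φ} (hs : s ∈ stepSet φ) :
    tLength φ X Y (g * s) ≤ tLength φ X Y g + 1 := by
  rw [hT.tLength_eq, hT.tLength_eq]
  rcases hs with ⟨x, rfl⟩ | ⟨ε, rfl⟩
  · rw [(hT.nf_mul_of φ g x).1]; omega
  · rcases hT.nf_mul_tPow φ g ε with ⟨r, h, -⟩ | ⟨x, h⟩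
    · rw [h]; simp
    · rw [h]; simp; omega

theorem Transversals.step_up {g s : HNN φ} (hs : s ∈ stepSet φ)
    (h : tLength φ X Y g < tLength φ X Y (g * s)) :
    ∃ r ε, nfWord φ X Y (g * s) = nfWord φ X Y g ++ [(r, ε)] ∧
      nfTail φ X Y (g * s) ∈ tailGroup A B ε := by
  rw [hT.tLength_eq, hT.tLength_eq] at h
  rcases hs with ⟨x, rfl⟩ | ⟨ε, rfl⟩
  · rw [(hT.nf_mul_of φ g x).1] at h; omega
  · rcases hT.nf_mul_tPow φ g ε with ⟨r, h', h''⟩ | ⟨x, h'⟩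
    · exact ⟨r, ε, h', h''⟩
    · rw [h'] at h; simp at h

/-- As long as a path does not become shorter than a prefix of its normal form, it keeps that
prefix: the cone of a vertex of the tree can be left only through its parent. -/
theorem Transversals.prefix_path {z : ℕ → HNN φ} (hz : ∀ i, z i ∈ stepSet φ) {x : HNN φ}
    {l : List (G₀ × ℤˣ)} {N M : ℕ} (hl : l <+: nfWord φ X Y (path z x N))
    (hlen : ∀ n, N ≤ n → n ≤ M → l.length ≤ tLength φ X Y (path z x n)) :
    ∀ n, N ≤ n → n ≤ M → l <+: nfWord φ X Y (path z x n) := by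
  intro n hn
  induction n, hn using Nat.le_induction with
  | base => exact fun _ => hl
  | succ n hn ih =>
    intro hM
    rw [path_succ]
    refine hT.prefix_step (hz n) (ih (by omega)) ?_
    rw [← path_succ]
    exact hlen _ (by omega) hM

theorem Transversals.nf_tailVal (ε : ℤˣ) (h : G₀) :
    nfWord φ X Y (tailVal φ ε h) = [(1, ε)] ∧ nfTail φ X Y (tailVal φ ε h) = h :=
  hT.nf_eq φ (isNormal_singleton_iff.mpr (hT.one_mem ε)) (by simp [word_singleton, tailVal])

omit hT in
theorem isNormal_glue {l₀ l₁ : List (G₀ × ℤˣ)} {g : G₀} {ε : ℤˣ}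
    (h0 : IsNormal X Y (l₀ ++ [(g, ε)])) (h1 : IsNormal X Y ((1, ε) :: l₁)) :
    IsNormal X Y (l₀ ++ [(g, ε)] ++ l₁) := by
  refine ⟨?_, List.isChain_append.mpr ⟨h0.2, (IsNormal.right (l := [(1, ε)]) h1).2, ?_⟩⟩
  · intro x hx
    rcases List.mem_append.mp hx with hx | hx
    · exact h0.1 x hx
    · exact h1.1 x (by simp [hx])
  · intro x hx y hy
    have hx : x = (g, ε) := by simpa using hx.symm
    subst hx
    exact (List.isChain_cons.mp h1.2).1 y hy

/-- Left multiplication by `g₁ t₁ ⋯ gₙ` is the obvious operation on normal forms that begin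
with `1 tₙ`. -/
theorem Transversals.nf_base_mul {l₀ l₁ : List (G₀ × ℤˣ)} {g : G₀} {ε : ℤˣ}
    (h0 : IsNormal X Y (l₀ ++ [(g, ε)])) {y : HNN φ} (hy : nfWord φ X Y y = (1, ε) :: l₁) :
    nfWord φ X Y (word φ l₀ * HNNExtension.of g * y) = l₀ ++ [(g, ε)] ++ l₁ := by
  obtain ⟨h1, h2⟩ := hT.nfWord_spec φ y
  rw [hy] at h1 h2
  refine (hT.nf_eq φ (h := nfTail φ X Y y) (isNormal_glue h0 h1) ?_).1
  conv_rhs => rw [← h2]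
  rw [show ((1 : G₀), ε) :: l₁ = [(1, ε)] ++ l₁ from rfl]
  simp only [word_append, word_singleton, map_one, one_mul, mul_assoc]

theorem Transversals.nf_of_base_mul {l₀ l₁ : List (G₀ × ℤˣ)} {g : G₀} {ε : ℤˣ} {y : HNN φ}
    (hy : nfWord φ X Y (word φ l₀ * HNNExtension.of g * y) = l₀ ++ [(g, ε)] ++ l₁) :
    nfWord φ X Y y = (1, ε) :: l₁ := by
  obtain ⟨h1, h2⟩ := hT.nfWord_spec φ (word φ l₀ * HNNExtension.of g * y)
  rw [hy] at h1 h2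
  refine (hT.nf_eq φ (h := nfTail φ X Y (word φ l₀ * HNNExtension.of g * y)) ?_ ?_).1
  · have h3 : IsNormal X Y ([(g, ε)] ++ l₁) := by
      rw [List.append_assoc] at h1; exact h1.right
    refine ⟨?_, ?_⟩
    · intro x hx
      rcases List.mem_cons.mp hx with rfl | hx
      · exact hT.one_mem ε
      · exact h3.1 x (by simp [hx])
    · have h4 := List.isChain_cons.mp h3.2
      exact List.isChain_cons.mpr ⟨h4.1, h4.2⟩
  · rw [word_append, word_append, word_singleton] at h2
    rw [show ((1 : G₀), ε) :: l₁ = [(1, ε)] ++ l₁ from rfl, word_append, word_singleton]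
    simp only [mul_assoc] at h2
    simpa [mul_assoc] using h2

/-- A path started in `t^ε h` stays outside `G₀` for a while if and only if its translate stays in
the cone of the translated vertex, and then translation shifts all lengths by the same amount. -/
theorem Transversals.cone_iff {z : ℕ → HNN φ} (hz : ∀ i, z i ∈ stepSet φ)
    {l₀ : List (G₀ × ℤˣ)} {g : G₀} {ε : ℤˣ} (h0 : IsNormal X Y (l₀ ++ [(g, ε)])) (h : G₀) (M : ℕ) :
    ((∀ n ≤ M, 1 ≤ tLength φ X Y (path z (tailVal φ ε h) n)) ↔
      ∀ n ≤ M, l₀.length + 1 ≤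
        tLength φ X Y (path z (word φ l₀ * HNNExtension.of g * tailVal φ ε h) n)) ∧
    ((∀ n ≤ M, 1 ≤ tLength φ X Y (path z (tailVal φ ε h) n)) → ∀ n ≤ M,
      tLength φ X Y (path z (word φ l₀ * HNNExtension.of g * tailVal φ ε h) n)
        = l₀.length + tLength φ X Y (path z (tailVal φ ε h) n)) := by
  have key : (∀ n ≤ M, 1 ≤ tLength φ X Y (path z (tailVal φ ε h) n)) → ∀ n ≤ M,
      tLength φ X Y (path z (word φ l₀ * HNNExtension.of g * tailVal φ ε h) n)
        = l₀.length + tLength φ X Y (path z (tailVal φ ε h) n) := by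
    intro H n hn
    obtain ⟨l₁, hl₁⟩ := hT.prefix_path hz (x := tailVal φ ε h) (l := [(1, ε)]) (N := 0) (M := M)
      (by rw [path_zero, (hT.nf_tailVal ε h).1]) (fun n _ hn => H n hn) n (Nat.zero_le _) hn
    have hl₁' : nfWord φ X Y (path z (tailVal φ ε h) n) = (1, ε) :: l₁ := hl₁.symm
    rw [path_mul_left, hT.tLength_eq, hT.tLength_eq, hT.nf_base_mul h0 hl₁', hl₁']
    simp
  refine ⟨⟨fun H n hn => by rw [key H n hn]; have := H n hn; omega, fun H n hn => ?_⟩, key⟩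
  obtain ⟨l₁, hl₁⟩ := hT.prefix_path hz
    (x := word φ l₀ * HNNExtension.of g * tailVal φ ε h) (l := l₀ ++ [(g, ε)]) (N := 0) (M := M)
    (by rw [path_zero, hT.nf_base_mul h0 (hT.nf_tailVal ε h).1]; simp)
    (fun n _ hn => by simpa using H n hn) n (Nat.zero_le _) hn
  rw [path_mul_left] at hl₁
  rw [hT.tLength_eq, hT.nf_of_base_mul hl₁.symm]
  simp

theorem Transversals.notMem_range_iff (g : HNN φ) :
    g ∉ Set.range (HNNExtension.of : G₀ →* HNN φ) ↔ 1 ≤ tLength φ X Y g := by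
  rw [← not_iff_not, not_not, not_le, Nat.lt_one_iff, hT.tLength_eq, List.length_eq_zero_iff]
  constructor
  · rintro ⟨x, rfl⟩
    exact (hT.nf_eq φ (h := x) IsNormal.nil (by simp [word])).1
  · intro h
    have := (hT.nfWord_spec φ g).2
    rw [h] at this
    exact ⟨nfTail φ X Y g, by simpa [word] using this⟩

theorem Transversals.tLength_one : tLength φ X Y (1 : HNN φ) = 0 := by
  have := hT.notMem_range_iff (1 : HNN φ)
  by_contra h
  exact this.mpr (by omega) ⟨1, map_one _⟩

end

/-! ### Exit times of a path -/

section

variable {φ : A ≃* B} {X Y : Set G₀}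

/-- From time `m` on, the path started in `1` has `t`-length at least `k`. -/
def Stays (X Y : Set G₀) (k m : ℕ) (z : ℕ → HNN φ) : Prop :=
  ∀ n, m ≤ n → k ≤ tLength φ X Y (path z 1 n)

theorem exitTime_eq {k m : ℕ} {z : ℕ → HNN φ} (h : Stays X Y k m z)
    (hm : m = 0 ∨ tLength φ X Y (path z 1 (m - 1)) < k) : exitTime X Y (coord φ) k z = m := by
  refine le_antisymm (Nat.sInf_le h) (le_csInf ⟨m, h⟩ fun m' hm' => ?_)
  by_contra hlt
  push Not at hlt
  rcases hm with rfl | hm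
  · omega
  · have := hm' (m - 1) (by omega)
    exact absurd hm (by simpa using this)

theorem stays_exitTime {k : ℕ} {z : ℕ → HNN φ} (h : ∃ m, Stays X Y k m z) :
    Stays X Y k (exitTime X Y (coord φ) k z) z :=
  Nat.sInf_mem (s := {m | ∀ n, m ≤ n → k ≤ tLength φ X Y (walk (coord φ) 1 n z)}) h

theorem exitTime_le {k m : ℕ} {z : ℕ → HNN φ} (h : Stays X Y k m z) :
    exitTime X Y (coord φ) k z ≤ m := Nat.sInf_le h

theorem tLength_exitTime_sub_one {k : ℕ} {z : ℕ → HNN φ} (h : ∃ m, Stays X Y k m z)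
    (h0 : exitTime X Y (coord φ) k z ≠ 0) :
    tLength φ X Y (path z 1 (exitTime X Y (coord φ) k z - 1)) < k := by
  have h1 := stays_exitTime h
  by_contra hlt
  push Not at hlt
  have : Stays X Y k (exitTime X Y (coord φ) k z - 1) z := by
    intro n hn
    rcases hn.eq_or_lt with rfl | hn
    · exact hlt
    · exact h1 n (by omega)
  have := exitTime_le this
  omega

variable (hT : Transversals A B X Y)
include hT

theorem Transversals.exitTime_ne_zero {k : ℕ} (hk : 1 ≤ k) {z : ℕ → HNN φ}
    (h : ∃ m, Stays X Y k m z) : exitTime X Y (coord φ) k z ≠ 0 := by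
  intro h0
  have := stays_exitTime h 0 (by omega)
  rw [path_zero, hT.tLength_one] at this
  omega

/-- The normal form of the position at the exit time `eₖ`. -/
theorem Transversals.exitTime_block {k : ℕ} (hk : 1 ≤ k) {z : ℕ → HNN φ}
    (hz : ∀ i, z i ∈ stepSet φ) (h : ∃ m, Stays X Y k m z) :
    ∃ (l₀ : List (G₀ × ℤˣ)) (b : Block G₀), l₀.length + 1 = k ∧ b ∈ blocks A B X Y ∧
      IsNormal X Y (l₀ ++ [(b.rep, b.sign)]) ∧
      path z 1 (exitTime X Y (coord φ) k z) = word φ l₀ * b.val φ ∧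
      lastBlock φ X Y (path z 1 (exitTime X Y (coord φ) k z)) = b := by
  have h0 := hT.exitTime_ne_zero hk h
  have h1 := tLength_exitTime_sub_one h h0
  have h2 := stays_exitTime h _ le_rfl
  obtain ⟨e, he⟩ := Nat.exists_eq_succ_of_ne_zero h0
  rw [he, Nat.succ_sub_one] at h1
  rw [he, Nat.succ_eq_add_one] at h2 ⊢
  rw [path_succ] at h2 ⊢
  have h3 := hT.tLength_step (g := path z 1 e) (hz e)
  obtain ⟨r, ε, hr, htail⟩ := hT.step_up (g := path z 1 e) (hz e) (by omega)
  obtain ⟨hn, hw⟩ := hT.nfWord_spec φ (path z 1 e * z e)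
  have hlen : (nfWord φ X Y (path z 1 e)).length + 1 = k := by
    have := hT.tLength_eq φ (path z 1 e)
    omega
  rw [hr] at hn hw
  have hval := word_concat_mul φ (nfWord φ X Y (path z 1 e))
    ⟨r, ε, nfTail φ X Y (path z 1 e * z e)⟩
  simp only at hval
  have hval := hw.symm.trans hval
  refine ⟨nfWord φ X Y (path z 1 e), ⟨r, ε, nfTail φ X Y (path z 1 e * z e)⟩, hlen,
    ⟨hn.1 (r, ε) (by simp), htail⟩, hn, hval, ?_⟩
  conv_lhs => rw [hval]
  exact hT.lastBlock_eq φ hn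

theorem Transversals.exitTime_lt {k : ℕ} {z : ℕ → HNN φ} (hz : ∀ i, z i ∈ stepSet φ)
    (h : ∃ m, Stays X Y k m z) (h' : ∃ m, Stays X Y (k + 1) m z) :
    exitTime X Y (coord φ) k z < exitTime X Y (coord φ) (k + 1) z := by
  have h1 : exitTime X Y (coord φ) k z ≤ exitTime X Y (coord φ) (k + 1) z :=
    exitTime_le fun n hn => by have := stays_exitTime h' n hn; omega
  refine lt_of_le_of_ne h1 fun heq => ?_
  have h2 := stays_exitTime h' _ le_rfl
  rw [← heq] at h2
  rcases Nat.eq_zero_or_pos k with rfl | hk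
  · have : exitTime X Y (coord φ) 0 z = 0 := exitTime_eq (fun _ _ => Nat.zero_le _) (Or.inl rfl)
    rw [this, path_zero, hT.tLength_one] at h2
    omega
  · obtain ⟨l₀, b, hl, -, hn, hp, -⟩ := hT.exitTime_block hk hz h
    rw [hp, ← word_concat_mul, hT.tLength_word φ hn] at h2
    simp at h2
    omega

/-- The event in the definition of the transition probability from `t^ε h`: the path started
in `t^ε h` is at `t^ε b` at time `n`, at a vertex of length `1` just before, and it avoids `G₀`. -/
def stepEvent (φ : A ≃* B) (X Y : Set G₀) (ε : ℤˣ) (h : G₀) (b : Block G₀) (n : ℕ) :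
    Set (ℕ → HNN φ) :=
  {z | path z (tailVal φ ε h) n = tPow φ ε * b.val φ ∧
    tLength φ X Y (path z (tailVal φ ε h) (n - 1)) = 1 ∧
    ∀ m, m < n → 1 ≤ tLength φ X Y (path z (tailVal φ ε h) m)}

/-- The path started in `t^ε h` never visits `G₀`. -/
def escapeEvent (φ : A ≃* B) (ε : ℤˣ) (h : G₀) : Set (ℕ → HNN φ) :=
  {z | ∀ n, 1 ≤ n → path z (tailVal φ ε h) n ∉ Set.range (HNNExtension.of : G₀ →* HNN φ)}

theorem Transversals.mem_escapeEvent_iff {ε : ℤˣ} {h : G₀} {z : ℕ → HNN φ} :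
    z ∈ escapeEvent φ ε h ↔ ∀ n, 1 ≤ tLength φ X Y (path z (tailVal φ ε h) n) := by
  simp only [escapeEvent, Set.mem_ofPred_eq, hT.notMem_range_iff]
  refine ⟨fun H n => ?_, fun H n _ => H n⟩
  rcases Nat.eq_zero_or_pos n with rfl | hn
  · rw [path_zero, hT.tLength_eq, (hT.nf_tailVal ε h).1]; simp
  · exact H n hn

/-- Escaping from the cone of an arbitrary vertex amounts to `escapeEvent`. -/
theorem Transversals.mem_escapeEvent_iff_translate {z : ℕ → HNN φ} (hz : ∀ i, z i ∈ stepSet φ)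
    {l₀ : List (G₀ × ℤˣ)} {g : G₀} {ε : ℤˣ} (h0 : IsNormal X Y (l₀ ++ [(g, ε)])) (h : G₀) :
    z ∈ escapeEvent φ ε h ↔ ∀ n, l₀.length + 1 ≤
      tLength φ X Y (path z (word φ l₀ * HNNExtension.of g * tailVal φ ε h) n) := by
  rw [hT.mem_escapeEvent_iff]
  exact ⟨fun H n => (hT.cone_iff hz h0 h n).1.mp (fun m _ => H m) n le_rfl,
    fun H n => (hT.cone_iff hz h0 h n).1.mpr (fun m _ => H m) n le_rfl⟩

theorem Transversals.stays_iff {z : ℕ → HNN φ} (hz : ∀ i, z i ∈ stepSet φ) {N : ℕ}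
    {l₀ : List (G₀ × ℤˣ)} {b : Block G₀} (h0 : IsNormal X Y (l₀ ++ [(b.rep, b.sign)]))
    (hN : path z 1 N = word φ l₀ * b.val φ) :
    Stays X Y (l₀.length + 1) N z ↔ shiftSeq N z ∈ escapeEvent φ b.sign b.tail := by
  rw [hT.mem_escapeEvent_iff_translate (z := shiftSeq N z) (fun i => hz (N + i)) h0 b.tail]
  have h1 : ∀ n, path z 1 (N + n) = path (shiftSeq N z)
      (word φ l₀ * HNNExtension.of b.rep * tailVal φ b.sign b.tail) n := by
    intro n
    rw [path_add, hN, Block.val, mul_assoc]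
  simp only [← h1]
  exact ⟨fun H n => H _ (by omega), fun H n hn => by
    obtain ⟨m, rfl⟩ := Nat.exists_eq_add_of_le hn; exact H m⟩

/-- The normal form at the exit time `eₖ₊₁` extends the one at the exit time `eₖ` by a block. -/
theorem Transversals.exitTime_block_succ {z : ℕ → HNN φ} (hz : ∀ i, z i ∈ stepSet φ) {N : ℕ}
    {l₀ : List (G₀ × ℤˣ)} {b : Block G₀} (h0 : IsNormal X Y (l₀ ++ [(b.rep, b.sign)]))
    (hN : path z 1 N = word φ l₀ * b.val φ) (hst : Stays X Y (l₀.length + 1) N z)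
    (hex : ∃ m, Stays X Y (l₀.length + 2) m z)
    (hle : N ≤ exitTime X Y (coord φ) (l₀.length + 2) z) :
    ∃ b' : Block G₀, b' ∈ blocks A B X Y ∧
      IsNormal X Y (l₀ ++ [(b.rep, b.sign)] ++ [(b'.rep, b'.sign)]) ∧
      path z 1 (exitTime X Y (coord φ) (l₀.length + 2) z)
        = word φ (l₀ ++ [(b.rep, b.sign)]) * b'.val φ ∧
      lastBlock φ X Y (path z 1 (exitTime X Y (coord φ) (l₀.length + 2) z)) = b' := by
  obtain ⟨l₁, b₁, hl₁, hb₁, hn₁, hp₁, hlast⟩ := hT.exitTime_block (by omega) hz hex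
  have hpre := hT.prefix_path hz (l := l₀ ++ [(b.rep, b.sign)]) (x := 1) (N := N)
    (M := exitTime X Y (coord φ) (l₀.length + 2) z)
    (by rw [hN, ← word_concat_mul, (hT.nf_eq φ h0 rfl).1])
    (fun n hn _ => by simpa using hst n hn) _ hle le_rfl
  rw [hp₁, ← word_concat_mul, (hT.nf_eq φ hn₁ rfl).1] at hpre
  have hl₁' : l₁ = l₀ ++ [(b.rep, b.sign)] := by
    have h1 : l₀ ++ [(b.rep, b.sign)] <+: l₁ :=
      List.prefix_of_prefix_length_le hpre (List.prefix_append _ _) (by simp; omega)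
    exact (h1.eq_of_length (by simp; omega)).symm
  subst hl₁'
  exact ⟨b₁, hb₁, hn₁, hp₁, hlast⟩

/-- A path in `stepEvent` that then escapes from the new vertex escapes from the old one, too. -/
theorem Transversals.escape_of_step {z : ℕ → HNN φ} (hz : ∀ i, z i ∈ stepSet φ) {ε : ℤˣ} {h : G₀}
    {b' : Block G₀} {n' : ℕ} (hn : IsNormal X Y ([(1, ε)] ++ [(b'.rep, b'.sign)]))
    (hJ : z ∈ stepEvent φ X Y ε h b' n')
    (hesc : shiftSeq n' z ∈ escapeEvent φ b'.sign b'.tail) :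
    (∀ n, n' ≤ n → 2 ≤ tLength φ X Y (path z (tailVal φ ε h) n)) ∧ z ∈ escapeEvent φ ε h := by
  have hesc' := (hT.mem_escapeEvent_iff_translate (fun i => hz (n' + i)) hn b'.tail).mp hesc
  have hge : ∀ n, n' ≤ n → 2 ≤ tLength φ X Y (path z (tailVal φ ε h) n) := by
    intro n hn
    obtain ⟨m, rfl⟩ := Nat.exists_eq_add_of_le hn
    rw [path_add, hJ.1]
    have := hesc' m
    rw [word_singleton, map_one, one_mul, mul_assoc] at this
    exact this
  refine ⟨hge, hT.mem_escapeEvent_iff.mpr fun n => ?_⟩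
  rcases lt_or_ge n n' with hn | hn
  · exact hJ.2.2 n hn
  · have := hge n hn; omega

/-- The description of the next pair of the exit chain in terms of the steps after the
exit time `eₖ = N`. -/
theorem Transversals.exitChain_succ_eq_iff {z : ℕ → HNN φ} (hz : ∀ i, z i ∈ stepSet φ) {N n' : ℕ}
    {l₀ : List (G₀ × ℤˣ)} {b b' : Block G₀}
    (h0 : IsNormal X Y (l₀ ++ [(b.rep, b.sign)] ++ [(b'.rep, b'.sign)]))
    (hN : path z 1 N = word φ l₀ * b.val φ)
    (hexit : exitTime X Y (coord φ) (l₀.length + 1) z = N) (hn' : 1 ≤ n') :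
    (Stays X Y (l₀.length + 1) N z ∧ (∃ m, Stays X Y (l₀.length + 2) m z) ∧
        exitChain X Y (coord φ) (l₀.length + 2) z = (b', n')) ↔
      shiftSeq N z ∈ stepEvent φ X Y b.sign b.tail b' n' ∧
        shiftSeq n' (shiftSeq N z) ∈ escapeEvent φ b'.sign b'.tail := by
  set x := tailVal φ b.sign b.tail with hx
  set z' := shiftSeq N z with hz'def
  have hz' : ∀ i, z' i ∈ stepSet φ := fun i => hz (N + i)
  set base := word φ l₀ * HNNExtension.of b.rep with hbase
  have hpath : ∀ n, path z 1 (N + n) = base * path z' x n := by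
    intro n
    rw [path_add, hN, Block.val, ← mul_assoc, path_mul_left]
  have hpath' : ∀ n, path z 1 (N + n) = path z' (base * x) n := by
    intro n; rw [hpath, path_mul_left]
  have hnb := h0.left
  have hb1 : IsNormal X Y ([(1, b.sign)] ++ [(b'.rep, b'.sign)]) := by
    have h := isNormal_concat_iff.mp h0
    exact isNormal_concat_iff (l := []).mpr
      ⟨isNormal_singleton_iff.mpr (hT.one_mem _), h.2⟩
  have hwl : word φ (l₀ ++ [(b.rep, b.sign)]) = base * tPow φ b.sign := by
    rw [word_append, word_singleton, mul_assoc]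
  constructor
  · rintro ⟨hst, hex, hch⟩
    have hcone : ∀ n, 1 ≤ tLength φ X Y (path z' x n) := by
      have := (hT.stays_iff hz hnb hN).mp hst
      rwa [hT.mem_escapeEvent_iff] at this
    have hlen : ∀ n, tLength φ X Y (path z 1 (N + n))
        = l₀.length + tLength φ X Y (path z' x n) := by
      intro n
      rw [hpath']
      exact (hT.cone_iff hz' hnb b.tail n).2 (fun m _ => hcone m) n le_rfl
    have hch1 := congrArg Prod.fst hch
    have hch2 := congrArg Prod.snd hch
    simp only [exitChain, Nat.add_succ_sub_one, hexit] at hch1 hch2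
    have he : exitTime X Y (coord φ) (l₀.length + 2) z = N + n' := by omega
    have hst' := stays_exitTime hex
    have hlt := tLength_exitTime_sub_one hex (by omega)
    obtain ⟨b₁, -, hn₁, hp₁, hlast⟩ := hT.exitTime_block_succ hz hnb hN hst hex (by omega)
    rw [he] at hst' hlt hp₁ hlast hch1
    have hb₁ : b₁ = b' := hlast.symm.trans hch1
    subst hb₁
    refine ⟨⟨?_, ?_, fun m _ => hcone m⟩, ?_⟩
    · have := hpath n'
      rw [hp₁, hwl, mul_assoc] at this
      exact (mul_left_cancel this).symm
    · have h1 := hlen (n' - 1)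
      have h2 := hcone (n' - 1)
      rw [show N + n' - 1 = N + (n' - 1) by omega] at hlt
      change tLength φ X Y (path z' x (n' - 1)) = 1
      omega
    · have h3 := (hT.stays_iff hz hn₁ hp₁).mp (by simpa using hst')
      have h4 : shiftSeq n' z' = shiftSeq (N + n') z := by
        funext i; simp [shiftSeq, hz'def, add_assoc]
      rwa [h4]
  · rintro ⟨hJ, hesc⟩
    obtain ⟨hge, hcone⟩ := hT.escape_of_step hz' hb1 hJ hesc
    obtain ⟨hJ1, hJ2, -⟩ := hJ
    rw [hT.mem_escapeEvent_iff] at hcone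
    rw [← hx] at hJ1 hJ2
    change ∀ n, 1 ≤ tLength φ X Y (path z' x n) at hcone
    change ∀ n, n' ≤ n → 2 ≤ tLength φ X Y (path z' x n) at hge
    have hlen : ∀ n, tLength φ X Y (path z 1 (N + n))
        = l₀.length + tLength φ X Y (path z' x n) := by
      intro n
      rw [hpath']
      exact (hT.cone_iff hz' hnb b.tail n).2 (fun m _ => hcone m) n le_rfl
    have hst : Stays X Y (l₀.length + 1) N z := by
      intro n hn
      obtain ⟨m, rfl⟩ := Nat.exists_eq_add_of_le hn
      rw [hlen]; have := hcone m; omega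
    have hst' : Stays X Y (l₀.length + 2) (N + n') z := by
      intro n hn
      obtain ⟨m, rfl⟩ := Nat.exists_eq_add_of_le (show N ≤ n by omega)
      rw [hlen]; have := hge m (by omega); omega
    have he : exitTime X Y (coord φ) (l₀.length + 2) z = N + n' := by
      refine exitTime_eq hst' (Or.inr ?_)
      rw [show N + n' - 1 = N + (n' - 1) by omega, hlen, hJ2]
      omega
    refine ⟨hst, ⟨_, hst'⟩, ?_⟩
    have hp : path z 1 (N + n') = word φ (l₀ ++ [(b.rep, b.sign)]) * b'.val φ := by
      rw [hpath, hJ1, hwl, mul_assoc base]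
    simp only [exitChain, Nat.add_succ_sub_one, hexit, he, Prod.mk.injEq]
    refine ⟨?_, by omega⟩
    change lastBlock φ X Y (path z 1 (N + n')) = b'
    rw [hp]
    exact hT.lastBlock_eq φ h0

end

end HNNWalk

/-! ### The law of a sequence of independent steps -/

namespace HNNWalk

section

variable {α : Type*} [MeasurableSpace α]

/-- The law of a sequence of independent random variables with law `μ`. -/
noncomputable def seqLaw (μ : Measure α) : Measure (ℕ → α) := Measure.infinitePi fun _ => μ

instance instIsProbabilityMeasureSeqLaw (μ : Measure α) [IsProbabilityMeasure μ] :
    IsProbabilityMeasure (seqLaw μ) := by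
  unfold seqLaw; infer_instance

/-- The event `E` is decided by the first `N` entries of the sequence. -/
def DecidedBy (N : ℕ) (E : Set (ℕ → α)) : Prop :=
  ∀ z z', (∀ i < N, z i = z' i) → z ∈ E → z' ∈ E

theorem measurable_shiftSeq (N : ℕ) : Measurable (shiftSeq N : (ℕ → α) → ℕ → α) :=
  measurable_pi_lambda _ fun i => measurable_pi_apply (N + i)

theorem seqLaw_map_shiftSeq (μ : Measure α) [IsProbabilityMeasure μ] (N : ℕ) :
    (seqLaw μ).map (shiftSeq N) = seqLaw μ :=
  Measure.map_infinitePi_infinitePi_of_inj (P := fun _ : ℕ => μ) (f := fun i => N + i)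
    (fun i j h => by simpa using h)

theorem seqLaw_shiftSeq (μ : Measure α) [IsProbabilityMeasure μ] (N : ℕ) {E : Set (ℕ → α)}
    (hE : MeasurableSet E) : seqLaw μ (shiftSeq N ⁻¹' E) = seqLaw μ E := by
  rw [← Measure.map_apply (measurable_shiftSeq N) hE, seqLaw_map_shiftSeq]

theorem seqLaw_eval (μ : Measure α) [IsProbabilityMeasure μ] (i : ℕ) {s : Set α}
    (hs : MeasurableSet s) : seqLaw μ {z | z i ∈ s} = μ s :=
  (measurePreserving_eval_infinitePi (fun _ : ℕ => μ) i).measure_preimage hs.nullMeasurableSet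

variable [Countable α] [DiscreteMeasurableSpace α]

omit [MeasurableSpace α] [Countable α] [DiscreteMeasurableSpace α] in
theorem DecidedBy.eq_preimage {N : ℕ} {E : Set (ℕ → α)} (hE : DecidedBy N E) :
    E = (fun (z : ℕ → α) (i : Fin N) => z i) ⁻¹' ((fun (z : ℕ → α) (i : Fin N) => z i) '' E) := by
  refine Set.Subset.antisymm (Set.subset_preimage_image _ _) ?_
  rintro z ⟨z', hz', h⟩
  exact hE z' z (fun i hi => congrFun h ⟨i, hi⟩) hz'

theorem DecidedBy.measurableSet {N : ℕ} {E : Set (ℕ → α)} (hE : DecidedBy N E) :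
    MeasurableSet E := by
  rw [hE.eq_preimage]
  exact (measurable_pi_lambda _ fun i => measurable_pi_apply _) (Set.to_countable _).measurableSet

/-- The Markov property of a sequence of independent identically distributed steps. -/
theorem seqLaw_inter_shiftSeq (μ : Measure α) [IsProbabilityMeasure μ] {N : ℕ}
    {E F : Set (ℕ → α)} (hE : DecidedBy N E) (hF : MeasurableSet F) :
    seqLaw μ (E ∩ shiftSeq N ⁻¹' F) = seqLaw μ E * seqLaw μ F := by
  have hind : ProbabilityTheory.iIndepFun (fun (i : ℕ) (z : ℕ → α) => z i) (seqLaw μ) :=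
    ProbabilityTheory.iIndepFun_infinitePi (P := fun _ : ℕ => μ) (X := fun _ x => x)
      (fun _ => measurable_id)
  have hind' := ProbabilityTheory.indep_iSup_of_disjoint
    (m := fun i : ℕ => MeasurableSpace.comap (fun z : ℕ → α => z i) inferInstance)
    (fun i => (measurable_pi_apply i).comap_le) hind.iIndep
    (Set.Iio_disjoint_Ici (le_refl N))
  rw [ProbabilityTheory.Indep_iff] at hind'
  have h1 : MeasurableSet[⨆ i ∈ Set.Iio N,
      MeasurableSpace.comap (fun z : ℕ → α => z i) inferInstance] E := by
    rw [hE.eq_preimage]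
    refine (@measurable_pi_lambda _ _ _ (_) _ _ fun i => ?_) (Set.to_countable _).measurableSet
    refine Measurable.of_comap_le ?_
    exact le_iSup₂_of_le (f := fun (i : ℕ) (_ : i ∈ Set.Iio N) =>
      MeasurableSpace.comap (fun z : ℕ → α => z i) inferInstance) (i : ℕ) i.2 le_rfl
  have h2 : MeasurableSet[⨆ i ∈ Set.Ici N,
      MeasurableSpace.comap (fun z : ℕ → α => z i) inferInstance] (shiftSeq N ⁻¹' F) := by
    refine (@measurable_pi_lambda _ _ _ (_) _ _ fun i => ?_) hF
    refine Measurable.of_comap_le ?_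
    exact le_iSup₂_of_le (f := fun (i : ℕ) (_ : i ∈ Set.Ici N) =>
      MeasurableSpace.comap (fun z : ℕ → α => z i) inferInstance) (N + i)
        (Nat.le_add_right _ _) le_rfl
  rw [hind' _ _ h1 h2, seqLaw_shiftSeq μ N hF]

theorem seqLaw_cylinder_pos (μ : Measure α) [IsProbabilityMeasure μ] (N : ℕ) (s : ℕ → α)
    (hs : ∀ i < N, 0 < μ {s i}) : 0 < seqLaw μ {z | ∀ i < N, z i = s i} := by
  have : {z : ℕ → α | ∀ i < N, z i = s i} = Set.pi (Finset.range N) fun i => {s i} := by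
    ext z; simp
  rw [this, seqLaw, Measure.infinitePi_pi _ fun i _ => measurableSet_singleton _]
  rw [pos_iff_ne_zero, Finset.prod_ne_zero_iff]
  exact fun i hi => (hs i (Finset.mem_range.mp hi)).ne'

end

/-! ### Measurability of the walk -/

section

variable {G₀ : Type*} [Group G₀] {A B : Subgroup G₀} {φ : A ≃* B} {X Y : Set G₀}

instance instDiscreteMeasurableSpaceHNN : DiscreteMeasurableSpace (HNN φ) :=
  ⟨fun _ => trivial⟩

theorem exists_list_of_generation {μ₀ : PMF G₀} (hgen : Subsemigroup.closure μ₀.support = ⊤)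
    (g : G₀) : ∃ l : List G₀, (∀ x ∈ l, x ∈ μ₀.support) ∧ l.prod = g := by
  have hle : Subsemigroup.closure μ₀.support ≤ (Submonoid.closure μ₀.support).toSubsemigroup :=
    Subsemigroup.closure_le.mpr Submonoid.subset_closure
  rw [hgen] at hle
  exact Submonoid.exists_list_of_mem_closure (hle (Set.mem_univ g))

theorem countable_of_generation {μ₀ : PMF G₀} (hgen : Subsemigroup.closure μ₀.support = ⊤) :
    Countable G₀ := by
  have : Countable μ₀.support := μ₀.support_countable
  refine Function.Surjective.countable
    (f := fun l : List μ₀.support => (l.map Subtype.val).prod) fun g => ?_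
  obtain ⟨l, hl, rfl⟩ := exists_list_of_generation hgen g
  exact ⟨l.attach.map fun x => ⟨x.1, hl x.1 x.2⟩, by simp [Function.comp_def]⟩

theorem Transversals.countable [Countable G₀] (hT : Transversals A B X Y) (φ : A ≃* B) :
    Countable (HNN φ) := by
  have : Countable ℤˣ := Finite.to_countable
  refine Function.Surjective.countable
    (f := fun x : List (G₀ × ℤˣ) × G₀ => word φ x.1 * HNNExtension.of x.2) ?_
  intro g
  obtain ⟨l, h, -, hg⟩ := hT.exists_word φ g
  exact ⟨(l, h), hg⟩

theorem decidedBy_path (x : HNN φ) (n : ℕ) (S : Set (HNN φ)) :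
    DecidedBy n {z : ℕ → HNN φ | path z x n ∈ S} := by
  intro z z' h hz
  simpa only [Set.mem_ofPred_eq, path_congr h] using hz

variable [Countable (HNN φ)]

theorem measurable_path (x : HNN φ) (n : ℕ) : Measurable fun z : ℕ → HNN φ => path z x n :=
  fun S _ => (decidedBy_path x n S).measurableSet

theorem measurableSet_path (x : HNN φ) (n : ℕ) (S : Set (HNN φ)) :
    MeasurableSet {z : ℕ → HNN φ | path z x n ∈ S} := (decidedBy_path x n S).measurableSet

theorem measurableSet_stays (k m : ℕ) : MeasurableSet {z : ℕ → HNN φ | Stays X Y k m z} := by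
  have : {z : ℕ → HNN φ | Stays X Y k m z}
      = ⋂ n, ⋂ _ : m ≤ n, {z | path z 1 n ∈ {g | k ≤ tLength φ X Y g}} := by
    ext z; simp [Stays]
  rw [this]
  exact MeasurableSet.iInter fun n => MeasurableSet.iInter fun _ => measurableSet_path _ _ _

theorem measurable_exitTime (k : ℕ) : Measurable (exitTime X Y (coord φ) k) := by
  refine measurable_to_countable' fun m => ?_
  have : exitTime X Y (coord φ) k ⁻¹' {m} =
      ({z | Stays X Y k m z} ∩ ⋂ m' ∈ Set.Iio m, {z | Stays X Y k m' z}ᶜ) ∪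
        ({_z | m = 0} ∩ ⋂ m', {z | Stays X Y k m' z}ᶜ) := by
    ext z
    simp only [Set.mem_preimage, Set.mem_singleton_iff, Set.mem_union, Set.mem_inter_iff,
      Set.mem_ofPred_eq, Set.mem_iInter, Set.mem_Iio, Set.mem_compl_iff]
    constructor
    · rintro rfl
      by_cases h : ∃ m, Stays X Y k m z
      · exact Or.inl ⟨stays_exitTime h, fun m' hm' hs => by have := exitTime_le hs; omega⟩
      · push Not at h
        refine Or.inr ⟨?_, h⟩
        have : {m | ∀ n, m ≤ n → k ≤ tLength φ X Y (walk (coord φ) 1 n z)} = ∅ :=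
          Set.eq_empty_of_forall_notMem h
        rw [exitTime, this, Nat.sInf_empty]
    · rintro (⟨h1, h2⟩ | ⟨rfl, h⟩)
      · refine le_antisymm (exitTime_le h1) ?_
        by_contra hlt
        exact h2 _ (by omega) (stays_exitTime ⟨m, h1⟩)
      · have : {m | ∀ n, m ≤ n → k ≤ tLength φ X Y (walk (coord φ) 1 n z)} = ∅ :=
          Set.eq_empty_of_forall_notMem h
        rw [exitTime, this, Nat.sInf_empty]
  rw [this]
  refine MeasurableSet.union (MeasurableSet.inter (measurableSet_stays _ _) ?_)
    (MeasurableSet.inter (MeasurableSet.const _) ?_)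
  · exact MeasurableSet.biInter (Set.to_countable _) fun m' _ => (measurableSet_stays _ _).compl
  · exact MeasurableSet.iInter fun m' => (measurableSet_stays _ _).compl

theorem measurable_path_exitTime (k : ℕ) :
    Measurable fun z : ℕ → HNN φ => path z 1 (exitTime X Y (coord φ) k z) := by
  have h : Measurable fun p : (ℕ → HNN φ) × ℕ => path p.1 (1 : HNN φ) p.2 :=
    measurable_from_prod_countable_left fun n => measurable_path 1 n
  exact h.comp (measurable_id.prodMk (measurable_exitTime k))

theorem measurableSet_exitChain (k : ℕ) (S : Set (Block G₀ × ℕ)) :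
    MeasurableSet {z : ℕ → HNN φ | exitChain X Y (coord φ) k z ∈ S} := by
  have h : Measurable fun z : ℕ → HNN φ => (path z 1 (exitTime X Y (coord φ) k z),
      exitTime X Y (coord φ) k z, exitTime X Y (coord φ) (k - 1) z) :=
    (measurable_path_exitTime k).prodMk ((measurable_exitTime k).prodMk (measurable_exitTime _))
  exact h (t := {p : HNN φ × ℕ × ℕ | (lastBlock φ X Y p.1, p.2.1 - p.2.2) ∈ S})
    (Set.to_countable _).measurableSet

theorem measurableSet_escapeEvent (ε : ℤˣ) (h : G₀) :
    MeasurableSet (escapeEvent φ ε h) := by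
  have : escapeEvent φ ε h = ⋂ n, ⋂ _ : 1 ≤ n, {z : ℕ → HNN φ | path z (tailVal φ ε h) n ∈
      (Set.range (HNNExtension.of : G₀ →* HNN φ))ᶜ} := by
    ext z; simp [escapeEvent]
  rw [this]
  exact MeasurableSet.iInter fun n => MeasurableSet.iInter fun _ => measurableSet_path _ _ _

omit [Countable (HNN φ)] in
theorem decidedBy_stepEvent (ε : ℤˣ) (h : G₀) (b : Block G₀) (n : ℕ) :
    DecidedBy n (stepEvent φ X Y ε h b n) := by
  rintro z z' hzz' ⟨h1, h2, h3⟩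
  refine ⟨?_, ?_, fun m hm => ?_⟩
  · rw [← path_congr hzz']; exact h1
  · rw [← path_congr fun i hi => hzz' i (by omega)]; exact h2
  · rw [← path_congr fun i hi => hzz' i (by omega)]; exact h3 m hm

end

end HNNWalk

/-! ### A spectral gap on `ℓ²` and the Green function -/

namespace HNNWalk

open scoped ENNReal

/-- The square of the distance of two extended nonnegative numbers (one of the two truncated
differences vanishes). -/
noncomputable def sqDist (a b : ℝ≥0∞) : ℝ≥0∞ := (a - b) ^ 2 + (b - a) ^ 2

theorem sqDist_comm (a b : ℝ≥0∞) : sqDist a b = sqDist b a := add_comm _ _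

theorem sqDist_add_self {a : ℝ≥0∞} (ha : a ≠ ∞) (c : ℝ≥0∞) : sqDist a (a + c) = c ^ 2 := by
  rw [sqDist, ENNReal.add_sub_cancel_left ha, tsub_eq_zero_of_le le_self_add]; simp

theorem sq_add_sq_eq {a b : ℝ≥0∞} (ha : a ≠ ∞) (hb : b ≠ ∞) :
    a ^ 2 + b ^ 2 = 2 * (a * b) + sqDist a b := by
  rcases le_total a b with h | h
  · obtain ⟨c, rfl⟩ := le_iff_exists_add.mp h
    rw [sqDist_add_self ha]; ring
  · obtain ⟨c, rfl⟩ := le_iff_exists_add.mp h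
    rw [sqDist_comm, sqDist_add_self hb]; ring

theorem two_mul_le_sq_add_sq {a b : ℝ≥0∞} (ha : a ≠ ∞) (hb : b ≠ ∞) :
    2 * (a * b) ≤ a ^ 2 + b ^ 2 := by
  rw [sq_add_sq_eq ha hb]; exact le_self_add

theorem two_mul_sq_le {a b : ℝ≥0∞} (ha : a ≠ ∞) (hb : b ≠ ∞) :
    2 * a ^ 2 ≤ 3 * b ^ 2 + 6 * sqDist a b := by
  rcases le_total a b with h | h
  · calc 2 * a ^ 2 ≤ 3 * b ^ 2 := by gcongr; norm_num
      _ ≤ _ := le_self_add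
  · obtain ⟨c, rfl⟩ := le_iff_exists_add.mp h
    rw [sqDist_comm, sqDist_add_self hb]
    have hc : c ≠ ∞ := fun h => ha (by simp [h])
    have := two_mul_le_sq_add_sq hb (b := 2 * c) (ENNReal.mul_ne_top (by simp) hc)
    calc 2 * (b + c) ^ 2 = 2 * b ^ 2 + 2 * c ^ 2 + 2 * (b * (2 * c)) := by ring
      _ ≤ 2 * b ^ 2 + 2 * c ^ 2 + (b ^ 2 + (2 * c) ^ 2) := by gcongr
      _ = _ := by ring

section

variable {G V : Type*} [Group G] [MulAction G V]

/-- The squared `ℓ²`-distance of the function `S` and of its translate by `g`. -/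
noncomputable def displacement (S : V → ℝ≥0∞) (g : G) : ℝ≥0∞ := ∑' v, sqDist (S (g⁻¹ • v)) (S v)

theorem tsum_smul (f : V → ℝ≥0∞) (g : G) : ∑' v, f (g • v) = ∑' v, f v :=
  (MulAction.toPerm g).tsum_eq f

open scoped Classical in
/-- A paradoxical decomposition bounds the `ℓ²`-norm by the displacements of three elements: the
sets `C`, `D`, `x C`, `y D` are pairwise disjoint, but `C` and `t D` cover everything. A function
that is almost invariant under `x`, `y`, `t` has about as much mass on `x C`, `y D`, `t D` as on
`C`, `D`, `D`, so that its total mass would have to be at least twice itself. -/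
theorem tsum_sq_le_displacement {S : V → ℝ≥0∞} (hS : ∀ v, S v ≠ ∞) (hN : ∑' v, S v ^ 2 ≠ ∞)
    {C D : Set V} {t x y : G} (hcover : ∀ v, v ∈ C ∨ t⁻¹ • v ∈ D) (hCD : ∀ v ∈ C, v ∉ D)
    (hx : ∀ v, x⁻¹ • v ∈ C → v ∉ C ∧ v ∉ D) (hy : ∀ v, y⁻¹ • v ∈ D → v ∉ C ∧ v ∉ D)
    (hxy : ∀ v, x⁻¹ • v ∈ C → y⁻¹ • v ∉ D) :
    ∑' v, S v ^ 2 ≤ 30 * (displacement S t + displacement S x + displacement S y) := by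
  set N := ∑' v, S v ^ 2 with hNdef
  set c := ∑' v, if v ∈ C then S v ^ 2 else 0 with hc
  set d := ∑' v, if v ∈ D then S v ^ 2 else 0 with hd
  set cx := ∑' v, if x⁻¹ • v ∈ C then S v ^ 2 else 0 with hcx
  set dy := ∑' v, if y⁻¹ • v ∈ D then S v ^ 2 else 0 with hdy
  set dt := ∑' v, if t⁻¹ • v ∈ D then S v ^ 2 else 0 with hdt
  have hdisj : c + cx + d + dy ≤ N := by
    rw [hc, hd, hcx, hdy, ← ENNReal.tsum_add, ← ENNReal.tsum_add, ← ENNReal.tsum_add]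
    refine ENNReal.tsum_le_tsum fun v => ?_
    by_cases a1 : v ∈ C
    · have a2 := hCD v a1
      have a3 : x⁻¹ • v ∉ C := fun h => (hx v h).1 a1
      have a4 : y⁻¹ • v ∉ D := fun h => (hy v h).1 a1
      simp only [a1, a2, a3, a4, if_true, if_false, add_zero, le_refl]
    by_cases a3 : x⁻¹ • v ∈ C
    · have a4 := hxy v a3
      have a2 := (hx v a3).2
      simp only [a1, a2, a3, a4, if_true, if_false, add_zero, zero_add, le_refl]
    by_cases a4 : y⁻¹ • v ∈ D
    · have a2 := (hy v a4).2
      simp only [a1, a2, a3, a4, if_true, if_false, add_zero, zero_add, le_refl]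
    simp only [a1, a3, a4, if_false, add_zero, zero_add]
    split_ifs <;> simp
  have hcov : N ≤ c + dt := by
    rw [hc, hdt, ← ENNReal.tsum_add]
    refine ENNReal.tsum_le_tsum fun v => ?_
    rcases hcover v with h | h
    · simp [h]
    · simp [h]
  have htrans : ∀ (g : G) (E : Set V),
      2 * (∑' v, if v ∈ E then S v ^ 2 else 0)
        ≤ 3 * (∑' v, if g⁻¹ • v ∈ E then S v ^ 2 else 0) + 6 * displacement S g := by
    intro g E
    rw [← tsum_smul (fun v => if v ∈ E then S v ^ 2 else 0) g⁻¹, displacement,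
      ← ENNReal.tsum_mul_left, ← ENNReal.tsum_mul_left, ← ENNReal.tsum_mul_left,
      ← ENNReal.tsum_add]
    refine ENNReal.tsum_le_tsum fun v => ?_
    split_ifs
    · exact two_mul_sq_le (hS _) (hS _)
    · simp
  have htrans' : 2 * dt ≤ 3 * d + 6 * displacement S t := by
    rw [hdt, hd, ← tsum_smul (fun v => if v ∈ D then S v ^ 2 else 0) t⁻¹, displacement,
      ← ENNReal.tsum_mul_left, ← ENNReal.tsum_mul_left, ← ENNReal.tsum_mul_left,
      ← ENNReal.tsum_add]
    refine ENNReal.tsum_le_tsum fun v => ?_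
    split_ifs
    · rw [sqDist_comm]; exact two_mul_sq_le (hS _) (hS _)
    · simp
  have h1 := htrans x C
  have h2 := htrans y D
  rw [← hc, ← hcx] at h1
  rw [← hd, ← hdy] at h2
  by_cases hδ : displacement S t + displacement S x + displacement S y = ∞
  · rw [hδ]; simp
  rw [ENNReal.add_eq_top, ENNReal.add_eq_top] at hδ
  push Not at hδ
  obtain ⟨⟨ht', hx'⟩, hy'⟩ := hδ
  have hfin : ∀ E : V → Prop, (∑' v, if E v then S v ^ 2 else 0) ≠ ∞ := fun E =>
    ne_top_of_le_ne_top hN (ENNReal.tsum_le_tsum fun v => by split_ifs <;> simp)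
  have hcf : c ≠ ∞ := hfin _
  have hdf : d ≠ ∞ := hfin _
  have hcxf : cx ≠ ∞ := hfin _
  have hdyf : dy ≠ ∞ := hfin _
  have hdtf : dt ≠ ∞ := hfin _
  clear_value N c d cx dy dt
  generalize displacement S t = δt at *
  generalize displacement S x = δx at *
  generalize displacement S y = δy at *
  lift N to NNReal using hN
  lift c to NNReal using hcf
  lift d to NNReal using hdf
  lift cx to NNReal using hcxf
  lift dy to NNReal using hdyf
  lift dt to NNReal using hdtf
  lift δt to NNReal using ht'
  lift δx to NNReal using hx'
  lift δy to NNReal using hy'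
  norm_cast at *
  have e : ∀ a b : NNReal, a ≤ b ↔ (a : ℝ) ≤ b := fun a b => NNReal.coe_le_coe.symm
  rw [e] at *
  push_cast at *
  have := c.2; have := d.2; have := cx.2; have := dy.2; have := δt.2; have := δx.2; have := δy.2
  simp only [NNReal.val_eq_coe] at *
  -- `5 / 3 * (c + d) ≤ N + 2 * (δx + δy)` and `N ≤ 3 / 2 * (c + d) + 3 * δt`
  linarith

end

section

variable {G₀ : Type*} [Group G₀] {A B : Subgroup G₀} {φ : A ≃* B} [Countable (HNN φ)]
  (μ : Measure (HNN φ)) [IsProbabilityMeasure μ]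
  {V : Type*} [MulAction (HNN φ) V] (o : V)

/-- The probability that the walk on `V` with steps of law `μ` started in `o` is at `v` at
time `n`. -/
noncomputable def visitProb (n : ℕ) (v : V) : ℝ≥0∞ := seqLaw μ {z | path z 1 n • o = v}

/-- The expected number of visits of the walk in `v` before time `K`. -/
noncomputable def truncGreen (K : ℕ) (v : V) : ℝ≥0∞ := ∑ n ∈ Finset.range K, visitProb μ o n v

omit [Countable (HNN φ)] in
theorem visitProb_le_one (n : ℕ) (v : V) : visitProb μ o n v ≤ 1 := prob_le_one

omit [Countable (HNN φ)] in
theorem truncGreen_le (K : ℕ) (v : V) : truncGreen μ o K v ≤ K := by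
  calc truncGreen μ o K v ≤ ∑ _n ∈ Finset.range K, (1 : ℝ≥0∞) :=
        Finset.sum_le_sum fun n _ => visitProb_le_one μ o n v
    _ = K := by simp

omit [Countable (HNN φ)] in
theorem truncGreen_ne_top (K : ℕ) (v : V) : truncGreen μ o K v ≠ ∞ :=
  ne_top_of_le_ne_top (by simp) (truncGreen_le μ o K v)

omit [Countable (HNN φ)] [IsProbabilityMeasure μ] in
theorem truncGreen_mono {K K' : ℕ} (h : K ≤ K') (v : V) :
    truncGreen μ o K v ≤ truncGreen μ o K' v :=
  Finset.sum_le_sum_of_subset (Finset.range_mono h)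

omit [IsProbabilityMeasure μ] in
theorem tsum_measure_path {x : HNN φ} {n : ℕ} (E : Set (ℕ → HNN φ)) (hE : MeasurableSet E) :
    seqLaw μ E = ∑' g, seqLaw μ ({z | path z x n = g} ∩ E) := by
  rw [← measure_iUnion]
  · congr 1; ext z; simp
  · intro g g' hgg'
    refine Set.disjoint_left.mpr fun z hz hz' => hgg' (hz.1.symm.trans hz'.1)
  · exact fun g => (measurableSet_path x n {g}).inter hE

theorem tsum_visitProb [Countable V] (n : ℕ) : ∑' v, visitProb μ o n v = 1 := by
  unfold visitProb
  rw [← measure_iUnion]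
  · have : (⋃ v, {z : ℕ → HNN φ | path z 1 n • o = v}) = Set.univ := by ext z; simp
    rw [this, measure_univ]
  · intro g g' hgg'
    exact Set.disjoint_left.mpr fun z hz hz' => hgg' (hz.symm.trans hz')
  · exact fun v => measurableSet_path 1 n {g | g • o = v}

theorem tsum_truncGreen_sq [Countable V] (K : ℕ) : ∑' v, truncGreen μ o K v ^ 2 ≠ ∞ := by
  have h : ∑' v, truncGreen μ o K v = K := by
    unfold truncGreen
    rw [Summable.tsum_finsetSum fun _ _ => ENNReal.summable]
    simp [tsum_visitProb]
  refine ne_top_of_le_ne_top (b := (K : ℝ≥0∞) * K) (by finiteness) ?_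
  calc ∑' v, truncGreen μ o K v ^ 2 ≤ ∑' v, K * truncGreen μ o K v :=
        ENNReal.tsum_le_tsum fun v => by
          rw [sq]; exact mul_le_mul_left (truncGreen_le μ o K v) _
    _ = _ := by rw [ENNReal.tsum_mul_left, h]

theorem visitProb_add (j n : ℕ) (v : V) :
    visitProb μ o (n + j) v = ∑' g, seqLaw μ {z | path z 1 j = g} * visitProb μ o n (g⁻¹ • v) := by
  unfold visitProb
  have hE : MeasurableSet {z : ℕ → HNN φ | path z 1 (n + j) • o = v} :=
    measurableSet_path 1 (n + j) {g | g • o = v}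
  rw [tsum_measure_path μ (x := 1) (n := j) _ hE]
  refine tsum_congr fun g => ?_
  have := seqLaw_inter_shiftSeq μ (decidedBy_path 1 j {g})
    (measurableSet_path 1 n {g' | g' • o = g⁻¹ • v})
  simp only [Set.mem_singleton_iff, Set.mem_ofPred_eq] at this
  rw [← this]
  congr 1
  ext z
  simp only [Set.mem_inter_iff, Set.mem_ofPred_eq, Set.mem_preimage]
  refine and_congr_right fun h => ?_
  rw [add_comm, path_add, h, path_eq_mul, mul_smul, eq_inv_smul_iff]

theorem truncGreen_le_add (j K : ℕ) (v : V) :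
    truncGreen μ o K v ≤ truncGreen μ o j v +
      ∑' g, seqLaw μ {z | path z 1 j = g} * truncGreen μ o K (g⁻¹ • v) := by
  have : ∑' g, seqLaw μ {z | path z 1 j = g} * truncGreen μ o K (g⁻¹ • v)
      = ∑ n ∈ Finset.range K, visitProb μ o (n + j) v := by
    simp only [truncGreen, visitProb_add, Finset.mul_sum]
    rw [Summable.tsum_finsetSum fun _ _ => ENNReal.summable]
  rw [this]
  calc truncGreen μ o K v ≤ truncGreen μ o (j + K) v := truncGreen_mono μ o (by omega) v
    _ = _ := by
      simp only [truncGreen, Finset.sum_range_add]; simp only [add_comm j]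

/-- The truncated Green function is almost a fixed point of the convolution operators, and by
strict convexity of `ℓ²` this bounds the displacement of every element that the walk can reach. -/
theorem mul_displacement_le [Countable V] (j K : ℕ) (g : HNN φ) :
    seqLaw μ {z | path z 1 j = g} * displacement (truncGreen μ o K) g
      ≤ 2 * ∑' v, truncGreen μ o j v * truncGreen μ o K v := by
  set S := truncGreen μ o K with hS
  set m : HNN φ → ℝ≥0∞ := fun g => seqLaw μ {z | path z 1 j = g} with hm
  have hSf : ∀ v, S v ≠ ∞ := truncGreen_ne_top μ o K
  have hN : ∑' v, S v ^ 2 ≠ ∞ := tsum_truncGreen_sq μ o K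
  have hm1 : ∑' g, m g = 1 := by
    have := tsum_measure_path μ (x := 1) (n := j) Set.univ MeasurableSet.univ
    simpa [hm] using this.symm
  have hid : ∀ g : HNN φ, 2 * ∑' v, S v ^ 2
      = 2 * ∑' v, S (g⁻¹ • v) * S v + displacement S g := by
    intro g
    calc 2 * ∑' v, S v ^ 2 = ∑' v, S (g⁻¹ • v) ^ 2 + ∑' v, S v ^ 2 := by
          rw [tsum_smul (fun v => S v ^ 2) g⁻¹, two_mul]
      _ = ∑' v, (2 * (S (g⁻¹ • v) * S v) + sqDist (S (g⁻¹ • v)) (S v)) := by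
          rw [← ENNReal.tsum_add]
          exact tsum_congr fun v => sq_add_sq_eq (hSf _) (hSf _)
      _ = _ := by rw [ENNReal.tsum_add, ENNReal.tsum_mul_left, displacement]
  have hav : 2 * ∑' v, S v ^ 2 = 2 * (∑' v, (∑' g, m g * S (g⁻¹ • v)) * S v)
      + ∑' g, m g * displacement S g := by
    calc 2 * ∑' v, S v ^ 2 = ∑' g, m g * (2 * ∑' v, S v ^ 2) := by
          rw [ENNReal.tsum_mul_right, hm1, one_mul]
      _ = ∑' g, (2 * ∑' v, m g * S (g⁻¹ • v) * S v + m g * displacement S g) := by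
          refine tsum_congr fun g => ?_
          rw [hid g, mul_add, mul_left_comm, ← ENNReal.tsum_mul_left]
          simp only [mul_assoc]
      _ = _ := by
          rw [ENNReal.tsum_add, ENNReal.tsum_mul_left, ENNReal.tsum_comm]
          simp only [ENNReal.tsum_mul_right]
  have hle : ∑' v, S v ^ 2 ≤ ∑' v, truncGreen μ o j v * S v
      + ∑' v, (∑' g, m g * S (g⁻¹ • v)) * S v := by
    rw [← ENNReal.tsum_add]
    refine ENNReal.tsum_le_tsum fun v => ?_
    rw [← add_mul, sq]
    exact mul_le_mul_left (truncGreen_le_add μ o j K v) _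
  have hfin : 2 * ∑' v, S v ^ 2 ≠ ∞ := ENNReal.mul_ne_top (by simp) hN
  have hkey : 2 * ∑' v, S v ^ 2 + ∑' g, m g * displacement S g
      ≤ 2 * ∑' v, S v ^ 2 + 2 * ∑' v, truncGreen μ o j v * S v := by
    calc 2 * ∑' v, S v ^ 2 + ∑' g, m g * displacement S g
        ≤ 2 * (∑' v, truncGreen μ o j v * S v + ∑' v, (∑' g, m g * S (g⁻¹ • v)) * S v)
          + ∑' g, m g * displacement S g := by gcongr
      _ = (2 * (∑' v, (∑' g, m g * S (g⁻¹ • v)) * S v) + ∑' g, m g * displacement S g)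
          + 2 * ∑' v, truncGreen μ o j v * S v := by ring
      _ = _ := by rw [← hav]
  exact (ENNReal.le_tsum g).trans ((ENNReal.add_le_add_iff_left hfin).mp hkey)

/-- In the presence of a paradoxical decomposition the walk visits every point only finitely
often in the mean. -/
theorem tsum_visitProb_ne_top [Countable V] {C D : Set V} {t x y : HNN φ}
    (hcover : ∀ v, v ∈ C ∨ t⁻¹ • v ∈ D) (hCD : ∀ v ∈ C, v ∉ D)
    (hx : ∀ v, x⁻¹ • v ∈ C → v ∉ C ∧ v ∉ D) (hy : ∀ v, y⁻¹ • v ∈ D → v ∉ C ∧ v ∉ D)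
    (hxy : ∀ v, x⁻¹ • v ∈ C → y⁻¹ • v ∉ D)
    (hreach : ∀ g, ∃ j, 0 < seqLaw μ {z | path z 1 j = g}) (v : V) :
    ∑' n, visitProb μ o n v ≠ ∞ := by
  choose j hj using hreach
  set J := j t + j x + j y with hJ
  set M := 60 * ((seqLaw μ {z | path z 1 (j t) = t})⁻¹ + (seqLaw μ {z | path z 1 (j x) = x})⁻¹ +
    (seqLaw μ {z | path z 1 (j y) = y})⁻¹) with hM
  have hMf : M ≠ ∞ := by
    have h : ∀ g, (seqLaw μ {z | path z 1 (j g) = g})⁻¹ ≠ ∞ := fun g =>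
      ENNReal.inv_ne_top.mpr (hj g).ne'
    exact ENNReal.mul_ne_top (by simp) (ENNReal.add_ne_top.mpr
      ⟨ENNReal.add_ne_top.mpr ⟨h t, h x⟩, h y⟩)
  set R := truncGreen μ o J with hR
  have hRf : ∀ v, R v ≠ ∞ := truncGreen_ne_top μ o J
  set W := ∑' v, (M * R v) ^ 2 with hW
  have hWf : W ≠ ∞ := by
    simp only [hW, mul_pow]
    rw [ENNReal.tsum_mul_left]
    exact ENNReal.mul_ne_top (ENNReal.pow_ne_top hMf) (tsum_truncGreen_sq μ o J)
  have hbound : ∀ K, ∑' v, truncGreen μ o K v ^ 2 ≤ W := by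
    intro K
    set S := truncGreen μ o K with hS
    have hSf : ∀ v, S v ≠ ∞ := truncGreen_ne_top μ o K
    have hN : ∑' v, S v ^ 2 ≠ ∞ := tsum_truncGreen_sq μ o K
    have hdis : ∀ g, j g ≤ J → displacement S g ≤
        (seqLaw μ {z | path z 1 (j g) = g})⁻¹ * (2 * ∑' v, R v * S v) := by
      intro g hg
      rw [mul_comm, ← div_eq_mul_inv, ENNReal.le_div_iff_mul_le (Or.inl (hj g).ne')
        (Or.inl (measure_ne_top _ _)), mul_comm]
      refine (mul_displacement_le μ o (j g) K g).trans ?_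
      gcongr with v
      exact truncGreen_mono μ o hg v
    have h1 : ∑' v, S v ^ 2 + ∑' v, S v ^ 2 ≤ M * (2 * ∑' v, R v * S v) := by
      have h := tsum_sq_le_displacement hSf hN hcover hCD hx hy hxy
      calc ∑' v, S v ^ 2 + ∑' v, S v ^ 2
          ≤ 30 * (displacement S t + displacement S x + displacement S y)
            + 30 * (displacement S t + displacement S x + displacement S y) := add_le_add h h
        _ = 60 * (displacement S t + displacement S x + displacement S y) := by ring
        _ ≤ _ := by
          rw [hM, mul_assoc, add_mul, add_mul]
          gcongr
          · exact hdis t (by omega)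
          · exact hdis x (by omega)
          · exact hdis y (by omega)
    have h2 : M * (2 * ∑' v, R v * S v) ≤ W + ∑' v, S v ^ 2 := by
      rw [hW, ← ENNReal.tsum_add, ← ENNReal.tsum_mul_left, ← ENNReal.tsum_mul_left]
      refine ENNReal.tsum_le_tsum fun v => ?_
      refine le_trans (le_of_eq ?_)
        (two_mul_le_sq_add_sq (ENNReal.mul_ne_top hMf (hRf v)) (hSf v))
      ring
    exact (ENNReal.add_le_add_iff_right hN).mp (h1.trans h2)
  have hpt : ∀ K, truncGreen μ o K v ≤ W + 1 := by
    intro K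
    rcases le_total (truncGreen μ o K v) 1 with h | h
    · exact h.trans le_add_self
    · calc truncGreen μ o K v ≤ truncGreen μ o K v ^ 2 := by
            rw [sq]; exact le_mul_of_one_le_left zero_le h
        _ ≤ ∑' v, truncGreen μ o K v ^ 2 := ENNReal.le_tsum v
        _ ≤ W := hbound K
        _ ≤ W + 1 := le_self_add
  refine ne_top_of_le_ne_top (b := W + 1) (by finiteness) ?_
  rw [ENNReal.tsum_eq_iSup_nat]
  exact iSup_le hpt

end

end HNNWalk

/-! ### The steps of the walk -/

namespace HNNWalk

open scoped ENNReal

variable {G₀ : Type*} [Group G₀] {A B : Subgroup G₀} {X Y : Set G₀}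

section

variable (φ : A ≃* B) (μ₀ : PMF G₀) {α p : ℝ}

theorem isProbabilityMeasure_stepLaw (hα : α ∈ Set.Ioo (0 : ℝ) 1) (hp : p ∈ Set.Ioo (0 : ℝ) 1) :
    IsProbabilityMeasure (stepLaw φ μ₀ α p) := by
  constructor
  simp only [stepLaw, Measure.add_apply, Measure.smul_apply, measure_univ, smul_eq_mul, mul_one]
  rw [← ENNReal.ofReal_add hp.1.le (by linarith [hp.2]), ← ENNReal.ofReal_mul (by linarith [hα.2]),
    ← ENNReal.ofReal_add hα.1.le (by nlinarith [hα.2])]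
  simp

theorem ae_mem_stepSet : ∀ᵐ s ∂stepLaw φ μ₀ α p, s ∈ stepSet φ := by
  rw [ae_iff]
  have h1 : (μ₀.map (HNNExtension.of : G₀ →* HNN φ)).toMeasure {s | s ∉ stepSet φ} = 0 := by
    rw [PMF.toMeasure_apply_eq_zero_iff _ (MeasurableSet.of_discrete), Set.disjoint_left]
    intro s hs hs'
    rw [PMF.mem_support_map_iff] at hs
    obtain ⟨x, -, rfl⟩ := hs
    exact hs' (Or.inl ⟨x, rfl⟩)
  have h2 : (HNNExtension.t : HNN φ) ∈ stepSet φ := Or.inr ⟨1, (tPow_one φ).symm⟩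
  have h3 : (HNNExtension.t : HNN φ)⁻¹ ∈ stepSet φ := Or.inr ⟨-1, (tPow_neg_one φ).symm⟩
  simp [stepLaw, h1, h2, h3]

theorem stepLaw_of_pos (hα : α ∈ Set.Ioo (0 : ℝ) 1) {x : G₀} (hx : x ∈ μ₀.support) :
    0 < stepLaw φ μ₀ α p {HNNExtension.of x} := by
  refine lt_of_lt_of_le ?_ (Measure.le_add_right le_rfl _)
  rw [Measure.smul_apply, smul_eq_mul, pos_iff_ne_zero, mul_ne_zero_iff]
  refine ⟨by simpa using hα.1, ?_⟩
  rw [Ne, PMF.toMeasure_apply_eq_zero_iff _ (MeasurableSet.of_discrete), Set.not_disjoint_iff]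
  exact ⟨_, (PMF.mem_support_map_iff _ _ _).mpr ⟨x, hx, rfl⟩, rfl⟩

theorem stepLaw_tPow_pos (hα : α ∈ Set.Ioo (0 : ℝ) 1) (hp : p ∈ Set.Ioo (0 : ℝ) 1) (ε : ℤˣ) :
    0 < stepLaw φ μ₀ α p {tPow φ ε} := by
  refine lt_of_lt_of_le ?_ (Measure.le_add_left le_rfl _)
  rw [Measure.smul_apply, smul_eq_mul, pos_iff_ne_zero, mul_ne_zero_iff]
  refine ⟨by simpa using hα.2, ?_⟩
  have h1 : ENNReal.ofReal p ≠ 0 := by simpa using hp.1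
  have h2 : ENNReal.ofReal (1 - p) ≠ 0 := by simpa using hp.2
  rcases Int.units_eq_one_or ε with rfl | rfl
  · simp [tPow_one, h1]
  · simp [tPow_neg_one, h2]

end

section

variable {φ : A ≃* B}

theorem path_eq_take_prod {z : ℕ → HNN φ} {ls : List (HNN φ)}
    (h : ∀ i < ls.length, z i = ls.getD i 1) (x : HNN φ) {n : ℕ} (hn : n ≤ ls.length) :
    path z x n = x * (ls.take n).prod := by
  induction n with
  | zero => simp [path_zero]
  | succ n ih =>
    rw [path_succ, ih (by omega), h n (by omega), List.getD_eq_getElem _ _ hn,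
      List.prod_take_succ _ _ hn,
      mul_assoc]

/-- A finite sequence of possible steps has positive probability. -/
theorem seqLaw_list_pos (μ : Measure (HNN φ)) [IsProbabilityMeasure μ] [Countable (HNN φ)]
    (ls : List (HNN φ)) (h : ∀ s ∈ ls, 0 < μ {s}) :
    0 < seqLaw μ {z | ∀ i < ls.length, z i = ls.getD i 1} := by
  refine seqLaw_cylinder_pos μ _ _ fun i hi => ?_
  rw [List.getD_eq_getElem _ _ hi]
  exact h _ (List.getElem_mem hi)

theorem ae_forall_mem_stepSet {μ : Measure (HNN φ)} [IsProbabilityMeasure μ]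
    (h : ∀ᵐ s ∂μ, s ∈ stepSet φ) : ∀ᵐ z ∂seqLaw μ, ∀ i, z i ∈ stepSet φ := by
  rw [ae_all_iff]
  intro i
  rw [ae_iff]
  exact (seqLaw_eval μ i (s := {s | s ∉ stepSet φ}) MeasurableSet.of_discrete).trans (ae_iff.mp h)

/-- The walk can reach every element of the group. -/
theorem Transversals.exists_path_pos (hT : Transversals A B X Y) [Countable (HNN φ)]
    {μ₀ : PMF G₀} (hgen : Subsemigroup.closure μ₀.support = ⊤) (μ : Measure (HNN φ))
    [IsProbabilityMeasure μ] (hof : ∀ x ∈ μ₀.support, 0 < μ {HNNExtension.of x})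
    (ht : ∀ ε, 0 < μ {tPow φ ε}) (g : HNN φ) :
    ∃ j, 0 < seqLaw μ {z | path z 1 j = g} := by
  have hG : ∀ x : G₀, ∃ ls : List (HNN φ), (∀ s ∈ ls, 0 < μ {s}) ∧
      ls.prod = HNNExtension.of x := by
    intro x
    obtain ⟨l, hl, rfl⟩ := exists_list_of_generation hgen x
    refine ⟨l.map HNNExtension.of, ?_, (map_list_prod _ _).symm⟩
    intro s hs
    obtain ⟨y, hy, rfl⟩ := List.mem_map.mp hs
    exact hof y (hl y hy)
  have hW : ∀ l : List (G₀ × ℤˣ), ∃ ls : List (HNN φ), (∀ s ∈ ls, 0 < μ {s}) ∧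
      ls.prod = word φ l := by
    intro l
    induction l with
    | nil => exact ⟨[], by simp, by simp [word]⟩
    | cons a l ih =>
      obtain ⟨l1, h1, h1'⟩ := hG a.1
      obtain ⟨l2, h2, h2'⟩ := ih
      refine ⟨l1 ++ (tPow φ a.2 :: l2), ?_, by simp [h1', h2', word, mul_assoc]⟩
      intro s hs
      rcases List.mem_append.mp hs with hs | hs
      · exact h1 s hs
      · rcases List.mem_cons.mp hs with rfl | hs
        · exact ht _
        · exact h2 s hs
  obtain ⟨l, h, -, rfl⟩ := hT.exists_word φ g
  obtain ⟨l1, h1, h1'⟩ := hW l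
  obtain ⟨l2, h2, h2'⟩ := hG h
  refine ⟨(l1 ++ l2).length, (seqLaw_list_pos μ (l1 ++ l2) ?_).trans_le (measure_mono ?_)⟩
  · intro s hs
    rcases List.mem_append.mp hs with hs | hs
    · exact h1 s hs
    · exact h2 s hs
  · intro z hz
    rw [Set.mem_ofPred_eq, path_eq_take_prod hz 1 le_rfl, List.take_length, List.prod_append,
      h1', h2', one_mul]

/-! ### Transience if `A` and `B` are proper subgroups -/

/-- The cosets of `G₀` whose normal form begins with `1 t^ε`. -/
def startSet (φ : A ≃* B) (X Y : Set G₀) (ε : ℤˣ) :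
    Set (HNN φ ⧸ (HNNExtension.of : G₀ →* HNN φ).range) :=
  {v | ∃ l, nfWord φ X Y v.out = (1, ε) :: l}

/-- The word of the normal form depends on the coset only. -/
theorem Transversals.nfWord_out (hT : Transversals A B X Y) (g : HNN φ) :
    nfWord φ X Y (g : HNN φ ⧸ (HNNExtension.of : G₀ →* HNN φ).range).out = nfWord φ X Y g := by
  obtain ⟨⟨_, x, rfl⟩, h⟩ := QuotientGroup.mk_out_eq_mul (HNNExtension.of : G₀ →* HNN φ).range g
  rw [h]
  exact (hT.nf_mul_of φ g x).1

theorem Transversals.mk_mem_startSet (hT : Transversals A B X Y) {g : HNN φ} {ε : ℤˣ} :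
    (g : HNN φ ⧸ (HNNExtension.of : G₀ →* HNN φ).range) ∈ startSet φ X Y ε ↔
      ∃ l, nfWord φ X Y g = (1, ε) :: l := by
  rw [startSet, Set.mem_ofPred_eq, hT.nfWord_out]

theorem Transversals.nf_of_mul (hT : Transversals A B X Y) {g : HNN φ} {ε : ℤˣ} {r : G₀}
    (hr : r ∈ reps X Y ε) {l : List (G₀ × ℤˣ)}
    (hg : nfWord φ X Y ((HNNExtension.of r)⁻¹ * g) = (1, ε) :: l) :
    nfWord φ X Y g = (r, ε) :: l := by
  have := hT.nf_base_mul (l₀ := []) (isNormal_singleton_iff.mpr hr) hg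
  simpa [word] using this

theorem Transversals.exists_rep_ne_one (hT : Transversals A B X Y) {ε : ℤˣ}
    (h : tailGroup A B (-ε) ≠ ⊤) : ∃ r ∈ reps X Y ε, r ≠ 1 := by
  by_contra hc
  push Not at hc
  refine h (eq_top_iff.mpr fun g _ => ?_)
  obtain ⟨r, hr, a, ha, rfl⟩ := hT.exists_rep ε g
  rw [hc r hr, one_mul]
  exact ha

/-- The cosets that begin with `1 t` and with `1 t⁻¹` form a paradoxical decomposition with the
translations by `t` and by nontrivial representatives `x` and `y`. -/
theorem Transversals.tsum_visit_ne_top (hT : Transversals A B X Y) [Countable (HNN φ)]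
    (hA : A ≠ ⊤) (hB : B ≠ ⊤) (μ : Measure (HNN φ)) [IsProbabilityMeasure μ]
    (hreach : ∀ g, ∃ j, 0 < seqLaw μ {z | path z 1 j = g})
    (v : HNN φ ⧸ (HNNExtension.of : G₀ →* HNN φ).range) :
    ∑' n, visitProb μ ((1 : HNN φ) : HNN φ ⧸ (HNNExtension.of : G₀ →* HNN φ).range) n v ≠ ∞ := by
  obtain ⟨x, hx, hx1⟩ := hT.exists_rep_ne_one (ε := 1) (by simpa [tailGroup_neg_one] using hA)
  obtain ⟨y, hy, hy1⟩ := hT.exists_rep_ne_one (ε := -1) (by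
    rw [neg_neg, tailGroup_one]; exact hB)
  have : Countable (HNN φ ⧸ (HNNExtension.of : G₀ →* HNN φ).range) :=
    Function.Surjective.countable QuotientGroup.mk_surjective
  refine tsum_visitProb_ne_top μ _ (C := startSet φ X Y 1) (D := startSet φ X Y (-1))
    (t := tPow φ 1) (x := HNNExtension.of x) (y := HNNExtension.of y) ?_ ?_ ?_ ?_ ?_ hreach v
  · intro v
    obtain ⟨g, rfl⟩ := QuotientGroup.mk_surjective v
    rw [or_iff_not_imp_left, MulAction.Quotient.smul_mk, smul_eq_mul, hT.mk_mem_startSet,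
      hT.mk_mem_startSet]
    intro hg
    obtain ⟨h1, h2⟩ := hT.nfWord_spec φ g
    have hn : IsNormal X Y ((1, -1) :: nfWord φ X Y g) := by
      refine (isNormal_cons_one_iff hT).mpr ⟨h1, fun h => ?_⟩
      rw [neg_neg] at h
      obtain ⟨l, hl⟩ := List.head?_eq_some_iff.mp h
      exact hg ⟨l, hl⟩
    refine ⟨_, (hT.nf_eq φ (h := nfTail φ X Y g) hn ?_).1⟩
    conv_rhs => rw [← h2]
    rw [← tPow_neg, show ((1 : G₀), (-1 : ℤˣ)) :: nfWord φ X Y g = [(1, -1)] ++ nfWord φ X Y g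
      from rfl, word_append, word_singleton]
    simp [mul_assoc]
  · rintro v ⟨l, hl⟩ ⟨l', hl'⟩
    rw [hl] at hl'
    simp at hl'
  · intro v hv
    obtain ⟨g, rfl⟩ := QuotientGroup.mk_surjective v
    rw [MulAction.Quotient.smul_mk, smul_eq_mul, hT.mk_mem_startSet] at hv
    obtain ⟨l, hl⟩ := hv
    have h := hT.nf_of_mul hx hl
    rw [hT.mk_mem_startSet, hT.mk_mem_startSet, h]
    simp [hx1]
  · intro v hv
    obtain ⟨g, rfl⟩ := QuotientGroup.mk_surjective v
    rw [MulAction.Quotient.smul_mk, smul_eq_mul, hT.mk_mem_startSet] at hv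
    obtain ⟨l, hl⟩ := hv
    have h := hT.nf_of_mul hy hl
    rw [hT.mk_mem_startSet, hT.mk_mem_startSet, h]
    simp [hy1]
  · intro v hv hv'
    obtain ⟨g, rfl⟩ := QuotientGroup.mk_surjective v
    rw [MulAction.Quotient.smul_mk, smul_eq_mul, hT.mk_mem_startSet] at hv hv'
    obtain ⟨l, hl⟩ := hv
    obtain ⟨l', hl'⟩ := hv'
    have := (hT.nf_of_mul hx hl).symm.trans (hT.nf_of_mul hy hl')
    simp at this

/-- A path that visits every coset of `G₀` only finitely often leaves every ball: a path that
does not become shorter than `k` returns to length `k` only in one vertex. -/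
theorem Transversals.exists_stays_of_finite_visits (hT : Transversals A B X Y) {z : ℕ → HNN φ}
    (hz : ∀ i, z i ∈ stepSet φ)
    (hv : ∀ v : HNN φ ⧸ (HNNExtension.of : G₀ →* HNN φ).range,
      ∀ᶠ n in Filter.atTop, (path z 1 n : HNN φ ⧸ (HNNExtension.of : G₀ →* HNN φ).range) ≠ v)
    (k : ℕ) : ∃ m, Stays X Y k m z := by
  induction k with
  | zero => exact ⟨0, fun _ _ => Nat.zero_le _⟩
  | succ k ih =>
    obtain ⟨m, hm⟩ := ih
    by_cases hex : ∃ n₀, m ≤ n₀ ∧ tLength φ X Y (path z 1 n₀) = k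
    · obtain ⟨n₀, hmn, hn₀⟩ := hex
      obtain ⟨N, hN⟩ := Filter.eventually_atTop.mp
        (hv (path z 1 n₀ : HNN φ ⧸ (HNNExtension.of : G₀ →* HNN φ).range))
      refine ⟨max n₀ N, fun n hn => ?_⟩
      by_contra hlt
      have hk : tLength φ X Y (path z 1 n) = k := by
        have := hm n (by omega)
        omega
      have hpre := hT.prefix_path hz (x := 1) (l := nfWord φ X Y (path z 1 n₀)) (N := n₀) (M := n)
        List.prefix_rfl (fun i hi _ => by rw [← hT.tLength_eq, hn₀]; exact hm i (by omega))
        n (by omega) le_rfl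
      have heq := hpre.eq_of_length (by rw [← hT.tLength_eq, ← hT.tLength_eq, hk, hn₀])
      refine hN n (by omega) ?_
      rw [QuotientGroup.eq]
      obtain ⟨-, h1⟩ := hT.nfWord_spec φ (path z 1 n)
      obtain ⟨-, h2⟩ := hT.nfWord_spec φ (path z 1 n₀)
      rw [← heq] at h1
      refine ⟨(nfTail φ X Y (path z 1 n))⁻¹ * nfTail φ X Y (path z 1 n₀), ?_⟩
      rw [map_mul, map_inv, eq_inv_mul_iff_mul_eq.mpr h1, eq_inv_mul_iff_mul_eq.mpr h2]
      simp [mul_assoc]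
    · push Not at hex
      exact ⟨m, fun n hn => by have h1 := hm n hn; have h2 := hex n hn; omega⟩

end

end HNNWalk

/-! ### Transience if `A = B = G₀` -/

namespace HNNWalk

open scoped ENNReal
open Filter Topology

variable {G₀ : Type*} [Group G₀] {A B : Subgroup G₀} {X Y : Set G₀}

/-- The homomorphism that counts the letters `t` with signs. -/
def tExponent (φ : A ≃* B) : HNN φ →* Multiplicative ℤ :=
  HNNExtension.lift 1 (Multiplicative.ofAdd 1) (by simp)

/-- The exponent sum of `t` as a real number. -/
def tHeight (φ : A ≃* B) (g : HNN φ) : ℝ := ((Multiplicative.toAdd (tExponent φ g) : ℤ) : ℝ)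

section

variable (φ : A ≃* B)

theorem tHeight_mul (g h : HNN φ) : tHeight φ (g * h) = tHeight φ g + tHeight φ h := by
  simp [tHeight]

theorem tHeight_of (x : G₀) : tHeight φ (HNNExtension.of x) = 0 := by
  simp [tHeight, tExponent]

theorem tHeight_t : tHeight φ HNNExtension.t = 1 := by
  simp [tHeight, tExponent]

theorem tHeight_inv (g : HNN φ) : tHeight φ g⁻¹ = -tHeight φ g := by
  simp [tHeight]

theorem tHeight_one : tHeight φ 1 = 0 := by simp [tHeight]

theorem tHeight_tPow (ε : ℤˣ) : tHeight φ (tPow φ ε) = ((ε : ℤ) : ℝ) := by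
  rcases Int.units_eq_one_or ε with rfl | rfl
  · simp [tPow_one, tHeight_t]
  · simp [tPow_neg_one, tHeight_inv, tHeight_t]

theorem tHeight_path (z : ℕ → HNN φ) (x : HNN φ) (n : ℕ) :
    tHeight φ (path z x n) = tHeight φ x + ∑ i ∈ Finset.range n, tHeight φ (z i) := by
  induction n with
  | zero => simp [path_zero]
  | succ n ih => rw [path_succ, tHeight_mul, ih, Finset.sum_range_succ, add_assoc]

theorem tHeight_word (l : List (G₀ × ℤˣ)) :
    tHeight φ (word φ l) = (l.map fun x => ((x.2 : ℤ) : ℝ)).sum := by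
  induction l with
  | nil => simp [word, tHeight_one]
  | cons a l ih =>
    rw [show a :: l = [a] ++ l from rfl, word_append, tHeight_mul, ih,
      show [a] = [(a.1, a.2)] from rfl, word_singleton, tHeight_mul, tHeight_of, tHeight_tPow]
    simp

variable (hT : Transversals A B X Y)
include hT

theorem Transversals.tHeight_eq (g : HNN φ) :
    tHeight φ g = ((nfWord φ X Y g).map fun x => ((x.2 : ℤ) : ℝ)).sum := by
  conv_lhs => rw [← (hT.nfWord_spec φ g).2]
  rw [tHeight_mul, tHeight_of, add_zero, tHeight_word]

theorem Transversals.abs_tHeight_le (g : HNN φ) : |tHeight φ g| ≤ tLength φ X Y g := by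
  rw [hT.tHeight_eq, hT.tLength_eq]
  generalize nfWord φ X Y g = l
  induction l with
  | nil => simp
  | cons a l ih =>
    rw [List.map_cons, List.sum_cons, List.length_cons]
    refine (abs_add_le _ _).trans ?_
    have : |((a.2 : ℤ) : ℝ)| = 1 := by
      rcases Int.units_eq_one_or a.2 with h | h <;> simp [h]
    push_cast
    linarith

end

omit [Group G₀] in
theorem sum_sign_of_isChain (a : G₀ × ℤˣ) (l : List (G₀ × ℤˣ))
    (h : List.IsChain (fun x y : G₀ × ℤˣ => x.2 = y.2) (a :: l)) :
    ((a :: l).map fun x => ((x.2 : ℤ) : ℝ)).sum = (a.2 : ℤ) * ((l.length : ℝ) + 1) := by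
  induction l generalizing a with
  | nil => simp
  | cons b l ih =>
    obtain ⟨h1, h2⟩ := List.isChain_cons_cons.mp h
    rw [List.map_cons, List.sum_cons, ih b h2, h1]
    push_cast [List.length_cons]
    ring

section

variable (φ : A ≃* B) (μ₀ : PMF G₀) {α p : ℝ}

theorem norm_tHeight_le {s : HNN φ} (hs : s ∈ stepSet φ) : ‖tHeight φ s‖ ≤ 1 := by
  rcases hs with ⟨x, rfl⟩ | ⟨ε, rfl⟩
  · simp [tHeight_of]
  · rw [tHeight_tPow]
    rcases Int.units_eq_one_or ε with rfl | rfl <;> simp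

theorem integrable_tHeight (hα : α ∈ Set.Ioo (0 : ℝ) 1) (hp : p ∈ Set.Ioo (0 : ℝ) 1)
    [Countable (HNN φ)] : Integrable (tHeight φ) (stepLaw φ μ₀ α p) := by
  have := isProbabilityMeasure_stepLaw φ μ₀ hα hp
  refine Integrable.of_bound (C := 1) (Measurable.of_discrete).aestronglyMeasurable ?_
  filter_upwards [ae_mem_stepSet φ μ₀] with s hs
  exact norm_tHeight_le φ hs

theorem integral_tHeight (hα : α ∈ Set.Ioo (0 : ℝ) 1) (hp : p ∈ Set.Ioo (0 : ℝ) 1)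
    [Countable (HNN φ)] : ∫ s, tHeight φ s ∂stepLaw φ μ₀ α p = (1 - α) * (2 * p - 1) := by
  have hint := integrable_tHeight φ μ₀ hα hp
  rw [stepLaw] at hint ⊢
  rw [integrable_add_measure] at hint
  have h2 := hint.2
  rw [integrable_smul_measure (by simpa using hα.2) (by simp), integrable_add_measure] at h2
  rw [integral_add_measure hint.1 hint.2, integral_smul_measure, integral_smul_measure,
    integral_add_measure h2.1 h2.2, integral_smul_measure, integral_smul_measure,
    integral_dirac, integral_dirac]
  have h0 : ∫ s, tHeight φ s ∂(μ₀.map (HNNExtension.of : G₀ →* HNN φ)).toMeasure = 0 := by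
    refine integral_eq_zero_of_ae ?_
    rw [Filter.EventuallyEq, ae_iff,
      PMF.toMeasure_apply_eq_zero_iff _ (MeasurableSet.of_discrete), Set.disjoint_left]
    intro s hs hs'
    obtain ⟨x, -, rfl⟩ := (PMF.mem_support_map_iff _ _ _).mp hs
    exact hs' (tHeight_of φ x)
  rw [h0, tHeight_t, tHeight_inv, tHeight_t, ENNReal.toReal_ofReal hα.1.le,
    ENNReal.toReal_ofReal (by linarith [hα.2]), ENNReal.toReal_ofReal hp.1.le,
    ENNReal.toReal_ofReal (by linarith [hp.2])]
  simp only [smul_eq_mul]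
  ring

/-- The strong law of large numbers for the exponent sum of `t` along the walk. -/
theorem ae_tendsto_tHeight (hα : α ∈ Set.Ioo (0 : ℝ) 1) (hp : p ∈ Set.Ioo (0 : ℝ) 1)
    [Countable (HNN φ)] : ∀ᵐ z ∂seqLaw (stepLaw φ μ₀ α p), Tendsto
      (fun n : ℕ => (∑ i ∈ Finset.range n, tHeight φ (z i)) / n) atTop
      (𝓝 ((1 - α) * (2 * p - 1))) := by
  have := isProbabilityMeasure_stepLaw φ μ₀ hα hp
  have hmp := measurePreserving_eval_infinitePi (fun _ : ℕ => stepLaw φ μ₀ α p)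
  have hm : Measurable (tHeight φ) := Measurable.of_discrete
  have hind : ProbabilityTheory.iIndepFun (fun (i : ℕ) (z : ℕ → HNN φ) => tHeight φ (z i))
      (seqLaw (stepLaw φ μ₀ α p)) :=
    ProbabilityTheory.iIndepFun_infinitePi (P := fun _ : ℕ => stepLaw φ μ₀ α p)
      (X := fun _ => tHeight φ) fun _ => hm
  have h := ProbabilityTheory.strong_law_ae_real
    (fun (i : ℕ) (z : ℕ → HNN φ) => tHeight φ (z i)) (μ := seqLaw (stepLaw φ μ₀ α p))
    ((hmp 0).integrable_comp_of_integrable (integrable_tHeight φ μ₀ hα hp))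
    (fun i j hij => hind.indepFun hij)
    (fun i => ⟨(hm.comp (measurable_pi_apply i)).aemeasurable,
      (hm.comp (measurable_pi_apply 0)).aemeasurable, by
        rw [show (fun z : ℕ → HNN φ => tHeight φ (z i)) = tHeight φ ∘ Function.eval i from rfl,
          show (fun z : ℕ → HNN φ => tHeight φ (z 0)) = tHeight φ ∘ Function.eval 0 from rfl,
          ← Measure.map_map hm (hmp i).measurable, ← Measure.map_map hm (hmp 0).measurable]
        exact congrArg (Measure.map (tHeight φ)) ((hmp i).map_eq.trans (hmp 0).map_eq.symm)⟩)
  have hE : ∫ z : ℕ → HNN φ, tHeight φ (z 0) ∂seqLaw (stepLaw φ μ₀ α p)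
      = (1 - α) * (2 * p - 1) := by
    rw [← integral_tHeight φ μ₀ hα hp]
    conv_rhs => rw [← (hmp 0).map_eq,
      integral_map (hmp 0).measurable.aemeasurable hm.aestronglyMeasurable]
    rfl
  rwa [hE] at h

/-- If the steps are biased, then the exponent sum of `t` along the walk tends to `∞` in the
direction of the bias. -/
theorem exists_sign_ae_tendsto_tHeight (hα : α ∈ Set.Ioo (0 : ℝ) 1) (hp : p ∈ Set.Ioo (0 : ℝ) 1)
    (hp2 : p ≠ 1 / 2) [Countable (HNN φ)] :
    ∃ ε : ℤˣ, ∀ᵐ z ∂seqLaw (stepLaw φ μ₀ α p), ∀ x : HNN φ,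
      Tendsto (fun n : ℕ => ((ε : ℤ) : ℝ) * tHeight φ (path z x n)) atTop atTop := by
  have key : ∀ ε : ℤˣ, 0 < ((ε : ℤ) : ℝ) * ((1 - α) * (2 * p - 1)) →
      ∀ᵐ z ∂seqLaw (stepLaw φ μ₀ α p), ∀ x : HNN φ,
      Tendsto (fun n : ℕ => ((ε : ℤ) : ℝ) * tHeight φ (path z x n)) atTop atTop := by
    intro ε hε
    filter_upwards [ae_tendsto_tHeight φ μ₀ hα hp] with z hz x
    have h1 : Tendsto (fun n : ℕ => (n : ℝ) *
        (((ε : ℤ) : ℝ) * ((∑ i ∈ Finset.range n, tHeight φ (z i)) / n))) atTop atTop :=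
      tendsto_natCast_atTop_atTop.atTop_mul_pos hε (hz.const_mul _)
    have h2 := tendsto_atTop_add_const_left atTop (((ε : ℤ) : ℝ) * tHeight φ x) h1
    refine h2.congr' ?_
    filter_upwards [eventually_gt_atTop 0] with n hn
    have : (n : ℝ) ≠ 0 := by positivity
    rw [tHeight_path]
    field_simp
  rcases lt_or_gt_of_ne hp2 with h | h
  · exact ⟨-1, key (-1) (by simp; nlinarith [hα.2])⟩
  · exact ⟨1, key 1 (by simp; exact mul_pos (by linarith [hα.2]) (by linarith))⟩

variable (hT : Transversals A B X Y)
include hT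

/-- The walk is transient: its `t`-length tends to infinity. -/
theorem Transversals.ae_exists_stays (hgen : Subsemigroup.closure μ₀.support = ⊤)
    (hα : α ∈ Set.Ioo (0 : ℝ) 1) (hp : p ∈ Set.Ioo (0 : ℝ) 1) [Countable (HNN φ)]
    (hAB : (A ≠ ⊤ ∧ B ≠ ⊤) ∨ p ≠ 1 / 2) :
    ∀ᵐ z ∂seqLaw (stepLaw φ μ₀ α p), ∀ k, ∃ m, Stays X Y k m z := by
  have := isProbabilityMeasure_stepLaw φ μ₀ hα hp
  rcases hAB with ⟨hA, hB⟩ | hp2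
  · have hreach := hT.exists_path_pos hgen (stepLaw φ μ₀ α p)
      (fun x hx => stepLaw_of_pos φ μ₀ hα hx) (stepLaw_tPow_pos φ μ₀ hα hp)
    have : Countable (HNN φ ⧸ (HNNExtension.of : G₀ →* HNN φ).range) :=
      Function.Surjective.countable QuotientGroup.mk_surjective
    have hbc := ae_all_iff.mpr fun v => ae_eventually_notMem
      (hT.tsum_visit_ne_top hA hB (stepLaw φ μ₀ α p) hreach v)
    filter_upwards [hbc, ae_forall_mem_stepSet (ae_mem_stepSet φ μ₀)] with z hz hsteps
    refine hT.exists_stays_of_finite_visits hsteps fun v => ?_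
    filter_upwards [hz v] with n hn hv
    refine hn ?_
    rw [MulAction.Quotient.smul_mk, smul_eq_mul, mul_one, hv]
  · obtain ⟨ε, hε⟩ := exists_sign_ae_tendsto_tHeight φ μ₀ hα hp hp2
    filter_upwards [hε] with z hz k
    obtain ⟨m, hm⟩ := eventually_atTop.mp ((hz 1).eventually_ge_atTop (k : ℝ))
    refine ⟨m, fun n hn => ?_⟩
    have h1 := hm n hn
    have h2 := hT.abs_tHeight_le φ (path z 1 n)
    have h3 : ((ε : ℤ) : ℝ) * tHeight φ (path z 1 n) ≤ |tHeight φ (path z 1 n)| := by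
      rcases Int.units_eq_one_or ε with rfl | rfl
      · simpa using le_abs_self _
      · simpa using neg_le_abs _
    exact_mod_cast h1.trans (h3.trans h2)

/-- If `A = B = G₀`, then the walk can escape in one direction only. -/
theorem Transversals.exists_sign_of_escape (hα : α ∈ Set.Ioo (0 : ℝ) 1)
    (hp : p ∈ Set.Ioo (0 : ℝ) 1) (hp2 : p ≠ 1 / 2) [Countable (HNN φ)] (hA : A = ⊤) (hB : B = ⊤) :
    ∃ ε₀ : ℤˣ, ∀ ε h, 0 < seqLaw (stepLaw φ μ₀ α p) (escapeEvent φ ε h) → ε = ε₀ := by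
  have := isProbabilityMeasure_stepLaw φ μ₀ hα hp
  obtain ⟨ε₀, hε₀⟩ := exists_sign_ae_tendsto_tHeight φ μ₀ hα hp hp2
  refine ⟨ε₀, fun ε h hpos => ?_⟩
  have hone : ∀ (δ : ℤˣ) (r : G₀), r ∈ reps X Y δ → r = 1 := by
    intro δ r hr
    refine hT.eq_one_of_mem hr ?_
    have : tailGroup A B (-δ) = ⊤ := by
      unfold tailGroup; split_ifs <;> assumption
    rw [this]; trivial
  obtain ⟨z, hz, hz1, hz2⟩ := ((frequently_ae_mem_iff.mpr hpos.ne').and_eventually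
    (hε₀.and (ae_forall_mem_stepSet (ae_mem_stepSet φ μ₀)))).exists
  by_contra hne
  obtain rfl := units_eq_neg_of_ne hne
  obtain ⟨n, hn⟩ := ((hz1 (tailVal φ (-ε₀) h)).eventually_ge_atTop 1).exists
  rw [hT.mem_escapeEvent_iff] at hz
  obtain ⟨l, hl⟩ := hT.prefix_path hz2 (x := tailVal φ (-ε₀) h) (l := [(1, -ε₀)]) (N := 0) (M := n)
    (by rw [path_zero, (hT.nf_tailVal _ h).1]) (fun i _ _ => hz i) n (Nat.zero_le _) le_rfl
  have hnorm := (hT.nfWord_spec φ (path z (tailVal φ (-ε₀) h) n)).1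
  rw [List.singleton_append] at hl
  rw [← hl] at hnorm
  have hchain : List.IsChain (fun x y : G₀ × ℤˣ => x.2 = y.2) ((1, -ε₀) :: l) :=
    List.IsChain.imp_of_mem_imp (fun a b _ hb hab => hab (hone _ _ (hnorm.1 b hb))) hnorm.2
  rw [hT.tHeight_eq, ← hl, sum_sign_of_isChain _ _ hchain] at hn
  have : ((ε₀ : ℤ) : ℝ) * ((-ε₀ : ℤˣ) : ℤ) = -1 := by
    rcases Int.units_eq_one_or ε₀ with rfl | rfl <;> simp
  rw [← mul_assoc, this] at hn
  have : (0 : ℝ) ≤ (l.length : ℝ) + 1 := by positivity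
  linarith

end

end HNNWalk

/-! ### The Markov property at exit times -/

namespace HNNWalk

open scoped ENNReal

variable {G₀ : Type*} [Group G₀] {A B : Subgroup G₀} {X Y : Set G₀}

theorem measure_eq_tsum_fiber {Ω ι : Type*} [MeasurableSpace Ω] (P : Measure Ω) [Countable ι]
    {f : Ω → ι} (hf : ∀ i, MeasurableSet (f ⁻¹' {i})) (F : Set Ω) :
    P F = ∑' i, P (F ∩ f ⁻¹' {i}) := by
  have h : P.restrict F (⋃ i, f ⁻¹' {i}) = ∑' i, P.restrict F (f ⁻¹' {i}) :=
    measure_iUnion (fun i j hij => Set.disjoint_left.mpr fun z hz hz' => hij (hz.symm.trans hz')) hf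
  have h2 : (⋃ i, f ⁻¹' {i}) = Set.univ := by ext; simp
  rw [h2, Measure.restrict_apply_univ] at h
  rw [h]
  exact tsum_congr fun i => by rw [Measure.restrict_apply (hf i), Set.inter_comm]

section

variable {φ : A ≃* B}

/-- If two paths agree before time `N` and both have `t`-length at least `k` from then on, then
they have the same exit times up to the `k`-th. -/
theorem exitTime_congr {k N j : ℕ} (hj : j ≤ k) {z z' : ℕ → HNN φ}
    (hzz' : ∀ i < N, z i = z' i) (hz : Stays X Y k N z) (hz' : Stays X Y k N z') :
    exitTime X Y (coord φ) j z = exitTime X Y (coord φ) j z' := by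
  have : ∀ m, (∀ n, m ≤ n → j ≤ tLength φ X Y (walk (coord φ) 1 n z)) ↔
      ∀ n, m ≤ n → j ≤ tLength φ X Y (walk (coord φ) 1 n z') := by
    intro m
    refine forall_congr' fun n => forall_congr' fun _ => ?_
    rcases le_or_gt N n with hn | hn
    · have h1 := hz n hn
      have h2 := hz' n hn
      exact iff_of_true (hj.trans h1) (hj.trans h2)
    · have := path_congr (n := n) (fun i hi => hzz' i (by omega)) (1 : HNN φ)
      rw [path, path] at this
      rw [this]
  simp only [exitTime, this]

theorem xi_coord (L : Measure (ℕ → HNN φ)) (ε : ℤˣ) (h : G₀) :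
    xi L (coord φ) ε h = L (escapeEvent φ ε h) := rfl

variable (hT : Transversals A B X Y)
include hT

theorem Transversals.tPow_mul_ne_one_iff {ε : ℤˣ} {b : Block G₀} (hb : b ∈ blocks A B X Y) :
    tPow φ ε * HNNExtension.of b.rep * tPow φ b.sign ≠ 1 ↔ (b.rep = 1 → ε = b.sign) := by
  constructor
  · intro h h1
    by_contra hne
    refine h ?_
    rw [h1, map_one, mul_one, units_eq_neg_of_ne hne, tPow_neg_mul]
  · intro h h1
    have hn : IsNormal X Y ([] ++ [(1, ε)] ++ [(b.rep, b.sign)]) :=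
      isNormal_concat_iff.mpr ⟨isNormal_singleton_iff.mpr (hT.one_mem ε), hb.1, h⟩
    have := hT.tLength_word φ hn 1
    have hw : word φ ([] ++ [(1, ε)] ++ [(b.rep, b.sign)]) * HNNExtension.of 1 = 1 := by
      rw [List.nil_append, word_append, word_singleton, word_singleton, ← h1]
      simp [mul_assoc]
    rw [hw, hT.tLength_one] at this
    simp at this

omit hT in
theorem transProb_eq (L : Measure (ℕ → HNN φ)) {s s' : Block G₀ × ℕ}
    (h : tPow φ s.1.sign * HNNExtension.of s'.1.rep * tPow φ s'.1.sign ≠ 1) :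
    transProb X Y L (coord φ) s s' =
      L (escapeEvent φ s'.1.sign s'.1.tail) / L (escapeEvent φ s.1.sign s.1.tail) *
        L (stepEvent φ X Y s.1.sign s.1.tail s'.1 s'.2) := by
  rw [transProb, if_pos h]
  rfl

variable [Countable (HNN φ)] (μ : Measure (HNN φ)) [IsProbabilityMeasure μ]
  (hsteps : ∀ᵐ z ∂seqLaw μ, ∀ i, z i ∈ stepSet φ)
  (hstays : ∀ᵐ z ∂seqLaw μ, ∀ k, ∃ m, Stays X Y k m z)
include hsteps hstays

/-- The Markov property of the exit chain on the event that the exit time and the position at the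
exit time have given values. -/
theorem Transversals.exitChain_markov_fixed {l₀ : List (G₀ × ℤˣ)} {b : Block G₀} {N : ℕ}
    (h0 : IsNormal X Y (l₀ ++ [(b.rep, b.sign)])) {Φ : (ℕ → Block G₀ × ℕ) → Prop}
    (hΦ : ∀ w w', (∀ j, 1 ≤ j → j ≤ l₀.length + 1 → w j = w' j) → Φ w → Φ w')
    {b' : Block G₀} {n' m : ℕ} (hb' : b' ∈ blocks A B X Y) (hn' : 1 ≤ n') :
    seqLaw μ {z | (exitTime X Y (coord φ) (l₀.length + 1) z = N ∧ path z 1 N = word φ l₀ * b.val φ ∧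
        Φ fun j => exitChain X Y (coord φ) j z) ∧
        exitChain X Y (coord φ) (l₀.length + 2) z = (b', n')} =
      seqLaw μ {z | exitTime X Y (coord φ) (l₀.length + 1) z = N ∧
        path z 1 N = word φ l₀ * b.val φ ∧ Φ fun j => exitChain X Y (coord φ) j z} *
      transProb X Y (seqLaw μ) (coord φ) (b, m) (b', n') := by
  set E : Set (ℕ → HNN φ) := {z | (∀ i, z i ∈ stepSet φ) ∧ Stays X Y (l₀.length + 1) N z ∧
    exitTime X Y (coord φ) (l₀.length + 1) z = N ∧ path z 1 N = word φ l₀ * b.val φ ∧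
    Φ fun j => exitChain X Y (coord φ) j z} with hE
  have hE1 : seqLaw μ {z | exitTime X Y (coord φ) (l₀.length + 1) z = N ∧
        path z 1 N = word φ l₀ * b.val φ ∧ Φ fun j => exitChain X Y (coord φ) j z}
      = seqLaw μ E := by
    refine measure_congr ?_
    filter_upwards [hsteps, hstays] with z hz1 hz2
    refine propext ⟨fun h => ⟨hz1, ?_, h⟩, fun h => h.2.2⟩
    have := stays_exitTime (hz2 (l₀.length + 1))
    rwa [h.1] at this
  have hE2 : seqLaw μ {z | (exitTime X Y (coord φ) (l₀.length + 1) z = N ∧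
        path z 1 N = word φ l₀ * b.val φ ∧ Φ fun j => exitChain X Y (coord φ) j z) ∧
        exitChain X Y (coord φ) (l₀.length + 2) z = (b', n')}
      = seqLaw μ (E ∩ {z | exitChain X Y (coord φ) (l₀.length + 2) z = (b', n')}) := by
    refine measure_congr ?_
    filter_upwards [hsteps, hstays] with z hz1 hz2
    refine propext ⟨fun h => ⟨⟨hz1, ?_, h.1⟩, h.2⟩, fun h => ⟨h.1.2.2, h.2⟩⟩
    have := stays_exitTime (hz2 (l₀.length + 1))
    rwa [h.1.1] at this
  rw [hE1, hE2]
  by_cases hne : tPow φ b.sign * HNNExtension.of b'.rep * tPow φ b'.sign ≠ 1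
  swap
  · rw [transProb, if_neg hne, mul_zero]
    refine measure_mono_null ?_ (ae_iff.mp (hsteps.and hstays))
    rintro z ⟨⟨hz1, hz2, hz3, hz4, -⟩, hz6⟩ ⟨-, hz5⟩
    obtain ⟨b₁, hb₁, hn₁, -, hlast⟩ := hT.exitTime_block_succ hz1 h0 hz4 hz2 (hz5 _)
      (hz3 ▸ (hT.exitTime_lt hz1 (hz5 _) (hz5 _)).le)
    have : b₁ = b' := hlast.symm.trans (congrArg Prod.fst hz6)
    subst this
    exact hne ((hT.tPow_mul_ne_one_iff hb').mpr (isNormal_concat_iff.mp hn₁).2.2)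
  have hnorm : IsNormal X Y (l₀ ++ [(b.rep, b.sign)] ++ [(b'.rep, b'.sign)]) :=
    isNormal_concat_iff.mpr ⟨h0, hb'.1, (hT.tPow_mul_ne_one_iff hb').mp hne⟩
  -- the part of the event that concerns the steps before time `N`
  set D : Set (ℕ → HNN φ) := {z | ∃ z₀ ∈ E, ∀ i < N, z₀ i = z i} with hD
  have hDdec : DecidedBy N D := by
    rintro z z' hzz' ⟨z₀, hz₀, h⟩
    exact ⟨z₀, hz₀, fun i hi => (h i hi).trans (hzz' i hi)⟩
  have hclosed : ∀ z ∈ D, (∀ i, z i ∈ stepSet φ) → Stays X Y (l₀.length + 1) N z → z ∈ E := by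
    rintro z ⟨z₀, ⟨hz1, hz2, hz3, hz4, hz5⟩, h⟩ hz hst
    have he : ∀ j ≤ l₀.length + 1,
        exitTime X Y (coord φ) j z₀ = exitTime X Y (coord φ) j z :=
      fun j hj => exitTime_congr hj h hz2 hst
    refine ⟨hz, hst, by rw [← he _ le_rfl, hz3], by rw [← path_congr h, hz4],
      hΦ _ _ (fun j hj1 hj => ?_) hz5⟩
    have hle : exitTime X Y (coord φ) j z ≤ N :=
      exitTime_le fun n hn => hj.trans (hst n hn)
    have hp := path_congr (n := exitTime X Y (coord φ) j z) (fun i hi => h i (by omega))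
      (1 : HNN φ)
    rw [path, path] at hp
    simp only [exitChain, he j hj, he (j - 1) (by omega), hp]
  have hpathD : ∀ z ∈ D, path z 1 N = word φ l₀ * b.val φ := by
    rintro z ⟨z₀, hz₀, h⟩
    rw [← path_congr h]; exact hz₀.2.2.2.1
  have hLE : seqLaw μ E = seqLaw μ D * seqLaw μ (escapeEvent φ b.sign b.tail) := by
    rw [← seqLaw_inter_shiftSeq μ hDdec (measurableSet_escapeEvent _ _)]
    refine measure_congr ?_
    filter_upwards [hsteps] with z hz
    refine propext ⟨fun h => ⟨⟨z, h, fun _ _ => rfl⟩, (hT.stays_iff hz h0 h.2.2.2.1).mp h.2.1⟩,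
      fun h => hclosed z h.1 hz ((hT.stays_iff hz h0 (hpathD z h.1)).mpr h.2)⟩
  have hLE' : seqLaw μ (E ∩ {z | exitChain X Y (coord φ) (l₀.length + 2) z = (b', n')}) =
      seqLaw μ D * (seqLaw μ (stepEvent φ X Y b.sign b.tail b' n') *
        seqLaw μ (escapeEvent φ b'.sign b'.tail)) := by
    have hm := measurableSet_escapeEvent (φ := φ) b'.sign b'.tail
    have hJ := decidedBy_stepEvent (φ := φ) (X := X) (Y := Y) b.sign b.tail b' n'
    rw [← seqLaw_inter_shiftSeq μ hJ hm, ← seqLaw_inter_shiftSeq μ hDdec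
      (hJ.measurableSet.inter (measurable_shiftSeq n' hm))]
    refine measure_congr ?_
    filter_upwards [hsteps, hstays] with z hz hz'
    refine propext ⟨fun h => ⟨⟨z, h.1, fun _ _ => rfl⟩, ?_⟩, fun h => ?_⟩
    · exact (hT.exitChain_succ_eq_iff hz hnorm h.1.2.2.2.1 h.1.2.2.1 hn').mp
        ⟨h.1.2.1, hz' _, h.2⟩
    · have h1 : z ∈ E := by
        refine hclosed z h.1 hz ?_
        refine (hT.stays_iff hz h0 (hpathD z h.1)).mpr
          (hT.escape_of_step (fun i => hz (N + i)) ?_ h.2.1 h.2.2).2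
        exact isNormal_concat_iff (l := []).mpr
          ⟨isNormal_singleton_iff.mpr (hT.one_mem _), (isNormal_concat_iff.mp hnorm).2⟩
      exact ⟨h1, ((hT.exitChain_succ_eq_iff hz hnorm h1.2.2.2.1 h1.2.2.1 hn').mpr h.2).2.2⟩
  rw [hLE']
  by_cases hxi : seqLaw μ (escapeEvent φ b.sign b.tail) = 0
  · have h1 : seqLaw μ (E ∩ {z | exitChain X Y (coord φ) (l₀.length + 2) z = (b', n')}) = 0 :=
      measure_mono_null Set.inter_subset_left (by rw [hLE, hxi, mul_zero])
    rw [← hLE', h1, hLE, hxi, mul_zero, zero_mul]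
  · rw [hLE, transProb_eq (seqLaw μ) (s := (b, m)) (s' := (b', n')) hne]
    have hxi' : seqLaw μ (escapeEvent φ b.sign b.tail) ≠ ∞ := measure_ne_top _ _
    rw [ENNReal.div_eq_inv_mul]
    calc _ = seqLaw μ D * (seqLaw μ (escapeEvent φ b.sign b.tail) *
          (seqLaw μ (escapeEvent φ b.sign b.tail))⁻¹) *
          (seqLaw μ (stepEvent φ X Y b.sign b.tail b' n') *
            seqLaw μ (escapeEvent φ b'.sign b'.tail)) := by
          rw [ENNReal.mul_inv_cancel hxi hxi', mul_one]
      _ = _ := by ring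

/-- The Markov property of the exit chain. -/
theorem Transversals.exitChain_markov {k : ℕ} (hk : 1 ≤ k) {Φ : (ℕ → Block G₀ × ℕ) → Prop}
    (hΦ : ∀ w w', (∀ j, 1 ≤ j → j ≤ k → w j = w' j) → Φ w → Φ w') {s s' : Block G₀ × ℕ}
    (hs : ∀ w, Φ w → w k = s) (hb' : s'.1 ∈ blocks A B X Y) (hn' : 1 ≤ s'.2) :
    seqLaw μ {z | (Φ fun j => exitChain X Y (coord φ) j z) ∧
        exitChain X Y (coord φ) (k + 1) z = s'} =
      seqLaw μ {z | Φ fun j => exitChain X Y (coord φ) j z} *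
        transProb X Y (seqLaw μ) (coord φ) s s' := by
  set f : (ℕ → HNN φ) → ℕ × HNN φ := fun z =>
    (exitTime X Y (coord φ) k z, path z 1 (exitTime X Y (coord φ) k z)) with hf
  have hfm : ∀ i, MeasurableSet (f ⁻¹' {i}) := fun i =>
    ((measurable_exitTime k).prodMk (measurable_path_exitTime k)) (measurableSet_singleton i)
  rw [measure_eq_tsum_fiber _ hfm, measure_eq_tsum_fiber _ hfm
    {z | Φ fun j => exitChain X Y (coord φ) j z}, ← ENNReal.tsum_mul_right]
  refine tsum_congr fun ⟨N, x⟩ => ?_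
  by_cases hpos : seqLaw μ ({z | Φ fun j => exitChain X Y (coord φ) j z} ∩ f ⁻¹' {(N, x)}) = 0
  · rw [hpos, zero_mul]
    refine measure_mono_null ?_ hpos
    exact fun z hz => ⟨hz.1.1, hz.2⟩
  obtain ⟨z, ⟨hz1, hz2⟩, hz3, hz4⟩ := ((frequently_ae_mem_iff.mpr hpos).and_eventually
    (hsteps.and hstays)).exists
  obtain ⟨l₀, b, hl, -, hn, hp, hlast⟩ := hT.exitTime_block hk hz3 (hz4 k)
  have hz2 : f z = (N, x) := hz2
  simp only [hf, Prod.mk.injEq] at hz2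
  obtain ⟨rfl, rfl⟩ := hz2
  have hsb : s.1 = b := by rw [← hs _ hz1]; exact hlast
  subst hl
  have key := hT.exitChain_markov_fixed μ hsteps hstays
    (N := exitTime X Y (coord φ) (l₀.length + 1) z)
    hn hΦ (m := s.2) hb' hn'
  rw [← hsb] at key
  convert key using 2
  · ext y
    simp only [hf, Set.mem_inter_iff, Set.mem_ofPred_eq, Set.mem_preimage, Set.mem_singleton_iff,
      Prod.mk.injEq]
    constructor
    · rintro ⟨⟨h1, h2⟩, h3, h4⟩
      rw [h3, hp, hsb.symm] at h4
      exact ⟨⟨h3, h4, h1⟩, h2⟩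
    · rintro ⟨⟨h3, h4, h1⟩, h2⟩
      exact ⟨⟨h1, h2⟩, h3, by rw [h3, hp, hsb.symm]; exact h4⟩
  · congr 1
    ext y
    simp only [hf, Set.mem_inter_iff, Set.mem_ofPred_eq, Set.mem_preimage, Set.mem_singleton_iff,
      Prod.mk.injEq]
    constructor
    · rintro ⟨h1, h3, h4⟩
      rw [h3, hp, hsb.symm] at h4
      exact ⟨h3, h4, h1⟩
    · rintro ⟨h3, h4, h1⟩
      exact ⟨h1, h3, by rw [h3, hp, hsb.symm]; exact h4⟩

end

end HNNWalk

/-! ### Chains whose transitions depend on a finite part of the state -/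

namespace MarkovMatrix

open scoped ENNReal

section

variable {S : Type*} {Q : S → S → ℝ≥0∞}

theorem nStep_one (s s' : S) : nStep Q 1 s s' = Q s s' := by
  simp [nStep]

theorem mul_nStep_le (n : ℕ) (s u s' : S) : Q s u * nStep Q n u s' ≤ nStep Q (n + 1) s s' :=
  ENNReal.le_tsum (f := fun u => Q s u * nStep Q n u s') u

theorem tsum_eq_add_tsum_ne (f : S → ℝ≥0∞) (s : S) :
    ∑' v, f v = f s + ∑' v : {v : S // v ≠ s}, f v := by
  classical
  rw [ENNReal.summable.tsum_eq_add_tsum_ite' s]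
  congr 1
  rw [show ∑' v : {v : S // v ≠ s}, f v = ∑' v, Set.indicator {v | v ≠ s} f v from
    tsum_subtype {v | v ≠ s} f]
  refine tsum_congr fun v => ?_
  by_cases h : v = s <;> simp [h]

/-- The probability that the chain started in `u` does not visit `s` at any of the times
`1, …, n`. -/
noncomputable def avoidProb (Q : S → S → ℝ≥0∞) (s : S) : ℕ → S → ℝ≥0∞
  | 0, _ => 1
  | n + 1, u => ∑' v : {v : S // v ≠ s}, Q u v * avoidProb Q s n v

theorem firstHit_add_avoidProb (hQ : IsStochastic Q) (s : S) (n : ℕ) (u : S) :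
    firstHit Q s n u + avoidProb Q s (n + 1) u = avoidProb Q s n u := by
  induction n generalizing u with
  | zero =>
    simp only [firstHit, avoidProb, mul_one]
    rw [← tsum_eq_add_tsum_ne (fun v => Q u v) s, hQ u]
  | succ n ih =>
    rw [firstHit, avoidProb, avoidProb, ← ENNReal.tsum_add]
    exact tsum_congr fun v => by rw [← mul_add, ih]

theorem avoidProb_succ_le (hQ : IsStochastic Q) (s : S) (n : ℕ) (u : S) :
    avoidProb Q s (n + 1) u ≤ avoidProb Q s n u := by
  rw [← firstHit_add_avoidProb hQ s n u]; exact le_add_self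

theorem sum_firstHit_add_avoidProb (hQ : IsStochastic Q) (s : S) (N : ℕ) (u : S) :
    ∑ n ∈ Finset.range N, firstHit Q s n u + avoidProb Q s N u = 1 := by
  induction N with
  | zero => simp [avoidProb]
  | succ N ih => rw [Finset.sum_range_succ, add_assoc, firstHit_add_avoidProb hQ, ih]

theorem sum_mul_firstHit_add_avoidProb (hQ : IsStochastic Q) (s : S) (N : ℕ) (u : S) :
    ∑ n ∈ Finset.range N, ((n : ℝ≥0∞) + 1) * firstHit Q s n u + N * avoidProb Q s N u
      = ∑ n ∈ Finset.range N, avoidProb Q s n u := by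
  induction N with
  | zero => simp
  | succ N ih =>
    rw [Finset.sum_range_succ, Finset.sum_range_succ, ← ih, Nat.cast_succ, add_assoc, ← mul_add,
      firstHit_add_avoidProb hQ]
    ring

/-- If the chain is in `s` after two steps with a probability that is bounded below, uniformly in
the starting point, then the return time to `s` has a geometric tail. -/
theorem returns_of_two_step (hQ : IsStochastic Q) (s : S) {ε : ℝ≥0∞} (hε : 0 < ε)
    (h : ∀ u, ε ≤ ∑' v, Q u v * Q v s) (u : S) :
    ∑' n, firstHit Q s n u = 1 ∧ ∑' n : ℕ, ((n : ℝ≥0∞) + 1) * firstHit Q s n u < ⊤ := by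
  have hstep : ∀ (n : ℕ) (K : ℝ≥0∞), (∀ w, avoidProb Q s n w ≤ K) →
      ∀ w, avoidProb Q s (n + 1) w ≤ K * avoidProb Q s 1 w := by
    intro n K hK w
    rw [avoidProb, avoidProb, ← ENNReal.tsum_mul_left]
    refine ENNReal.tsum_le_tsum fun v => ?_
    rw [mul_comm K, mul_assoc]
    exact mul_le_mul_right ((hK v).trans_eq (by simp [avoidProb])) _
  have hstep2 : ∀ (n : ℕ) (K : ℝ≥0∞), (∀ w, avoidProb Q s n w ≤ K) →
      ∀ w, avoidProb Q s (n + 2) w ≤ K * avoidProb Q s 2 w := by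
    intro n K hK w
    rw [avoidProb, avoidProb, ← ENNReal.tsum_mul_left]
    refine ENNReal.tsum_le_tsum fun v => ?_
    rw [mul_left_comm]
    exact mul_le_mul_right (hstep n K hK v) _
  have htwo : ∀ w, avoidProb Q s 2 w ≤ 1 - ε := by
    intro w
    have h1 : ε + avoidProb Q s 2 w ≤ 1 := by
      calc ε + avoidProb Q s 2 w
          ≤ ∑' v, Q w v * Q v s + ∑' v, Q w v * avoidProb Q s 1 v := by
            refine add_le_add (h w) ?_
            rw [tsum_eq_add_tsum_ne (fun v => Q w v * avoidProb Q s 1 v) s]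
            exact le_add_self
        _ = ∑' v, Q w v * (Q v s + avoidProb Q s 1 v) := by
            rw [← ENNReal.tsum_add]; simp only [mul_add]
        _ = 1 := by
            have : ∀ v, Q v s + avoidProb Q s 1 v = 1 := fun v =>
              firstHit_add_avoidProb hQ s 0 v
            simp only [this, mul_one]
            exact hQ w
    exact ENNReal.le_sub_of_add_le_left
      (ne_top_of_le_ne_top ENNReal.one_ne_top (le_self_add.trans h1)) h1
  set r := 1 - ε with hr
  have hr1 : r < 1 := ENNReal.sub_lt_self ENNReal.one_ne_top one_ne_zero hε.ne'
  have hgeo : ∀ n w, avoidProb Q s (2 * n) w ≤ r ^ n := by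
    intro n
    induction n with
    | zero => intro w; simp [avoidProb]
    | succ n ih =>
      intro w
      rw [pow_succ]
      exact (hstep2 (2 * n) (r ^ n) ih w).trans (mul_le_mul_right (htwo w) _)
  have hsum : ∑' n, avoidProb Q s n u ≠ ∞ := by
    rw [← tsum_even_add_odd ENNReal.summable ENNReal.summable]
    have hfin : ∑' n, r ^ n ≠ ∞ := by
      rw [ENNReal.tsum_geometric]
      exact ENNReal.inv_ne_top.mpr (tsub_pos_of_lt hr1).ne'
    refine ENNReal.add_ne_top.mpr ⟨ne_top_of_le_ne_top hfin ?_, ne_top_of_le_ne_top hfin ?_⟩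
    · exact ENNReal.tsum_le_tsum fun n => hgeo n u
    · exact ENNReal.tsum_le_tsum fun n => (avoidProb_succ_le hQ s _ u).trans (hgeo n u)
  constructor
  · have h1 := (ENNReal.summable (f := fun n => firstHit Q s n u)).hasSum.tendsto_sum_nat
    have h2 := ENNReal.tendsto_atTop_zero_of_tsum_ne_top hsum
    have h3 := h1.add h2
    simp only [sum_firstHit_add_avoidProb hQ, add_zero] at h3
    exact tendsto_nhds_unique h3 tendsto_const_nhds
  · refine lt_of_le_of_lt ?_ hsum.lt_top
    rw [ENNReal.tsum_eq_iSup_nat]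
    refine iSup_le fun N => ?_
    calc _ ≤ ∑ n ∈ Finset.range N, avoidProb Q s n u := by
          rw [← sum_mul_firstHit_add_avoidProb hQ]; exact le_self_add
      _ ≤ _ := ENNReal.sum_le_tsum _

end

/-! The transition probabilities `Q s s' = k (τ s) s'` depend on `s` only through its type `τ s`,
and there are finitely many types. -/

section

variable {S C : Type*} [Finite C] {k : C → S → ℝ≥0∞} {τ : S → C} {Q : S → S → ℝ≥0∞}

section

variable (hQ : ∀ s s', Q s s' = k (τ s) s') (h1 : ∀ c, ∑' s, k c s = 1)
  (h2 : ∀ c c', ∃ s, τ s = c' ∧ 0 < k c s) (h3 : ∀ s, ∃ c, 0 < k c s)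
include hQ

include h1 in
omit [Finite C] in
theorem isStochastic_of_finite : IsStochastic Q := fun s => by simp only [hQ, h1]

include h2 h3

omit [Finite C] in
theorem two_step_pos (c : C) (s : S) : 0 < ∑' v, k c v * Q v s := by
  obtain ⟨c', hc'⟩ := h3 s
  obtain ⟨v, rfl, hv⟩ := h2 c c'
  refine lt_of_lt_of_le ?_ (ENNReal.le_tsum v)
  rw [hQ]
  exact ENNReal.mul_pos hv.ne' hc'.ne'

omit [Finite C] in
theorem nStep_pos (n : ℕ) (s s' : S) : 0 < nStep Q (n + 2) s s' := by
  induction n generalizing s with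
  | zero =>
    have h : nStep Q 2 s s' = ∑' u, k (τ s) u * Q u s' := by
      rw [nStep]
      simp only [nStep_one, hQ s]
    rw [zero_add, h]
    exact two_step_pos hQ h2 h3 (τ s) s'
  | succ n ih =>
    obtain ⟨u, -, hu⟩ := h2 (τ s) (τ s)
    refine lt_of_lt_of_le (ENNReal.mul_pos ?_ (ih u).ne') (mul_nStep_le (n + 2) s u s')
    rw [hQ]; exact hu.ne'

omit [Finite C] in
theorem isIrreducible_of_finite : IsIrreducible Q := fun s s' =>
  ⟨2, by omega, nStep_pos hQ h2 h3 0 s s'⟩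

omit [Finite C] in
theorem isAperiodic_of_finite : IsAperiodic Q := by
  intro s d hd
  have h2' := hd 2 (by omega) (nStep_pos hQ h2 h3 0 s s)
  have h3' := hd 3 (by omega) (nStep_pos hQ h2 h3 1 s s)
  exact Nat.dvd_one.mp ((Nat.dvd_add_right h2').mp h3')

include h1 in
theorem isPositiveRecurrent_of_finite : IsPositiveRecurrent Q := by
  intro s
  have : Nonempty C := ⟨τ s⟩
  obtain ⟨c₀, hc₀⟩ := Finite.exists_min fun c => ∑' v, k c v * Q v s
  refine returns_of_two_step (isStochastic_of_finite hQ h1) s (two_step_pos hQ h2 h3 c₀ s)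
    (fun u => ?_) s
  simpa only [hQ] using hc₀ (τ u)

end

/-! ### The invariant law of a positive stochastic matrix -/

section

variable {D : Type*} [Fintype D]

/-- A left fixed vector of a positive stochastic matrix is either nonpositive or positive. -/
theorem sign_of_vecMul_eq {M : D → D → ℝ} (hM : ∀ c c', 0 < M c c') (h1 : ∀ c, ∑ c', M c c' = 1)
    {v : D → ℝ} (hv : ∀ c', ∑ c, v c * M c c' = v c') : (∀ c, v c ≤ 0) ∨ ∀ c, 0 < v c := by
  by_cases h : ∀ c, v c ≤ 0
  · exact Or.inl h
  push Not at h
  obtain ⟨a, ha⟩ := h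
  right
  -- the positive part is a fixed vector, too, because its total mass is preserved
  have hle : ∀ c', max (v c') 0 ≤ ∑ c, max (v c) 0 * M c c' := by
    intro c'
    refine max_le ?_ (Finset.sum_nonneg fun c _ => mul_nonneg (le_max_right _ _) (hM c c').le)
    rw [← hv c']
    exact Finset.sum_le_sum fun c _ => mul_le_mul_of_nonneg_right (le_max_left _ _) (hM c c').le
  have hsum : ∑ c', max (v c') 0 = ∑ c', ∑ c, max (v c) 0 * M c c' := by
    rw [Finset.sum_comm]
    exact Finset.sum_congr rfl fun c _ => by rw [← Finset.mul_sum, h1, mul_one]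
  have heq := (Finset.sum_eq_sum_iff_of_le fun c' _ => hle c').mp hsum
  intro c'
  have : 0 < max (v c') 0 := by
    rw [heq c' (Finset.mem_univ _)]
    refine Finset.sum_pos' (fun c _ => mul_nonneg (le_max_right _ _) (hM c c').le)
      ⟨a, Finset.mem_univ _, mul_pos (lt_max_of_lt_left ha) (hM a c')⟩
  rcases lt_max_iff.mp this with h | h
  · exact h
  · exact absurd h (lt_irrefl _)

theorem existsUnique_real_invariant [Nonempty D] {M : D → D → ℝ} (hM : ∀ c c', 0 < M c c')
    (h1 : ∀ c, ∑ c', M c c' = 1) :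
    ∃ v : D → ℝ, (∀ c, 0 < v c) ∧ ∑ c, v c = 1 ∧ (∀ c', ∑ c, v c * M c c' = v c') ∧
      ∀ w : D → ℝ, ∑ c, w c = 1 → (∀ c', ∑ c, w c * M c c' = w c') → w = v := by
  classical
  have hdet : (Matrix.of M - 1).det = 0 := by
    refine Matrix.exists_mulVec_eq_zero_iff.mp ⟨fun _ => 1, ?_, ?_⟩
    · intro h
      obtain ⟨c⟩ := ‹Nonempty D›
      exact one_ne_zero (congrFun h c)
    · rw [Matrix.sub_mulVec, Matrix.one_mulVec, sub_eq_zero]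
      funext c
      simpa [Matrix.mulVec, dotProduct] using h1 c
  obtain ⟨v, hv0, hv⟩ := Matrix.exists_vecMul_eq_zero_iff.mpr hdet
  rw [Matrix.vecMul_sub, Matrix.vecMul_one, sub_eq_zero] at hv
  have hv : ∀ c', ∑ c, v c * M c c' = v c' := fun c' => by
    simpa [Matrix.vecMul, dotProduct] using congrFun hv c'
  have hpos : ∃ v : D → ℝ, (∀ c, 0 < v c) ∧ ∀ c', ∑ c, v c * M c c' = v c' := by
    rcases sign_of_vecMul_eq hM h1 hv with h | h
    · have hv' : ∀ c', ∑ c, (-v) c * M c c' = (-v) c' := fun c' => by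
        simp [Finset.sum_neg_distrib, hv c']
      rcases sign_of_vecMul_eq hM h1 hv' with h' | h'
      · exact absurd (funext fun c => le_antisymm (h c) (by simpa using h' c)) hv0
      · exact ⟨_, h', hv'⟩
    · exact ⟨v, h, hv⟩
  obtain ⟨v, hvp, hv⟩ := hpos
  have hs : 0 < ∑ c, v c := Finset.sum_pos (fun c _ => hvp c) Finset.univ_nonempty
  refine ⟨fun c => v c / ∑ c, v c, fun c => div_pos (hvp c) hs, ?_, ?_, ?_⟩
  · rw [← Finset.sum_div, div_self hs.ne']
  · intro c'
    simp only [div_mul_eq_mul_div, ← Finset.sum_div, hv]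
  · intro w hw1 hw
    set u : D → ℝ := fun c => v c / ∑ c, v c with hu
    have hu1 : ∑ c, u c = 1 := by rw [← Finset.sum_div, div_self hs.ne']
    have huM : ∀ c', ∑ c, u c * M c c' = u c' := by
      intro c'
      simp only [hu, div_mul_eq_mul_div, ← Finset.sum_div, hv]
    have hd : ∀ c', ∑ c, (w - u) c * M c c' = (w - u) c' := by
      intro c'
      simp [sub_mul, hw c', huM c']
    have hd0 : ∑ c, (w - u) c = 0 := by simp [hw1, hu1]
    rcases sign_of_vecMul_eq hM h1 hd with h | h
    · have := (Finset.sum_eq_zero_iff_of_nonpos fun c _ => h c).mp hd0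
      funext c
      exact sub_eq_zero.mp (this c (Finset.mem_univ c))
    · exact absurd hd0 (Finset.sum_pos (fun c _ => h c) Finset.univ_nonempty).ne'

/-- A nonnegative matrix all of whose columns outside a set `p` vanish, and whose restriction
to `p` is a positive stochastic matrix, has exactly one invariant law. -/
theorem existsUnique_isInvariantLaw {M : D → D → ℝ≥0∞} (p : D → Prop) (hp : ∃ c, p c)
    (h0 : ∀ c c', ¬ p c' → M c c' = 0) (hpos : ∀ c c', p c → p c' → 0 < M c c')
    (h1 : ∀ c, p c → ∑' c', M c c' = 1) : ∃! ν : D → ℝ≥0∞, IsInvariantLaw M ν := by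
  classical
  have : Nonempty {c // p c} := by obtain ⟨c, hc⟩ := hp; exact ⟨⟨c, hc⟩⟩
  have hfin : ∀ c c', p c → M c c' ≠ ∞ := fun c c' hc =>
    ne_top_of_le_ne_top ENNReal.one_ne_top ((ENNReal.le_tsum c').trans_eq (h1 c hc))
  have hsub : ∀ f : D → ℝ≥0∞, (∀ c, ¬ p c → f c = 0) → ∑' c, f c = ∑ c : {c // p c}, f c := by
    intro f hf
    rw [← tsum_fintype (L := .unconditional _),
      show ∑' c : {c // p c}, f c = ∑' c, Set.indicator {c | p c} f c from
        tsum_subtype {c | p c} f]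
    refine tsum_congr fun c => ?_
    by_cases hc : p c
    · rw [Set.indicator_of_mem (show c ∈ {c | p c} from hc)]
    · rw [Set.indicator_of_notMem (show c ∉ {c | p c} from hc), hf c hc]
  obtain ⟨v, hv0, hv1, hvM, huniq⟩ := existsUnique_real_invariant
    (D := {c // p c}) (M := fun c c' => (M c c').toReal)
    (fun c c' => ENNReal.toReal_pos (hpos c c' c.2 c'.2).ne' (hfin c c' c.2)) (fun c => by
      have h := congrArg ENNReal.toReal
        ((hsub (fun c' => M c c') fun c' hc' => h0 c c' hc').symm.trans (h1 c c.2))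
      rwa [ENNReal.toReal_sum fun (c' : {c // p c}) _ => hfin c c' c.2, ENNReal.toReal_one] at h)
  refine ⟨fun c => if hc : p c then ENNReal.ofReal (v ⟨c, hc⟩) else 0, ⟨?_, ?_⟩, ?_⟩
  · rw [hsub _ fun c hc => dif_neg hc]
    rw [Finset.sum_congr rfl fun c _ => dif_pos c.2,
      ← ENNReal.ofReal_sum_of_nonneg fun c _ => (hv0 c).le, hv1, ENNReal.ofReal_one]
  · intro c'
    rw [hsub _ fun c hc => by simp only [dif_neg hc, zero_mul]]
    by_cases hc' : p c'
    · simp only [dif_pos hc']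
      rw [← hvM ⟨c', hc'⟩,
        ENNReal.ofReal_sum_of_nonneg fun c _ => mul_nonneg (hv0 c).le ENNReal.toReal_nonneg]
      refine Finset.sum_congr rfl fun c _ => ?_
      rw [dif_pos c.2, ENNReal.ofReal_mul (hv0 c).le, ENNReal.ofReal_toReal (hfin c c' c.2)]
    · simp [dif_neg hc', h0 _ c' hc']
  · intro ν hν
    have hν0 : ∀ c, ¬ p c → ν c = 0 := fun c hc => by
      rw [← hν.2 c]; simp [h0 _ c hc]
    have hνf : ∀ c, ν c ≠ ∞ := fun c =>
      ne_top_of_le_ne_top ENNReal.one_ne_top ((ENNReal.le_tsum c).trans_eq hν.1)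
    have hkey := huniq (fun c => (ν c).toReal) (by
      have h := congrArg ENNReal.toReal ((hsub ν hν0).symm.trans hν.1)
      rwa [ENNReal.toReal_sum fun (c : {c // p c}) _ => hνf c, ENNReal.toReal_one] at h) (by
      intro c'
      have h := congrArg ENNReal.toReal ((hsub (fun c => ν c * M c c'.1)
        fun c hc => by rw [hν0 c hc, zero_mul]).symm.trans (hν.2 c'.1))
      rw [ENNReal.toReal_sum fun (c : {c // p c}) _ =>
        ENNReal.mul_ne_top (hνf c) (hfin c c' c.2)] at h
      simpa only [ENNReal.toReal_mul] using h)
    funext c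
    by_cases hc : p c
    · rw [dif_pos hc, ← congrFun hkey ⟨c, hc⟩, ENNReal.ofReal_toReal (hνf c)]
    · rw [dif_neg hc, hν0 c hc]

end

end

end MarkovMatrix

/-! ### Transitions of positive probability -/

namespace HNNWalk

open scoped ENNReal

variable {G₀ : Type*} [Group G₀] {A B : Subgroup G₀} {X Y : Set G₀} {φ : A ≃* B}

instance instCountableBlock [Countable G₀] : Countable (Block G₀) := by
  have : Countable ℤˣ := Finite.to_countable
  exact Function.Injective.countable (f := fun b : Block G₀ => (b.rep, b.sign, b.tail))
    fun b b' h => by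
      simp only [Prod.mk.injEq] at h
      exact Block.ext h.1 h.2.1 h.2.2

/-- The pairs of a block and a time `n ≥ 1`. -/
def blockTimes (A B : Subgroup G₀) (X Y : Set G₀) : Set (Block G₀ × ℕ) :=
  {s | s.1 ∈ blocks A B X Y ∧ 1 ≤ s.2}

theorem exists_pos_of_measure_pos {Ω ι : Type*} [MeasurableSpace Ω] (P : Measure Ω) [Countable ι]
    {f : Ω → ι} (hf : ∀ i, MeasurableSet (f ⁻¹' {i})) {F : Set Ω} (hF : 0 < P F) :
    ∃ i, 0 < P (F ∩ f ⁻¹' {i}) := by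
  by_contra! h
  rw [measure_eq_tsum_fiber P hf F] at hF
  simp [fun i => le_antisymm (h i) bot_le] at hF

/-- The walk can move from `1` to any `x ∈ G₀` inside `G₀` and then make the step `t^ε`. -/
theorem base_path_pos [Countable (HNN φ)] (μ : Measure (HNN φ)) [IsProbabilityMeasure μ]
    (hbase : ∀ x : G₀, ∃ l : List G₀, (∀ y ∈ l, 0 < μ {HNNExtension.of y}) ∧ l.prod = x)
    (ht : ∀ ε, 0 < μ {tPow φ ε}) (x : G₀) (ε : ℤˣ) :
    ∃ j, 0 < seqLaw μ {z | path z 1 j = HNNExtension.of x ∧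
      (∀ m ≤ j, ∃ y : G₀, path z 1 m = HNNExtension.of y) ∧ z j = tPow φ ε} := by
  obtain ⟨l, hl, rfl⟩ := hbase x
  set ls : List (HNN φ) := l.map HNNExtension.of ++ [tPow φ ε] with hls
  have hpos : ∀ s ∈ ls, 0 < μ {s} := by
    intro s hs
    rcases List.mem_append.mp hs with hs | hs
    · obtain ⟨y, hy, rfl⟩ := List.mem_map.mp hs
      exact hl y hy
    · rw [List.mem_singleton.mp hs]; exact ht ε
  have hlen : ls.length = l.length + 1 := by simp [hls]
  refine ⟨l.length, lt_of_lt_of_le (seqLaw_list_pos μ ls hpos) (measure_mono fun z hz => ?_)⟩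
  have htake : ∀ m ≤ l.length, path z 1 m = HNNExtension.of (l.take m).prod := by
    intro m hm
    rw [path_eq_take_prod hz 1 (by omega), one_mul, hls,
      List.take_append_of_le_length (by simpa using hm), ← List.map_take, map_list_prod]
  refine ⟨?_, fun m hm => ⟨_, htake m hm⟩, ?_⟩
  · rw [htake _ le_rfl, List.take_length]
  · rw [hz _ (by omega), hls]
    simp [List.getD_eq_getElem?_getD]

section

variable (hT : Transversals A B X Y) [Countable (HNN φ)] (μ : Measure (HNN φ))
  [IsProbabilityMeasure μ]
include hT

theorem Transversals.stepEvent_pos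
    (hbase : ∀ x : G₀, ∃ l : List G₀, (∀ y ∈ l, 0 < μ {HNNExtension.of y}) ∧ l.prod = x)
    (ht : ∀ ε, 0 < μ {tPow φ ε}) (ε : ℤˣ) (h : G₀) {b : Block G₀} (hb : b ∈ blocks A B X Y) :
    ∃ n, 1 ≤ n ∧ 0 < seqLaw μ (stepEvent φ X Y ε h b n) := by
  obtain ⟨a, -, ha⟩ := tPow_mul_of φ b.sign hb.2
  obtain ⟨j, hj⟩ := base_path_pos μ hbase ht (h⁻¹ * b.rep * a) b.sign
  refine ⟨j + 1, by omega, lt_of_lt_of_le hj (measure_mono ?_)⟩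
  rintro z ⟨h1, h2, h3⟩
  have hlen : ∀ m ≤ j, tLength φ X Y (path z (tailVal φ ε h) m) = 1 := by
    intro m hm
    obtain ⟨y, hy⟩ := h2 m hm
    rw [path_eq_mul, hy, hT.tLength_eq, (hT.nf_mul_of φ _ _).1, (hT.nf_tailVal ε h).1]
    rfl
  refine ⟨?_, by rw [Nat.add_sub_cancel]; exact hlen j le_rfl,
    fun m hm => (hlen m (by omega)).ge⟩
  rw [path_succ, path_eq_mul, h1, h3, Block.val, tailVal, tailVal, ha]
  simp [mul_assoc]

theorem Transversals.exitChain_one_pos (hsteps : ∀ᵐ z ∂seqLaw μ, ∀ i, z i ∈ stepSet φ)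
    (hbase : ∀ x : G₀, ∃ l : List G₀, (∀ y ∈ l, 0 < μ {HNNExtension.of y}) ∧ l.prod = x)
    (ht : ∀ ε, 0 < μ {tPow φ ε}) {ε : ℤˣ} {h : G₀} (hh : h ∈ tailGroup A B ε)
    (hξ : 0 < seqLaw μ (escapeEvent φ ε h)) :
    ∃ n, 1 ≤ n ∧ 0 < seqLaw μ {z | exitChain X Y (coord φ) 1 z = (⟨1, ε, h⟩, n)} := by
  obtain ⟨a, -, ha⟩ := tPow_mul_of φ ε hh
  obtain ⟨j, hj⟩ := base_path_pos μ hbase ht a ε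
  refine ⟨j + 1, by omega, ?_⟩
  set E : Set (ℕ → HNN φ) := {z | path z 1 j = HNNExtension.of a ∧ path z 1 (j + 1) = tailVal φ ε h}
    with hE
  have hdec : DecidedBy (j + 1) E := by
    rintro z z' hzz' ⟨h1, h2⟩
    exact ⟨by rw [← path_congr fun i hi => hzz' i (by omega)]; exact h1,
      by rw [← path_congr hzz']; exact h2⟩
  have hEpos : 0 < seqLaw μ E := lt_of_lt_of_le hj (measure_mono fun z hz =>
    ⟨hz.1, by rw [path_succ, hz.1, hz.2.2, tailVal, ha]⟩)
  have hpos := ENNReal.mul_pos hEpos.ne' hξ.ne'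
  rw [← seqLaw_inter_shiftSeq μ hdec (measurableSet_escapeEvent _ _)] at hpos
  refine lt_of_lt_of_le hpos (measure_mono_ae ?_)
  filter_upwards [hsteps] with z hz hzE
  obtain ⟨⟨h1, h2⟩, h3⟩ := hzE
  have hn : IsNormal X Y ([] ++ [((⟨1, ε, h⟩ : Block G₀).rep, (⟨1, ε, h⟩ : Block G₀).sign)]) :=
    isNormal_singleton_iff.mpr (hT.one_mem ε)
  have h2' : path z 1 (j + 1) = word φ [] * (⟨1, ε, h⟩ : Block G₀).val φ := by
    rw [h2]; simp [word, Block.val]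
  have hst : Stays X Y 1 (j + 1) z := (hT.stays_iff hz hn h2').mpr h3
  have he1 : exitTime X Y (coord φ) 1 z = j + 1 := by
    refine exitTime_eq hst (Or.inr ?_)
    rw [Nat.add_sub_cancel, h1]
    by_contra hlt
    exact (hT.notMem_range_iff _).mpr (not_lt.mp hlt) ⟨a, rfl⟩
  have he0 : exitTime X Y (coord φ) 0 z = 0 := exitTime_eq (fun _ _ => Nat.zero_le _) (Or.inl rfl)
  change exitChain X Y (coord φ) 1 z = _
  rw [exitChain, he1, Nat.sub_self, he0]
  refine Prod.ext ?_ rfl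
  change lastBlock φ X Y (path z 1 (j + 1)) = _
  rw [h2']
  exact hT.lastBlock_eq φ hn

variable (hsteps : ∀ᵐ z ∂seqLaw μ, ∀ i, z i ∈ stepSet φ)
  (hstays : ∀ᵐ z ∂seqLaw μ, ∀ k, ∃ m, Stays X Y k m z)
include hsteps hstays

omit [Countable (HNN φ)] [IsProbabilityMeasure μ] in
theorem Transversals.ae_exitChain_mem {k : ℕ} (hk : 1 ≤ k) :
    ∀ᵐ z ∂seqLaw μ, exitChain X Y (coord φ) k z ∈ blockTimes A B X Y := by
  filter_upwards [hsteps, hstays] with z hz hst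
  obtain ⟨l₀, b, -, hb, -, -, hlast⟩ := hT.exitTime_block hk hz (hst k)
  obtain ⟨k, rfl⟩ := Nat.exists_eq_add_of_le' hk
  refine ⟨?_, ?_⟩
  · change lastBlock φ X Y (path z 1 (exitTime X Y (coord φ) (k + 1) z)) ∈ _
    rw [hlast]; exact hb
  · have := hT.exitTime_lt hz (hst k) (hst (k + 1))
    simp only [exitChain, Nat.add_sub_cancel]
    omega

omit [Countable (HNN φ)] [IsProbabilityMeasure μ] in
theorem Transversals.mem_blockTimes_of_pos {k : ℕ} (hk : 1 ≤ k) {s : Block G₀ × ℕ}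
    (h : 0 < seqLaw μ {z | exitChain X Y (coord φ) k z = s}) : s ∈ blockTimes A B X Y := by
  obtain ⟨z, hz, hz'⟩ := ((frequently_ae_mem_iff.mpr h.ne').and_eventually
    (hT.ae_exitChain_mem μ hsteps hstays hk)).exists
  exact Set.mem_of_eq_of_mem (Eq.symm hz) hz'

/-- The escape probabilities of the tails that occur are positive. -/
theorem Transversals.escape_pos {k : ℕ} (hk : 1 ≤ k) {s : Block G₀ × ℕ}
    (h : 0 < seqLaw μ {z | exitChain X Y (coord φ) k z = s}) :
    0 < seqLaw μ (escapeEvent φ s.1.sign s.1.tail) := by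
  by_contra h0
  have h0 : seqLaw μ (escapeEvent φ s.1.sign s.1.tail) = 0 := by simpa using h0
  refine h.ne' (measure_mono_null_ae (t := ⋃ N, shiftSeq N ⁻¹' escapeEvent φ s.1.sign s.1.tail)
    ?_ (measure_iUnion_null fun N => by
      rw [seqLaw_shiftSeq μ N (measurableSet_escapeEvent _ _), h0]))
  filter_upwards [hsteps, hstays] with z hz hst hzs
  obtain ⟨l₀, b, hl, -, hn, hp, hlast⟩ := hT.exitTime_block hk hz (hst k)
  have hb : s.1 = b := by
    rw [← hlast]; exact (congrArg Prod.fst hzs).symm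
  subst hl hb
  exact Set.mem_iUnion.mpr ⟨_, (hT.stays_iff hz hn hp).mp (stays_exitTime (hst _))⟩

theorem Transversals.exitChain_succ_pos_iff [Countable G₀] {k : ℕ} (hk : 1 ≤ k)
    {s : Block G₀ × ℕ} (hs : s ∈ blockTimes A B X Y) :
    0 < seqLaw μ {z | exitChain X Y (coord φ) (k + 1) z = s} ↔
      ∃ s₁, 0 < seqLaw μ {z | exitChain X Y (coord φ) k z = s₁} ∧
        0 < transProb X Y (seqLaw μ) (coord φ) s₁ s := by
  have key := fun s₁ => hT.exitChain_markov μ hsteps hstays hk (Φ := fun w => w k = s₁)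
    (fun w w' h hw => (h k hk le_rfl) ▸ hw) (fun _ hw => hw) hs.1 hs.2
  constructor
  · intro h
    obtain ⟨s₁, h₁⟩ := exists_pos_of_measure_pos _ (f := exitChain X Y (coord φ) k)
      (fun i => measurableSet_exitChain k {i}) h
    rw [Set.inter_comm] at h₁
    refine ⟨s₁, ?_⟩
    have h2 := (key s₁).symm.trans_gt h₁
    exact ⟨pos_iff_ne_zero.mpr (left_ne_zero_of_mul h2.ne'),
      pos_iff_ne_zero.mpr (right_ne_zero_of_mul h2.ne')⟩
  · rintro ⟨s₁, h1, h2⟩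
    have := ENNReal.mul_pos h1.ne' h2.ne'
    refine lt_of_lt_of_le ?_ (measure_mono (s := {z | exitChain X Y (coord φ) k z = s₁ ∧
      exitChain X Y (coord φ) (k + 1) z = s}) fun z hz => hz.2)
    exact (key s₁).trans_gt this

omit [IsProbabilityMeasure μ] in
/-- The state space consists of the states to which the chain can move from a possible first
state. -/
theorem Transversals.mem_stateSpace_iff [Countable G₀] {s : Block G₀ × ℕ} :
    s ∈ stateSpace X Y (seqLaw μ) (coord φ) ↔ s ∈ blockTimes A B X Y ∧
      0 < seqLaw μ {z | exitChain X Y (coord φ) 2 z = s} := by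
  constructor
  · rintro ⟨hs1, hs2, b₁, hb₁, hpos⟩
    refine ⟨⟨hs1, hs2⟩, lt_of_lt_of_le hpos (measure_mono_ae ?_)⟩
    filter_upwards [hsteps, hstays] with z hz hst hzE
    obtain ⟨-, h2, h3⟩ := hzE
    obtain ⟨l₀, b, hl, -, hn, hp, -⟩ := hT.exitTime_block (k := 2) (by omega) hz (hst 2)
    have hlen : tLength φ X Y (path z 1 (exitTime X Y (coord φ) 2 z)) = 2 := by
      rw [hp, ← word_concat_mul, hT.tLength_word φ hn, List.length_append]
      simpa using hl
    have hne : tPow φ b₁.sign * HNNExtension.of s.1.rep * tPow φ s.1.sign ≠ 1 := by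
      intro h1
      have h4 : path z 1 (exitTime X Y (coord φ) 2 z) = HNNExtension.of (b₁.rep * s.1.tail) := by
        refine Eq.trans h2 ?_
        calc _ = HNNExtension.of b₁.rep * (tPow φ b₁.sign * HNNExtension.of s.1.rep *
              tPow φ s.1.sign) * HNNExtension.of s.1.tail := by
              simp only [Block.val, tailVal, mul_assoc]
          _ = _ := by rw [h1, mul_one, map_mul]
      exact (hT.notMem_range_iff _).mpr (by omega) ⟨_, h4.symm⟩
    have hn' : IsNormal X Y ([(b₁.rep, b₁.sign)] ++ [(s.1.rep, s.1.sign)]) :=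
      isNormal_concat_iff (l := []).mpr ⟨isNormal_singleton_iff.mpr hb₁.1, hs1.1,
        (hT.tPow_mul_ne_one_iff hs1).mp hne⟩
    refine Prod.ext ?_ h3
    change lastBlock φ X Y (path z 1 (exitTime X Y (coord φ) 2 z)) = s.1
    rw [show path z 1 (exitTime X Y (coord φ) 2 z) = word φ [(b₁.rep, b₁.sign)] * s.1.val φ by
      rw [word_singleton]; exact h2]
    exact hT.lastBlock_eq φ hn'
  · rintro ⟨hs, hpos⟩
    obtain ⟨s₁, hs₁⟩ := exists_pos_of_measure_pos _ (f := exitChain X Y (coord φ) 1)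
      (fun i => measurableSet_exitChain 1 {i}) hpos
    have hb₁ := hT.mem_blockTimes_of_pos μ hsteps hstays le_rfl
      (lt_of_lt_of_le hs₁ (measure_mono Set.inter_subset_right))
    refine ⟨hs.1, hs.2, s₁.1, hb₁.1, lt_of_lt_of_le hs₁ (measure_mono_ae ?_)⟩
    filter_upwards [hsteps, hstays] with z hz hst hzE
    obtain ⟨h2, h1⟩ := hzE
    obtain ⟨l₀, b, hl, -, hn, hp, hlast⟩ := hT.exitTime_block le_rfl hz (hst 1)
    obtain rfl : l₀ = [] := List.eq_nil_of_length_eq_zero (by omega)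
    have hb : s₁.1 = b := by
      rw [← hlast]; exact (congrArg Prod.fst h1).symm
    subst hb
    obtain ⟨b', -, -, hp', hlast'⟩ := hT.exitTime_block_succ hz hn hp (stays_exitTime (hst 1))
      (hst 2) (hT.exitTime_lt hz (hst 1) (hst 2)).le
    have hb' : s.1 = b' := by
      rw [← hlast']; exact (congrArg Prod.fst h2).symm
    subst hb'
    refine ⟨?_, ?_, congrArg Prod.snd h2⟩
    · refine Eq.trans hp ?_
      simp [word]
    · refine Eq.trans hp' ?_
      rw [List.nil_append, word_singleton]

end

end HNNWalk

/-! ### The exit chain on its state space -/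

namespace HNNWalk

open scoped ENNReal

variable {G₀ : Type*} [Group G₀] {A B : Subgroup G₀} {X Y : Set G₀} {φ : A ≃* B}

instance instFiniteTails [Finite A] [Finite B] : Finite (Tails A B) := by
  refine Finite.of_injective (β := ℤˣ × ((A : Set G₀) ∪ B : Set G₀))
    (fun c => (c.1.1, ⟨c.1.2, ?_⟩)) fun c c' h => ?_
  · rcases Int.units_eq_one_or c.1.1 with h | h
    · exact Or.inr (by have := c.2; rwa [h] at this)
    · exact Or.inl (by have := c.2; rwa [h] at this)
  · simp only [Prod.mk.injEq, Subtype.mk.injEq] at h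
    exact Subtype.ext (Prod.ext h.1 h.2)

/-- A sum over a set of states, sorted by the tails of the states. -/
theorem tsum_eq_tsum_tails {S : Set (Block G₀ × ℕ)} (hS : S ⊆ blockTimes A B X Y)
    {f : Block G₀ × ℕ → ℝ≥0∞} (hf : ∀ s ∈ blockTimes A B X Y, s ∉ S → f s = 0) :
    ∑' s : S, f s = ∑' (c : Tails A B) (g : reps X Y c.1.1) (n : ℕ),
      f (⟨g, c.1.1, c.1.2⟩, n + 1) := by
  set e : (Σ c : Tails A B, reps X Y c.1.1 × ℕ) → Block G₀ × ℕ :=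
    fun x => (⟨x.2.1, x.1.1.1, x.1.1.2⟩, x.2.2 + 1) with he
  have hmem : ∀ x, e x ∈ blockTimes A B X Y := fun x => ⟨⟨x.2.1.2, x.1.2⟩, Nat.le_add_left 1 _⟩
  have hinj : Function.Injective e := by
    rintro ⟨⟨⟨ε, h⟩, hh⟩, ⟨g, hg⟩, n⟩ ⟨⟨⟨ε', h'⟩, hh'⟩, ⟨g', hg'⟩, n'⟩ hxy
    simp only [he, Prod.mk.injEq, Block.mk.injEq, Nat.add_right_cancel_iff] at hxy
    obtain ⟨⟨rfl, rfl, rfl⟩, rfl⟩ := hxy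
    rfl
  have hsupp : Function.support (S.indicator f) ⊆ Set.range e := by
    intro s hs
    obtain ⟨⟨h1, h2⟩, h3⟩ := hS (Set.mem_of_indicator_ne_zero hs)
    obtain ⟨n, hn⟩ := Nat.exists_eq_add_of_le' h3
    exact ⟨⟨⟨(s.1.sign, s.1.tail), h2⟩, ⟨s.1.rep, h1⟩, n⟩, Prod.ext rfl hn.symm⟩
  rw [tsum_subtype S f, ← hinj.tsum_eq hsupp, ENNReal.tsum_sigma']
  refine tsum_congr fun c => ?_
  rw [ENNReal.tsum_prod']
  refine tsum_congr fun g => tsum_congr fun n => ?_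
  by_cases h : e ⟨c, g, n⟩ ∈ S
  · rw [Set.indicator_of_mem h]
  · rw [Set.indicator_of_notMem h, ← hf _ (hmem _) h]

/-- The tails with positive escape probability. -/
abbrev LiveTails (φ : A ≃* B) (L : Measure (ℕ → HNN φ)) : Type _ :=
  {c : Tails A B // 0 < xi L (coord φ) c.1.1 c.1.2}

/-- The facts about the step law that determine which transitions of the exit chain are
possible. -/
structure StepData (X Y : Set G₀) (μ : Measure (HNN φ)) : Prop where
  ae_steps : ∀ᵐ z ∂seqLaw μ, ∀ i, z i ∈ stepSet φ
  ae_stays : ∀ᵐ z ∂seqLaw μ, ∀ k, ∃ m, Stays X Y k m z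
  base : ∀ x : G₀, ∃ l : List G₀, (∀ y ∈ l, 0 < μ {HNNExtension.of y}) ∧ l.prod = x
  tPow_pos : ∀ ε, 0 < μ {tPow φ ε}
  exists_rep : ∀ c c' : LiveTails φ (seqLaw μ),
    ∃ r ∈ reps X Y c'.1.1.1, r = 1 → c.1.1.1 = c'.1.1.1

section

variable (hT : Transversals A B X Y) {μ : Measure (HNN φ)} [IsProbabilityMeasure μ]
  [Countable (HNN φ)] [Countable G₀] (hμ : StepData X Y μ)
include hT hμ

omit [Countable G₀] in
/-- From every live tail, a state with any other live tail can be reached in one step. -/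
theorem Transversals.exists_transProb_pos (c c' : LiveTails φ (seqLaw μ)) :
    ∃ g ∈ reps X Y c'.1.1.1, ∃ n, 0 < transProb X Y (seqLaw μ) (coord φ) (tailState c.1)
      (⟨g, c'.1.1.1, c'.1.1.2⟩, n + 1) := by
  obtain ⟨g, hg, hg1⟩ := hμ.exists_rep c c'
  have hb : (⟨g, c'.1.1.1, c'.1.1.2⟩ : Block G₀) ∈ blocks A B X Y := ⟨hg, c'.1.2⟩
  obtain ⟨n, hn, hpos⟩ := hT.stepEvent_pos μ hμ.base hμ.tPow_pos c.1.1.1 c.1.1.2 hb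
  obtain ⟨n, rfl⟩ := Nat.exists_eq_add_of_le' hn
  refine ⟨g, hg, n, ?_⟩
  rw [transProb_eq (seqLaw μ) (s := tailState c.1) (s' := (⟨g, c'.1.1.1, c'.1.1.2⟩, n + 1))
    ((hT.tPow_mul_ne_one_iff hb).mpr hg1)]
  exact ENNReal.mul_pos (ENNReal.div_pos c'.2.ne' (measure_ne_top _ _)).ne' hpos.ne'

/-- Every live tail occurs at every exit time. -/
theorem Transversals.exists_exitChain_pos (c : LiveTails φ (seqLaw μ)) {k : ℕ} (hk : 1 ≤ k) :
    ∃ (g : G₀) (n : ℕ), 0 < seqLaw μ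
      {z | exitChain X Y (coord φ) k z = (⟨g, c.1.1.1, c.1.1.2⟩, n)} := by
  induction k, hk using Nat.le_induction with
  | base =>
    obtain ⟨n, -, hn⟩ := hT.exitChain_one_pos μ hμ.ae_steps hμ.base hμ.tPow_pos c.1.2 c.2
    exact ⟨1, n, hn⟩
  | succ k hk ih =>
    obtain ⟨g, n, hpos⟩ := ih
    obtain ⟨g', hg', n', hpos'⟩ := hT.exists_transProb_pos hμ c c
    exact ⟨g', n' + 1, (hT.exitChain_succ_pos_iff μ hμ.ae_steps hμ.ae_stays hk
      ⟨⟨hg', c.1.2⟩, by omega⟩).mpr ⟨_, hpos, hpos'⟩⟩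

theorem Transversals.exitChain_succ_pos_iff_liveTails {k : ℕ} (hk : 1 ≤ k) {s : Block G₀ × ℕ}
    (hs : s ∈ blockTimes A B X Y) :
    0 < seqLaw μ {z | exitChain X Y (coord φ) (k + 1) z = s} ↔
      ∃ c : LiveTails φ (seqLaw μ),
        0 < transProb X Y (seqLaw μ) (coord φ) (tailState c.1) s := by
  rw [hT.exitChain_succ_pos_iff μ hμ.ae_steps hμ.ae_stays hk hs]
  constructor
  · rintro ⟨s₁, h1, h2⟩
    exact ⟨⟨⟨(s₁.1.sign, s₁.1.tail),
      (hT.mem_blockTimes_of_pos μ hμ.ae_steps hμ.ae_stays hk h1).1.2⟩,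
      hT.escape_pos μ hμ.ae_steps hμ.ae_stays hk h1⟩, h2⟩
  · rintro ⟨c, hc⟩
    obtain ⟨g, n, h⟩ := hT.exists_exitChain_pos hμ c hk
    exact ⟨_, h, hc⟩

/-- The state space consists of the states that can be reached from a live tail. -/
theorem Transversals.mem_stateSpace_iff_liveTails {s : Block G₀ × ℕ} :
    s ∈ stateSpace X Y (seqLaw μ) (coord φ) ↔ s ∈ blockTimes A B X Y ∧
      ∃ c : LiveTails φ (seqLaw μ),
        0 < transProb X Y (seqLaw μ) (coord φ) (tailState c.1) s := by
  rw [hT.mem_stateSpace_iff μ hμ.ae_steps hμ.ae_stays]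
  exact and_congr_right fun hs => hT.exitChain_succ_pos_iff_liveTails hμ le_rfl hs

theorem Transversals.exitChain_pos_iff {k : ℕ} (hk : 2 ≤ k) (s : Block G₀ × ℕ) :
    0 < seqLaw μ {z | exitChain X Y (coord φ) k z = s} ↔
      s ∈ stateSpace X Y (seqLaw μ) (coord φ) := by
  obtain ⟨k, rfl⟩ := Nat.exists_eq_add_of_le' (show 1 ≤ k by omega)
  rw [hT.mem_stateSpace_iff_liveTails hμ]
  constructor
  · intro h
    have hs := hT.mem_blockTimes_of_pos μ hμ.ae_steps hμ.ae_stays (by omega) h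
    exact ⟨hs, (hT.exitChain_succ_pos_iff_liveTails hμ (by omega) hs).mp h⟩
  · rintro ⟨hs, h⟩
    exact (hT.exitChain_succ_pos_iff_liveTails hμ (by omega) hs).mpr h

theorem Transversals.ae_exitChain_mem_stateSpace {k : ℕ} (hk : 2 ≤ k) :
    ∀ᵐ z ∂seqLaw μ, exitChain X Y (coord φ) k z ∈ stateSpace X Y (seqLaw μ) (coord φ) := by
  rw [ae_iff]
  by_contra h
  obtain ⟨s, hs⟩ := exists_pos_of_measure_pos _ (f := exitChain X Y (coord φ) k)
    (fun i => measurableSet_exitChain k {i}) (pos_iff_ne_zero.mpr h)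
  obtain ⟨z, hz1, hz2⟩ := nonempty_of_measure_ne_zero hs.ne'
  refine hz1 ?_
  rw [show exitChain X Y (coord φ) k z = s from hz2]
  exact (hT.exitChain_pos_iff hμ hk s).mp
    (lt_of_lt_of_le hs (measure_mono Set.inter_subset_right))

omit hT hμ [Countable (HNN φ)] [Countable G₀] [IsProbabilityMeasure μ] in
theorem stateSpace_subset :
    stateSpace X Y (seqLaw μ) (coord φ) ⊆ blockTimes A B X Y := fun _ hs => ⟨hs.1, hs.2.1⟩

theorem Transversals.xi_pos_of_mem_stateSpace {s : Block G₀ × ℕ}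
    (hs : s ∈ stateSpace X Y (seqLaw μ) (coord φ)) :
    0 < xi (seqLaw μ) (coord φ) s.1.sign s.1.tail :=
  hT.escape_pos μ hμ.ae_steps hμ.ae_stays (k := 2) (by omega)
    ((hT.exitChain_pos_iff hμ le_rfl s).mpr hs)

theorem Transversals.transProb_eq_zero (c : LiveTails φ (seqLaw μ)) {s : Block G₀ × ℕ}
    (hs : s ∈ blockTimes A B X Y) (hs' : s ∉ stateSpace X Y (seqLaw μ) (coord φ)) :
    transProb X Y (seqLaw μ) (coord φ) (tailState c.1) s = 0 := by
  by_contra h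
  exact hs' ((hT.mem_stateSpace_iff_liveTails hμ).mpr ⟨hs, c, pos_iff_ne_zero.mpr h⟩)

theorem Transversals.tsum_transProb (c : LiveTails φ (seqLaw μ)) :
    ∑' s : stateSpace X Y (seqLaw μ) (coord φ),
      transProb X Y (seqLaw μ) (coord φ) (tailState c.1) s = 1 := by
  obtain ⟨g, n, hpos⟩ := hT.exists_exitChain_pos hμ c le_rfl
  set s₁ : Block G₀ × ℕ := (⟨g, c.1.1.1, c.1.1.2⟩, n) with hs₁
  set F : Set (ℕ → HNN φ) := {z | exitChain X Y (coord φ) 1 z = s₁} with hF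
  have key : seqLaw μ F = seqLaw μ F * ∑' s : stateSpace X Y (seqLaw μ) (coord φ),
      transProb X Y (seqLaw μ) (coord φ) (tailState c.1) s := by
    conv_lhs => rw [measure_eq_tsum_fiber _ (f := exitChain X Y (coord φ) 2)
      (fun i => measurableSet_exitChain 2 {i}) F]
    rw [← ENNReal.tsum_mul_left, tsum_subtype (stateSpace X Y (seqLaw μ) (coord φ))
      (fun s => seqLaw μ F * transProb X Y (seqLaw μ) (coord φ) (tailState c.1) s)]
    refine tsum_congr fun s => ?_
    by_cases hs : s ∈ stateSpace X Y (seqLaw μ) (coord φ)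
    · rw [Set.indicator_of_mem hs]
      exact hT.exitChain_markov μ hμ.ae_steps hμ.ae_stays le_rfl (s := s₁) (Φ := fun w => w 1 = s₁)
        (fun w w' h hw => (h 1 le_rfl le_rfl) ▸ hw) (fun _ hw => hw) hs.1 hs.2.1
    · rw [Set.indicator_of_notMem hs]
      refine measure_mono_null Set.inter_subset_right ?_
      by_contra h
      exact hs ((hT.exitChain_pos_iff hμ le_rfl s).mp (pos_iff_ne_zero.mpr h))
  exact (ENNReal.mul_eq_left hpos.ne' (measure_ne_top _ _)).mp key.symm

theorem Transversals.exists_liveTail : Nonempty (LiveTails φ (seqLaw μ)) := by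
  obtain ⟨s, hs⟩ := exists_pos_of_measure_pos (seqLaw μ) (f := exitChain X Y (coord φ) 1)
    (fun i => measurableSet_exitChain 1 {i}) (F := Set.univ) (by simp)
  have hs := lt_of_lt_of_le hs (measure_mono Set.inter_subset_right)
  exact ⟨⟨⟨(s.1.sign, s.1.tail),
    (hT.mem_blockTimes_of_pos μ hμ.ae_steps hμ.ae_stays le_rfl hs).1.2⟩,
    hT.escape_pos μ hμ.ae_steps hμ.ae_stays le_rfl hs⟩⟩

section

variable [Finite A] [Finite B]

open MarkovMatrix

theorem Transversals.chainMatrix_properties :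
    IsStochastic (chainMatrix X Y (seqLaw μ) (coord φ)) ∧
      IsIrreducible (chainMatrix X Y (seqLaw μ) (coord φ)) ∧
      IsAperiodic (chainMatrix X Y (seqLaw μ) (coord φ)) ∧
      IsPositiveRecurrent (chainMatrix X Y (seqLaw μ) (coord φ)) := by
  set k : LiveTails φ (seqLaw μ) → stateSpace X Y (seqLaw μ) (coord φ) → ℝ≥0∞ :=
    fun c s => transProb X Y (seqLaw μ) (coord φ) (tailState c.1) s with hk
  set τ : stateSpace X Y (seqLaw μ) (coord φ) → LiveTails φ (seqLaw μ) :=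
    fun s => ⟨⟨(s.1.1.sign, s.1.1.tail), s.2.1.2⟩, hT.xi_pos_of_mem_stateSpace hμ s.2⟩ with hτ
  have hQ : ∀ s s', chainMatrix X Y (seqLaw μ) (coord φ) s s' = k (τ s) s' := fun s s' => rfl
  have h1 : ∀ c, ∑' s, k c s = 1 := hT.tsum_transProb hμ
  have h2 : ∀ c c', ∃ s, τ s = c' ∧ 0 < k c s := by
    intro c c'
    obtain ⟨g, hg, n, hpos⟩ := hT.exists_transProb_pos hμ c c'
    exact ⟨⟨_, (hT.mem_stateSpace_iff_liveTails hμ).mpr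
      ⟨⟨⟨hg, c'.1.2⟩, Nat.le_add_left 1 n⟩, c, hpos⟩⟩, rfl, hpos⟩
  have h3 : ∀ s, ∃ c, 0 < k c s := fun s => ((hT.mem_stateSpace_iff_liveTails hμ).mp s.2).2
  exact ⟨isStochastic_of_finite hQ h1, isIrreducible_of_finite hQ h2 h3,
    isAperiodic_of_finite hQ h2 h3, isPositiveRecurrent_of_finite hQ h1 h2 h3⟩

/-! ### The invariant laws -/

omit hT hμ [Countable (HNN φ)] [Countable G₀] [IsProbabilityMeasure μ] [Finite A] [Finite B] in
theorem tailMatrix_eq_zero {c c' : Tails A B} (h : xi (seqLaw μ) (coord φ) c'.1.1 c'.1.2 = 0) :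
    tailMatrix X Y (seqLaw μ) (coord φ) c c' = 0 := by
  -- the factor `0 / ξ(c)` vanishes even if `ξ(c) = 0`
  simp [tailMatrix, transProb, h]

theorem Transversals.existsUnique_tailLaw :
    ∃! ν : Tails A B → ℝ≥0∞, IsInvariantLaw (tailMatrix X Y (seqLaw μ) (coord φ)) ν := by
  have := Fintype.ofFinite (Tails A B)
  obtain ⟨c₀⟩ := hT.exists_liveTail hμ
  refine existsUnique_isInvariantLaw (fun c => 0 < xi (seqLaw μ) (coord φ) c.1.1 c.1.2)
    ⟨c₀.1, c₀.2⟩ (fun c c' hc' => tailMatrix_eq_zero (by simpa using hc')) ?_ ?_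
  · intro c c' hc hc'
    obtain ⟨g, hg, n, hpos⟩ := hT.exists_transProb_pos hμ ⟨c, hc⟩ ⟨c', hc'⟩
    refine hpos.trans_le (le_trans ?_ (ENNReal.le_tsum (⟨g, hg⟩ : reps X Y c'.1.1)))
    exact ENNReal.le_tsum
      (f := fun n => transProb X Y (seqLaw μ) (coord φ) (tailState c)
        (⟨g, c'.1.1, c'.1.2⟩, n + 1)) n
  · intro c hc
    rw [← hT.tsum_transProb hμ ⟨c, hc⟩, tsum_eq_tsum_tails (stateSpace_subset)
      fun s hs hs' => hT.transProb_eq_zero hμ ⟨c, hc⟩ hs hs']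
    rfl

omit hT hμ [Countable (HNN φ)] [Countable G₀] [IsProbabilityMeasure μ] [Finite A] [Finite B] in
theorem tailLaw_eq_zero {ν : Tails A B → ℝ≥0∞}
    (hν : IsInvariantLaw (tailMatrix X Y (seqLaw μ) (coord φ)) ν) (c : Tails A B)
    (hc : xi (seqLaw μ) (coord φ) c.1.1 c.1.2 = 0) : ν c = 0 := by
  rw [← hν.2 c]
  simp [tailMatrix_eq_zero hc]

omit [Finite A] [Finite B] in
theorem Transversals.isInvariantLaw_piLaw {ν : Tails A B → ℝ≥0∞}
    (hν : IsInvariantLaw (tailMatrix X Y (seqLaw μ) (coord φ)) ν) :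
    IsInvariantLaw (chainMatrix X Y (seqLaw μ) (coord φ))
      (piLaw X Y (seqLaw μ) (coord φ) ν) := by
  constructor
  · simp only [piLaw]
    rw [ENNReal.tsum_comm, ← hν.1]
    refine tsum_congr fun c => ?_
    rw [ENNReal.tsum_mul_left]
    by_cases hc : 0 < xi (seqLaw μ) (coord φ) c.1.1 c.1.2
    · rw [hT.tsum_transProb hμ ⟨c, hc⟩, mul_one]
    · rw [tailLaw_eq_zero hν c (by simpa using hc), zero_mul]
  · intro s'
    simp only [piLaw, chainMatrix]
    rw [tsum_eq_tsum_tails (S := stateSpace X Y (seqLaw μ) (coord φ))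
      (f := fun s => (∑' c : Tails A B, ν c * transProb X Y (seqLaw μ) (coord φ) (tailState c) s) *
        transProb X Y (seqLaw μ) (coord φ) s s') (stateSpace_subset) ?_]
    · refine tsum_congr fun c' => ?_
      conv_rhs => rw [← hν.2 c']
      have h : ∀ (g : reps X Y c'.1.1) (n : ℕ),
          transProb X Y (seqLaw μ) (coord φ) (⟨g, c'.1.1, c'.1.2⟩, n + 1) s' =
            transProb X Y (seqLaw μ) (coord φ) (tailState c') s' := fun _ _ => rfl
      simp only [h, ENNReal.tsum_mul_right]
      congr 1
      simp only [tailMatrix, ← ENNReal.tsum_mul_left]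
      conv_rhs => rw [ENNReal.tsum_comm]
      refine tsum_congr fun g => ?_
      conv_rhs => rw [ENNReal.tsum_comm]
    · intro s hs hs'
      refine mul_eq_zero_of_left (ENNReal.tsum_eq_zero.mpr fun c => ?_) _
      by_cases hc : 0 < xi (seqLaw μ) (coord φ) c.1.1 c.1.2
      · rw [hT.transProb_eq_zero hμ ⟨c, hc⟩ hs hs', mul_zero]
      · rw [tailLaw_eq_zero hν c (by simpa using hc), zero_mul]

end

end

end HNNWalk

/-! ### From the sequence space to the given probability space -/

namespace HNNWalk

open scoped ENNReal

variable {G₀ : Type*} [Group G₀] {A B : Subgroup G₀} {X Y : Set G₀} {φ : A ≃* B}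

theorem ne_top_or_eq_top [Finite A] [Finite B] (φ : A ≃* B) :
    (A ≠ ⊤ ∧ B ≠ ⊤) ∨ (A = ⊤ ∧ B = ⊤) := by
  have hcard : Nat.card A = Nat.card B := Nat.card_congr φ.toEquiv
  have key : A = ⊤ ↔ B = ⊤ := by
    constructor
    · rintro rfl
      have : Finite G₀ := Finite.of_equiv _ Subgroup.topEquiv.toEquiv
      exact Subgroup.eq_top_of_card_eq _ (by rw [← hcard, Subgroup.card_top])
    · rintro rfl
      have : Finite G₀ := Finite.of_equiv _ Subgroup.topEquiv.toEquiv
      exact Subgroup.eq_top_of_card_eq _ (by rw [hcard, Subgroup.card_top])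
  tauto

theorem Transversals.stepData (hT : Transversals A B X Y) [Finite A] [Finite B] (φ : A ≃* B)
    [Countable (HNN φ)] (μ₀ : PMF G₀) (hgen : Subsemigroup.closure μ₀.support = ⊤)
    {α p : ℝ} (hα : α ∈ Set.Ioo (0 : ℝ) 1) (hp : p ∈ Set.Ioo (0 : ℝ) 1)
    (htrans : ¬ (A = ⊤ ∧ B = ⊤ ∧ p = 1 / 2)) : StepData (φ := φ) X Y (stepLaw φ μ₀ α p) where
  ae_steps :=
    have := isProbabilityMeasure_stepLaw φ μ₀ hα hp
    ae_forall_mem_stepSet (ae_mem_stepSet φ μ₀)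
  ae_stays := hT.ae_exists_stays φ μ₀ hgen hα hp (by
    rcases ne_top_or_eq_top φ with h | h
    · exact Or.inl h
    · exact Or.inr fun h2 => htrans ⟨h.1, h.2, h2⟩)
  base x := by
    obtain ⟨l, hl, hx⟩ := exists_list_of_generation hgen x
    exact ⟨l, fun y hy => stepLaw_of_pos φ μ₀ hα (hl y hy), hx⟩
  tPow_pos := stepLaw_tPow_pos φ μ₀ hα hp
  exists_rep c c' := by
    rcases ne_top_or_eq_top φ with h | h
    · obtain ⟨r, hr, hr1⟩ := hT.exists_rep_ne_one (ε := c'.1.1.1) (by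
        rcases Int.units_eq_one_or c'.1.1.1 with h' | h' <;> rw [h']
        · exact h.1
        · exact h.2)
      exact ⟨r, hr, fun h1 => absurd h1 hr1⟩
    · obtain ⟨ε₀, hε₀⟩ := hT.exists_sign_of_escape φ μ₀ hα hp
        (fun h2 => htrans ⟨h.1, h.2, h2⟩) h.1 h.2
      exact ⟨1, hT.one_mem _, fun _ => (hε₀ _ _ c.2).trans (hε₀ _ _ c'.2).symm⟩

section

variable {Ω : Type*} [MeasurableSpace Ω] (P : Measure Ω) (ζ : ℕ → Ω → HNN φ)

omit [MeasurableSpace Ω] in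
theorem exitTime_eq_coord (k : ℕ) (ω : Ω) :
    exitTime X Y ζ k ω = exitTime X Y (coord φ) k fun i => ζ i ω := by
  unfold exitTime
  congr 1
  ext m
  refine forall_congr' fun n => ?_
  rw [walk_eq_path]

omit [MeasurableSpace Ω] in
theorem exitChain_eq_coord (k : ℕ) (ω : Ω) :
    exitChain X Y ζ k ω = exitChain X Y (coord φ) k fun i => ζ i ω := by
  rw [exitChain, exitChain, exitTime_eq_coord ζ k, exitTime_eq_coord ζ (k - 1),
    walk_eq_path ζ]

variable [Countable (HNN φ)] {P} {ζ} {L : Measure (ℕ → HNN φ)}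
  (hL : ∀ E : Set (ℕ → HNN φ), MeasurableSet E → P {ω | (fun i => ζ i ω) ∈ E} = L E)
include hL

theorem xi_eq_coord : xi P ζ = xi L (coord φ) := by
  funext ε h
  rw [xi_coord, ← hL _ (measurableSet_escapeEvent ε h)]
  simp only [xi, escapeEvent, walk_eq_path ζ]
  rfl

theorem transProb_eq_coord : transProb X Y P ζ = transProb X Y L (coord φ) := by
  funext s s'
  unfold transProb
  rw [xi_eq_coord hL]
  congr 2
  rw [show {ω | walk (coord φ) (tailVal φ s.1.sign s.1.tail) s'.2 ω = tPow φ s.1.sign * s'.1.val φ ∧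
        tLength φ X Y (walk (coord φ) (tailVal φ s.1.sign s.1.tail) (s'.2 - 1) ω) = 1 ∧
        ∀ n, n < s'.2 → 1 ≤ tLength φ X Y (walk (coord φ) (tailVal φ s.1.sign s.1.tail) n ω)} =
      stepEvent φ X Y s.1.sign s.1.tail s'.1 s'.2 from rfl,
    ← hL _ (decidedBy_stepEvent _ _ _ _).measurableSet]
  simp only [stepEvent, walk_eq_path ζ]
  rfl

theorem stateSpace_eq_coord : stateSpace X Y P ζ = stateSpace X Y L (coord φ) := by
  ext s
  refine and_congr_right fun _ => and_congr_right fun _ => exists_congr fun b₁ =>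
    and_congr_right fun _ => ?_
  rw [← hL]
  · simp only [exitTime_eq_coord ζ, walk_eq_path ζ]
    rfl
  · have h := ((measurable_path_exitTime (φ := φ) (X := X) (Y := Y) 1).prodMk
      ((measurable_path_exitTime (φ := φ) (X := X) (Y := Y) 2).prodMk
        ((measurable_exitTime (φ := φ) (X := X) (Y := Y) 1).prodMk
          (measurable_exitTime (φ := φ) (X := X) (Y := Y) 2))))
    exact h (t := {x : HNN φ × HNN φ × ℕ × ℕ | x.1 = b₁.val φ ∧
      x.2.1 = HNNExtension.of b₁.rep * tPow φ b₁.sign * s.1.val φ ∧ x.2.2.2 - x.2.2.1 = s.2})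
      (Set.to_countable _).measurableSet

omit [Countable (HNN φ)] in
theorem ae_of_coord {p : (ℕ → HNN φ) → Prop} (hp : MeasurableSet {z | p z})
    (h : ∀ᵐ z ∂L, p z) : ∀ᵐ ω ∂P, p fun i => ζ i ω := by
  rw [ae_iff] at h ⊢
  rw [← h]
  exact hL _ hp.compl

omit hL in
/-- The Markov property of the exit chain, in terms of conditional probabilities. -/
theorem Transversals.cond_exitChain (hT : Transversals A B X Y) {μ : Measure (HNN φ)}
    [IsProbabilityMeasure μ] [IsFiniteMeasure P] (hmeas : ∀ i, Measurable (ζ i))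
    (hL : ∀ E : Set (ℕ → HNN φ), MeasurableSet E → P {ω | (fun i => ζ i ω) ∈ E} = seqLaw μ E)
    (hsteps : ∀ᵐ z ∂seqLaw μ, ∀ i, z i ∈ stepSet φ)
    (hstays : ∀ᵐ z ∂seqLaw μ, ∀ k, ∃ m, Stays X Y k m z) {k : ℕ} (hk : 1 ≤ k)
    {Φ : (ℕ → Block G₀ × ℕ) → Prop} {s s' : Block G₀ × ℕ}
    (hΦ : ∀ w w', (∀ j, 1 ≤ j → j ≤ k → w j = w' j) → Φ w → Φ w') (hs : ∀ w, Φ w → w k = s)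
    (hm : MeasurableSet {z | Φ fun j => exitChain X Y (coord φ) j z})
    (hs' : s' ∈ stateSpace X Y (seqLaw μ) (coord φ))
    (hpos : 0 < P {ω | Φ fun j => exitChain X Y ζ j ω}) :
    ProbabilityTheory.cond P {ω | Φ fun j => exitChain X Y ζ j ω}
      {ω | exitChain X Y ζ (k + 1) ω = s'} = transProb X Y (seqLaw μ) (coord φ) s s' := by
  have hset : MeasurableSet {ω | Φ fun j => exitChain X Y ζ j ω} := by
    simp only [exitChain_eq_coord ζ]
    exact measurable_pi_lambda _ hmeas hm
  have h1 : P {ω | Φ fun j => exitChain X Y ζ j ω} =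
      seqLaw μ {z | Φ fun j => exitChain X Y (coord φ) j z} := by
    rw [← hL _ hm]
    simp only [exitChain_eq_coord ζ]
    rfl
  have h2 : P ({ω | Φ fun j => exitChain X Y ζ j ω} ∩ {ω | exitChain X Y ζ (k + 1) ω = s'}) =
      seqLaw μ {z | (Φ fun j => exitChain X Y (coord φ) j z) ∧
        exitChain X Y (coord φ) (k + 1) z = s'} := by
    rw [← hL {z | (Φ fun j => exitChain X Y (coord φ) j z) ∧
        exitChain X Y (coord φ) (k + 1) z = s'}
      (hm.inter (measurableSet_exitChain (k + 1) {s'}))]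
    simp only [exitChain_eq_coord ζ]
    rfl
  rw [ProbabilityTheory.cond_apply hset, h2, hT.exitChain_markov μ hsteps hstays hk hΦ
    hs hs'.1 hs'.2.1, ← h1, ← mul_assoc, ENNReal.inv_mul_cancel hpos.ne' (measure_ne_top _ _),
    one_mul]

end

theorem measure_steps_mem {α Ω : Type*} [MeasurableSpace α] [MeasurableSpace Ω] {P : Measure Ω}
    [IsProbabilityMeasure P] {μ : Measure α} {ζ : ℕ → Ω → α} (hmeas : ∀ i, Measurable (ζ i))
    (hindep : ProbabilityTheory.iIndepFun ζ P) (hlaw : ∀ i, P.map (ζ i) = μ)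
    {E : Set (ℕ → α)} (hE : MeasurableSet E) :
    P {ω | (fun i => ζ i ω) ∈ E} = seqLaw μ E := by
  have h := (ProbabilityTheory.iIndepFun_iff_map_fun_eq_infinitePi_map hmeas).mp hindep
  simp only [hlaw] at h
  rw [seqLaw, ← h, Measure.map_apply (measurable_pi_lambda _ hmeas) hE]
  rfl

end HNNWalk

theorem proposition4p1 {G₀ : Type*} [Group G₀] {A B : Subgroup G₀} [Finite A] [Finite B]
    (φ : A ≃* B) (X Y : Set G₀)
    (hX : Subgroup.IsComplement X (A : Set G₀)) (hX1 : (1 : G₀) ∈ X)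
    (hY : Subgroup.IsComplement Y (B : Set G₀)) (hY1 : (1 : G₀) ∈ Y)
    (μ₀ : PMF G₀) (hfin : μ₀.support.Finite) (hgen : Subsemigroup.closure μ₀.support = ⊤)
    (α p : ℝ) (hα : α ∈ Set.Ioo (0 : ℝ) 1) (hp : p ∈ Set.Ioo (0 : ℝ) 1)
    (htrans : ¬ (A = ⊤ ∧ B = ⊤ ∧ p = 1 / 2))
    {Ω : Type*} [MeasurableSpace Ω] (P : Measure Ω) [IsProbabilityMeasure P]
    (ζ : ℕ → Ω → HNN φ) (hmeas : ∀ i, Measurable (ζ i))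
    (hindep : ProbabilityTheory.iIndepFun ζ P)
    (hlaw : ∀ i, P.map (ζ i) = stepLaw φ μ₀ α p) :
    -- the exit times are finite, and the pairs are blocks with positive increments
    (∀ k, ∀ᵐ ω ∂P, ∃ m, ∀ n, m ≤ n → k ≤ tLength φ X Y (walk ζ 1 n ω)) ∧
    (∀ k, 1 ≤ k → ∀ᵐ ω ∂P,
      (exitChain X Y ζ k ω).1 ∈ blocks A B X Y ∧ 1 ≤ (exitChain X Y ζ k ω).2) ∧
    -- from the second pair on, the values are exactly the elements of the state space
    (∀ k, 2 ≤ k → (∀ᵐ ω ∂P, exitChain X Y ζ k ω ∈ stateSpace X Y P ζ) ∧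
      ∀ s, 0 < P {ω | exitChain X Y ζ k ω = s} ↔ s ∈ stateSpace X Y P ζ) ∧
    -- the Markov property, with the explicit transition probabilities
    (∀ k, 1 ≤ k → ∀ s : ℕ → Block G₀ × ℕ, ∀ s' ∈ stateSpace X Y P ζ,
      0 < P {ω | ∀ j, 1 ≤ j → j ≤ k → exitChain X Y ζ j ω = s j} →
      ProbabilityTheory.cond P {ω | ∀ j, 1 ≤ j → j ≤ k → exitChain X Y ζ j ω = s j}
        {ω | exitChain X Y ζ (k + 1) ω = s'} = transProb X Y P ζ (s k) s') ∧
    (∀ k, 1 ≤ k → ∀ s, ∀ s' ∈ stateSpace X Y P ζ,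
      0 < P {ω | exitChain X Y ζ k ω = s} →
      ProbabilityTheory.cond P {ω | exitChain X Y ζ k ω = s}
        {ω | exitChain X Y ζ (k + 1) ω = s'} = transProb X Y P ζ s s') ∧
    IsStochastic (chainMatrix X Y P ζ) ∧
    IsIrreducible (chainMatrix X Y P ζ) ∧
    IsAperiodic (chainMatrix X Y P ζ) ∧
    -- positive recurrence and the invariant law
    IsPositiveRecurrent (chainMatrix X Y P ζ) ∧
    (∃! ν : Tails A B → ENNReal, IsInvariantLaw (tailMatrix X Y P ζ) ν) ∧
    (∀ ν : Tails A B → ENNReal, IsInvariantLaw (tailMatrix X Y P ζ) ν →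
      (∀ c : Tails A B, xi P ζ c.1.1 c.1.2 = 0 → ν c = 0) ∧
      IsInvariantLaw (chainMatrix X Y P ζ) (piLaw X Y P ζ ν)) := by
  have hT : Transversals A B X Y := ⟨hX, hY, hX1, hY1⟩
  have : Countable G₀ := countable_of_generation hgen
  have : Countable (HNN φ) := hT.countable φ
  have := isProbabilityMeasure_stepLaw φ μ₀ hα hp
  have hμ := hT.stepData φ μ₀ hgen hα hp htrans
  have hL : ∀ E : Set (ℕ → HNN φ), MeasurableSet E → P {ω | (fun i => ζ i ω) ∈ E} =
      seqLaw (stepLaw φ μ₀ α p) E := fun E hE => measure_steps_mem hmeas hindep hlaw hE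
  have hS := stateSpace_eq_coord (X := X) (Y := Y) hL
  have hQ := transProb_eq_coord (X := X) (Y := Y) hL
  have hξ := xi_eq_coord hL
  have hproj : ∀ k (S : Set (Block G₀ × ℕ)), P {ω | exitChain X Y ζ k ω ∈ S} =
      seqLaw (stepLaw φ μ₀ α p) {z | exitChain X Y (coord φ) k z ∈ S} := fun k S => by
    rw [← hL _ (measurableSet_exitChain k S)]
    simp only [exitChain_eq_coord ζ]
    rfl
  unfold chainMatrix tailMatrix piLaw
  rw [hξ, hQ, hS]
  obtain ⟨h1, h2, h3, h4⟩ := hT.chainMatrix_properties hμ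
  refine ⟨fun k => ?_, fun k hk => ?_, fun k hk => ⟨?_, fun s => ?_⟩, ?_, ?_, h1, h2, h3, h4,
    hT.existsUnique_tailLaw hμ, fun ν hν => ⟨tailLaw_eq_zero hν, hT.isInvariantLaw_piLaw hμ hν⟩⟩
  · have h := ae_of_coord hL (p := fun z => ∃ m, Stays X Y k m z)
      (by
        simpa only [Set.ofPred_exists] using MeasurableSet.iUnion fun m => measurableSet_stays k m)
      (hμ.ae_stays.mono fun z hz => hz k)
    simpa only [Stays, ← walk_eq_path] using h
  · have h := ae_of_coord hL (measurableSet_exitChain k _)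
      (hT.ae_exitChain_mem _ hμ.ae_steps hμ.ae_stays hk)
    simp only [← exitChain_eq_coord] at h
    exact h
  · have h := ae_of_coord hL (measurableSet_exitChain k _)
      (hT.ae_exitChain_mem_stateSpace hμ hk)
    simpa only [← exitChain_eq_coord] using h
  · rw [← hT.exitChain_pos_iff hμ hk s]
    exact iff_of_eq (congrArg (0 < ·) (hproj k {s}))
  · intro k hk s s' hs' hpos
    refine hT.cond_exitChain hmeas hL hμ.ae_steps hμ.ae_stays hk
      (Φ := fun w => ∀ j, 1 ≤ j → j ≤ k → w j = s j)
      (fun w w' h hw j hj hjk => (h j hj hjk) ▸ hw j hj hjk) (fun w hw => hw k hk le_rfl)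
      ?_ hs' hpos
    have : {z : ℕ → HNN φ | ∀ j, 1 ≤ j → j ≤ k → exitChain X Y (coord φ) j z = s j} =
        ⋂ j, ⋂ _ : 1 ≤ j, ⋂ _ : j ≤ k, {z | exitChain X Y (coord φ) j z ∈ ({s j} : Set _)} := by
      ext z; simp
    rw [this]
    exact MeasurableSet.iInter fun j => MeasurableSet.iInter fun _ => MeasurableSet.iInter fun _ =>
      measurableSet_exitChain j _
  · intro k hk s s' hs' hpos
    exact hT.cond_exitChain hmeas hL hμ.ae_steps hμ.ae_stays hk (Φ := fun w => w k = s)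
      (fun w w' h hw => (h k hk le_rfl) ▸ hw) (fun w hw => hw) (measurableSet_exitChain k {s})
      hs' hpos
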